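/- Let $F$ be a C*-algebra, $\omega$ a state of $F$ with GNS triple $(\pi_\omega,H_\omega,\Omega_\omega)$, and let $C\subseteq\pi_\omega(F)'$ be a commutative von Neumann algebra on $H_\omega$ (containing the identity). Let $X$ be the spectrum of $C$, $\Phi:C\to C(X)$ the Gelfand isomorphism and $e\in C'$ the orthogonal projection onto $\overline{C\Omega_\omega}$. For every $A\in C'$ there is a unique $E(A)\in C$ with $e\,E(A)=eAe$; put $\psi_x(A):=\Phi(E(A))(x)$ for $x\in X$. Each $\psi_x$ is a state of $C'$; let $(\pi_{\psi_x},H_{\psi_x},\Omega_{\psi_x})$ be its GNS triple. Let $\Gamma_0$ be the C*-algebra of bounded sections $a=(a(x))_{x\in X}$, $a(x)\in B(H_{\psi_x})$, with pointwise operations and supremum norm. For $A\in C'$ let $\Pi(A)\in\Gamma_0$ be the section $x\mapsto\pi_{\psi_x}(A)$. Let $\tilde L\subseteq\Gamma_0$ be the C*-algebra generated by the sections of rank-one operators $$x\mapsto \pi_{\psi_x}(A)\Omega_{\psi_x}\,\bigl(\pi_{\psi_x}(B)\Omega_{\psi_x},\,\cdot\,\bigr),\qquad A,B\in C',$$ and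 let $\tilde L(x):=\{a(x): a\in\tilde L\}$. Then $\tilde L(x)=K(H_{\psi_x})$, the compact operators, for every $x\in X$. Moreover, for every state $\gamma$ of $\tilde L$: (a) There are a regular Borel probability measure $\nu$ on $X$ and a $\nu$-almost everywhere defined family of states $\rho_x$ of $\tilde L(x)$ such that, for all $a\in\tilde L$, $x\mapsto\rho_x(a(x))$ is $\nu$-integrable and $$\gamma(a)=\int_X\rho_x(a(x))\,d\nu(x).$$ (b) There are a regular Borel probability measure $\nu$ on $X$ and a $\nu$-almost everywhere defined family of density operators $T_x$ on $H_{\psi_x}$ (compact, positive, trace class, of trace $1$) such that, for all $a\in\tilde L$, $x\mapsto\mathrm{Tr}(a(x)T_x)$ is $\nu$-integrable and $$\gamma(a)=\int_X\mathrm{Tr}(a(x)T_x)\,d\nu(x).$$ (c) $\gamma$ has a unique extension to a state $\tilde\gamma$ of the C*-subalgebra of $\Gamma_0$ generated by $\tilde L$ and $\Pi(C')$. Put $\theta(\gamma)(A):=\tilde\gamma(\Pi(A))$ for $A\in C'$. Then for every Borel probability measure $\nu$ on $X$ and every family $T_x$ that represent $\gamma$ as in (b), and all $A\in C'$, the function $x\mapsto\mathrm{Tr}(\pi_{\psi_x}(A)T_x)$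 is $\nu$-integrable and $$\theta(\gamma)(A)=\int_X\mathrm{Tr}\bigl(\pi_{\psi_x}(A)\,T_x\bigr)\,d\nu(x).$$ -/

import Mathlib

open scoped ComplexOrder ENNReal InnerProductSpace
open MeasureTheory

universe u

namespace HostAlgebra

/-- A state of a (possibly non-unital) C*-algebra: a positive functional of norm one. -/
structure IsState {A : Type*} [NonUnitalNormedRing A] [StarRing A] [NormedSpace ℂ A]
    (φ : A →L[ℂ] ℂ) : Prop where
  nonneg : ∀ a, 0 ≤ φ (star a * a)
  norm_eq_one : ‖φ‖ = 1

section GNS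

section NonUnital

variable {A : Type u} [NonUnitalCStarAlgebra A] [PartialOrder A] [StarOrderedRing A]

/-- The GNS Hilbert space of a positive functional. -/
def GNSSpace (f : A →ₚ[ℂ] ℂ) : Type u := f.GNS

noncomputable instance (f : A →ₚ[ℂ] ℂ) : NormedAddCommGroup (GNSSpace f) :=
  inferInstanceAs (NormedAddCommGroup f.GNS)

noncomputable instance (f : A →ₚ[ℂ] ℂ) : InnerProductSpace ℂ (GNSSpace f) :=
  inferInstanceAs (InnerProductSpace ℂ f.GNS)

instance (f : A →ₚ[ℂ] ℂ) : CompleteSpace (GNSSpace f) :=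
  inferInstanceAs (CompleteSpace f.GNS)

/-- The class of `a` in the GNS space. -/
noncomputable def gnsClass (f : A →ₚ[ℂ] ℂ) : A →ₗ[ℂ] GNSSpace f :=
  (UniformSpace.Completion.toComplL (𝕜 := ℂ) (E := f.PreGNS)).toLinearMap ∘ₗ
    f.toPreGNS.toLinearMap

/-- The GNS representation of a C*-algebra that need not be unital:
`gnsRep' f a [b] = [a b]`. -/
noncomputable def gnsRep' (f : A →ₚ[ℂ] ℂ) : A →⋆ₙₐ[ℂ] (GNSSpace f →L[ℂ] GNSSpace f) :=
  f.gnsNonUnitalStarAlgHom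

lemma gnsRep'_class (f : A →ₚ[ℂ] ℂ) (a b : A) :
    gnsRep' f a (gnsClass f b) = gnsClass f (a * b) :=
  f.gnsNonUnitalStarAlgHom_apply_coe

lemma inner_gnsClass (f : A →ₚ[ℂ] ℂ) (a b : A) :
    ⟪gnsClass f a, gnsClass f b⟫_ℂ = f (star a * b) :=
  UniformSpace.Completion.inner_coe (𝕜 := ℂ) (f.toPreGNS a) (f.toPreGNS b)

lemma denseRange_gnsClass (f : A →ₚ[ℂ] ℂ) : DenseRange (gnsClass f) :=
  UniformSpace.Completion.denseRange_coe.comp f.toPreGNS.surjective.denseRange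
    (UniformSpace.Completion.continuous_coe _)

/-- A state as a positive linear map. -/
noncomputable def IsState.toPositive {ω : A →L[ℂ] ℂ} (h : IsState ω) : A →ₚ[ℂ] ℂ :=
  PositiveLinearMap.mk₀ ω.toLinearMap fun a ha => by
    obtain ⟨b, rfl⟩ := CStarAlgebra.nonneg_iff_eq_star_mul_self.mp ha
    exact h.nonneg b

lemma IsState.norm_le_class {ω : A →L[ℂ] ℂ} (h : IsState ω) (a : A) :
    ‖ω a‖ ≤ 1 * ‖gnsClass h.toPositive a‖ := by
  have l : Filter.Tendsto (fun u => ‖ω (u * a)‖) (CStarAlgebra.approximateUnit A)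
      (nhds ‖ω a‖) :=
    ((ω.continuous.tendsto _).comp
      ((CStarAlgebra.increasingApproximateUnit A).tendsto_mul_right a)).norm
  refine le_of_tendsto l ?_
  filter_upwards [(CStarAlgebra.increasingApproximateUnit A).eventually_norm] with u hu
  have h1 : ω (u * a) = ⟪gnsClass h.toPositive (star u), gnsClass h.toPositive a⟫_ℂ := by
    rw [inner_gnsClass, star_star]
    rfl
  have h2 : ‖gnsClass h.toPositive (star u)‖ ≤ 1 := by
    have h3 : ‖gnsClass h.toPositive (star u)‖ ^ 2 ≤ 1 := by
      have h4 := inner_self_eq_norm_sq_to_K (𝕜 := ℂ) (gnsClass h.toPositive (star u))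
      rw [inner_gnsClass, star_star] at h4
      have h5 : ‖h.toPositive (u * star u)‖ ≤ 1 := by
        calc ‖ω (u * star u)‖ ≤ ‖ω‖ * ‖u * star u‖ := ω.le_opNorm _
          _ ≤ 1 * (1 * 1) := by
            rw [h.norm_eq_one]
            gcongr
            refine (norm_mul_le _ _).trans ?_
            rw [norm_star]
            exact mul_le_mul hu hu (norm_nonneg _) zero_le_one
          _ = 1 := by norm_num
      rw [h4] at h5
      simpa using h5
    nlinarith [norm_nonneg (gnsClass h.toPositive (star u))]
  rw [h1]
  exact (norm_inner_le_norm _ _).trans (mul_le_mul_of_nonneg_right h2 (norm_nonneg _))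

/-- The cyclic GNS vector `Ω_ω` of a state `ω`: the vector with `(Ω_ω, [a]) = ω(a)`. -/
noncomputable def IsState.cyclicVector {ω : A →L[ℂ] ℂ} (h : IsState ω) :
    GNSSpace h.toPositive :=
  (InnerProductSpace.toDual ℂ (GNSSpace h.toPositive)).symm
    (ω.toLinearMap.extendOfNorm (gnsClass h.toPositive))

lemma IsState.inner_cyclicVector {ω : A →L[ℂ] ℂ} (h : IsState ω) (a : A) :
    ⟪h.cyclicVector, gnsClass h.toPositive a⟫_ℂ = ω a := by
  rw [cyclicVector, InnerProductSpace.toDual_symm_apply]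
  exact LinearMap.extendOfNorm_eq (f := ω.toLinearMap) (denseRange_gnsClass _)
    ⟨1, h.norm_le_class⟩ a

lemma IsState.rep_cyclicVector {ω : A →L[ℂ] ℂ} (h : IsState ω) (a : A) :
    gnsRep' h.toPositive a h.cyclicVector = gnsClass h.toPositive a := by
  refine ext_inner_right ℂ fun z => ?_
  refine (denseRange_gnsClass h.toPositive).induction_on (p := fun z =>
    ⟪gnsRep' h.toPositive a h.cyclicVector, z⟫_ℂ = ⟪gnsClass h.toPositive a, z⟫_ℂ) z ?_ ?_
  · exact isClosed_eq (continuous_const.inner continuous_id) (continuous_const.inner continuous_id)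
  · intro b
    have hs : ContinuousLinearMap.adjoint (gnsRep' h.toPositive a)
        = gnsRep' h.toPositive (star a) := (map_star (gnsRep' h.toPositive) a).symm
    rw [← ContinuousLinearMap.adjoint_inner_right, hs, gnsRep'_class, h.inner_cyclicVector,
      inner_gnsClass]
    rfl

end NonUnital

variable {A : Type u} [CStarAlgebra A] [PartialOrder A] [StarOrderedRing A]

/-- The GNS representation of a unital C*-algebra. -/
noncomputable def gnsRep (f : A →ₚ[ℂ] ℂ) : A →⋆ₐ[ℂ] (GNSSpace f →L[ℂ] GNSSpace f) :=
  f.gnsStarAlgHom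

/-- The GNS vector of a positive functional on a unital C*-algebra: the class of `1`. -/
noncomputable def gnsVec (f : A →ₚ[ℂ] ℂ) : GNSSpace f := gnsClass f 1

lemma norm_gnsVec (f : A →ₚ[ℂ] ℂ) : ‖gnsVec f‖ = √(f 1).re := by
  have h : ‖gnsVec f‖ = ‖f.toPreGNS 1‖ := UniformSpace.Completion.norm_coe _
  rw [h, PositiveLinearMap.preGNS_norm_def]
  simp

end GNS

section Sections

variable {X : Type u} (K : X → Type u) [∀ x, NormedAddCommGroup (K x)]
  [∀ x, InnerProductSpace ℂ (K x)] [∀ x, CompleteSpace (K x)]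

/-- The C*-algebra of bounded sections of the bundle with fibres `B(K_x)`, with pointwise
operations and the supremum norm. -/
def BddSections : Type u := lp (fun x => K x →L[ℂ] K x) ∞

noncomputable instance : NonUnitalCStarAlgebra (BddSections K) :=
  inferInstanceAs (NonUnitalCStarAlgebra (lp (fun x => K x →L[ℂ] K x) ∞))

variable {K}

/-- The bounded section with given values. -/
noncomputable def BddSections.mk (a : ∀ x, K x →L[ℂ] K x) (r : ℝ) (h : ∀ x, ‖a x‖ ≤ r) :
    BddSections K :=
  (⟨a, memℓp_infty ⟨r, by rintro _ ⟨x, rfl⟩; exact h x⟩⟩ : lp (fun x => K x →L[ℂ] K x) ∞)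

variable (K) in
/-- Evaluation of bounded sections at `x`. -/
noncomputable def evalAt (x : X) : BddSections K →⋆ₙₐ[ℂ] (K x →L[ℂ] K x) where
  toFun a := (show lp (fun x => K x →L[ℂ] K x) ∞ from a) x
  map_smul' _ _ := rfl
  map_zero' := rfl
  map_add' _ _ := rfl
  map_mul' _ _ := rfl
  map_star' _ := rfl

lemma evalAt_mk (a : ∀ x, K x →L[ℂ] K x) (r : ℝ) (h : ∀ x, ‖a x‖ ≤ r) (x : X) :
    evalAt K x (BddSections.mk a r h) = a x := rfl

end Sections

section Operators

variable {H : Type u} [NormedAddCommGroup H] [InnerProductSpace ℂ H] [CompleteSpace H]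

instance isClosed_vonNeumann (C : VonNeumannAlgebra H) :
    IsClosed (C.toStarSubalgebra : Set (H →L[ℂ] H)) := by
  have h : (C.toStarSubalgebra : Set (H →L[ℂ] H))
      = Set.centralizer (Set.centralizer (C : Set (H →L[ℂ] H))) := by simp
  rw [h]
  exact Set.isClosed_centralizer _

instance starOrderedRing_starSubalgebra (S : StarSubalgebra ℂ (H →L[ℂ] H))
    [hS : IsClosed (S : Set (H →L[ℂ] H))] : StarOrderedRing ↥S := by
  refine StarOrderedRing.of_nonneg_iff' (fun {x y} h z => ?_) fun x => ⟨fun hx => ?_, ?_⟩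
  · exact (add_le_add_iff_left (z : H →L[ℂ] H)).mpr h
  · have hx' : (0 : H →L[ℂ] H) ≤ (x : H →L[ℂ] H) := hx
    have hsa : IsSelfAdjoint x := Subtype.ext (IsSelfAdjoint.of_nonneg hx').star_eq
    have hsp : SpectrumRestricts x ContinuousMap.realToNNReal := by
      rw [SpectrumRestricts.nnreal_iff]
      intro r hr
      have h1 : (r : ℂ) ∈ spectrum ℂ x := by
        rw [← spectrum.algebraMap_mem_iff ℂ] at hr
        exact hr
      rw [StarSubalgebra.mem_spectrum_iff] at h1
      have := spectrum_nonneg_of_nonneg hx' h1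
      exact_mod_cast this
    obtain ⟨s, hs, -, h⟩ := CFC.exists_sqrt_of_isSelfAdjoint_of_quasispectrumRestricts hsa
      (quasispectrumRestricts_iff_spectrumRestricts.mpr hsp)
    exact ⟨s, by rw [hs.star_eq, h]⟩
  · rintro ⟨s, rfl⟩
    exact star_mul_self_nonneg (s : H →L[ℂ] H)

/-- `c ↦ c Ω` on a star-algebra of operators. -/
def orbitMap (S : StarSubalgebra ℂ (H →L[ℂ] H)) (Ω : H) : ↥S →ₗ[ℂ] H where
  toFun c := (c : H →L[ℂ] H) Ω
  map_add' _ _ := rfl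
  map_smul' _ _ := rfl

variable (H) in
/-- An abelian von Neumann algebra `C` on `H` with a vector `Ω` cyclic for its commutant. -/
structure AbelianData where
  C : VonNeumannAlgebra H
  Ω : H
  comm : ∀ c ∈ C, ∀ d ∈ C, c * d = d * c
  cyclic : DenseRange (orbitMap C.commutant.toStarSubalgebra Ω)

namespace AbelianData

variable (𝔇 : AbelianData H)

/-- The algebra `C` -/
abbrev alg : StarSubalgebra ℂ (H →L[ℂ] H) := 𝔇.C.toStarSubalgebra

/-- The algebra `C'` -/
noncomputable abbrev com : StarSubalgebra ℂ (H →L[ℂ] H) := 𝔇.C.commutant.toStarSubalgebra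

/-- The closed subspace `[C Ω]`. -/
noncomputable def cyclicSubspace : Submodule ℂ H := (LinearMap.range (orbitMap 𝔇.alg 𝔇.Ω)).topologicalClosure

instance : CompleteSpace 𝔇.cyclicSubspace :=
  (Submodule.isClosed_topologicalClosure _).completeSpace_coe

/-- The orthogonal projection `e` onto `[C Ω]`. -/
noncomputable def e : H →L[ℂ] H := 𝔇.cyclicSubspace.starProjection

variable {𝔇}

lemma comm_of_mem {A c : H →L[ℂ] H} (hA : A ∈ 𝔇.com) (hc : c ∈ 𝔇.alg) (z : H) :
    c (A z) = A (c z) := by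
  have := VonNeumannAlgebra.mem_commutant_iff.mp (show A ∈ 𝔇.C.commutant from hA) c hc
  exact DFunLike.congr_fun this z

lemma mem_alg {D : H →L[ℂ] H} (h : ∀ B ∈ 𝔇.com, B * D = D * B) : D ∈ 𝔇.alg := by
  have : D ∈ 𝔇.C.commutant.commutant := VonNeumannAlgebra.mem_commutant_iff.mpr h
  rwa [VonNeumannAlgebra.commutant_commutant] at this

lemma orbit_mem {c : H →L[ℂ] H} (hc : c ∈ 𝔇.alg) : c 𝔇.Ω ∈ 𝔇.cyclicSubspace :=
  Submodule.le_topologicalClosure _ ⟨⟨c, hc⟩, rfl⟩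

lemma cyclicSubspace_induction {p : H → Prop} (hp : IsClosed {z | p z})
    (h : ∀ c ∈ 𝔇.alg, p (c 𝔇.Ω)) {z : H} (hz : z ∈ 𝔇.cyclicSubspace) : p z := by
  refine closure_minimal (t := {z | p z}) ?_ hp hz
  rintro _ ⟨c, rfl⟩
  exact h c c.2

lemma inv {c : H →L[ℂ] H} (hc : c ∈ 𝔇.alg) {z : H} (hz : z ∈ 𝔇.cyclicSubspace) :
    c z ∈ 𝔇.cyclicSubspace := by
  refine cyclicSubspace_induction (p := fun z => c z ∈ 𝔇.cyclicSubspace) ?_ ?_ hz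
  · exact (Submodule.isClosed_topologicalClosure _).preimage c.continuous
  · intro d hd
    exact orbit_mem (mul_mem hc hd)

lemma e_mem_sub (z : H) : 𝔇.e z ∈ 𝔇.cyclicSubspace := Submodule.starProjection_apply_mem _ z

lemma e_of_mem {z : H} (hz : z ∈ 𝔇.cyclicSubspace) : 𝔇.e z = z :=
  Submodule.starProjection_eq_self_iff.mpr hz

lemma e_inner (x y : H) : ⟪𝔇.e x, y⟫_ℂ = ⟪x, 𝔇.e y⟫_ℂ :=
  Submodule.starProjection_isSymmetric _ x y

lemma e_sa : star 𝔇.e = 𝔇.e :=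
  (ContinuousLinearMap.isSelfAdjoint_iff_isSymmetric.mpr fun x y => e_inner x y).star_eq

lemma e_Ω : 𝔇.e 𝔇.Ω = 𝔇.Ω := e_of_mem (by simpa using orbit_mem (𝔇 := 𝔇) (one_mem _))

lemma e_e (z : H) : 𝔇.e (𝔇.e z) = 𝔇.e z := e_of_mem (e_mem_sub z)

lemma inner_star (A : H →L[ℂ] H) (x y : H) : ⟪star A x, y⟫_ℂ = ⟪x, A y⟫_ℂ :=
  ContinuousLinearMap.adjoint_inner_left A y x

lemma inner_star' (A : H →L[ℂ] H) (x y : H) : ⟪x, star A y⟫_ℂ = ⟪A x, y⟫_ℂ :=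
  ContinuousLinearMap.adjoint_inner_right A x y

lemma e_comm {c : H →L[ℂ] H} (hc : c ∈ 𝔇.alg) (z : H) : c (𝔇.e z) = 𝔇.e (c z) := by
  have h1 : 𝔇.e (c (𝔇.e z)) = c (𝔇.e z) := e_of_mem (inv hc (e_mem_sub z))
  rw [← h1]
  refine ext_inner_left ℂ fun w => ?_
  have h2 : 𝔇.e (star c (𝔇.e w)) = star c (𝔇.e w) :=
    e_of_mem (inv (star_mem hc) (e_mem_sub w))
  rw [← e_inner, ← inner_star, ← e_inner, h2, inner_star, e_inner]

lemma e_mem : 𝔇.e ∈ 𝔇.com := by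
  refine VonNeumannAlgebra.mem_commutant_iff.mpr fun c hc => ?_
  ext z
  exact e_comm hc z

lemma key {T d m : H →L[ℂ] H} (hT : T ∈ 𝔇.com) (hd : d ∈ 𝔇.alg) (hm : m ∈ 𝔇.alg) :
    ⟪𝔇.e (T 𝔇.Ω), m (star d 𝔇.Ω)⟫_ℂ = ⟪d 𝔇.Ω, m (𝔇.e (star T 𝔇.Ω))⟫_ℂ := by
  have h1 : 𝔇.e (m (star d 𝔇.Ω)) = m (star d 𝔇.Ω) :=
    e_of_mem (inv hm (orbit_mem (star_mem hd)))
  have h2 : star m (d 𝔇.Ω) = d (star m 𝔇.Ω) :=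
    DFunLike.congr_fun (𝔇.comm _ (star_mem hm) _ hd) 𝔇.Ω
  have h3 : 𝔇.e (d (star m 𝔇.Ω)) = d (star m 𝔇.Ω) :=
    e_of_mem (inv hd (orbit_mem (star_mem hm)))
  calc ⟪𝔇.e (T 𝔇.Ω), m (star d 𝔇.Ω)⟫_ℂ = ⟪T 𝔇.Ω, m (star d 𝔇.Ω)⟫_ℂ := by rw [e_inner, h1]
    _ = ⟪T (star m 𝔇.Ω), star d 𝔇.Ω⟫_ℂ := by
      rw [← inner_star m, comm_of_mem hT (star_mem hm)]
    _ = ⟪d (star m 𝔇.Ω), star T 𝔇.Ω⟫_ℂ := by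
      rw [inner_star' d, inner_star' T, comm_of_mem hT hd]
    _ = ⟪d (star m 𝔇.Ω), 𝔇.e (star T 𝔇.Ω)⟫_ℂ := by rw [← e_inner, h3]
    _ = _ := by rw [← h2, inner_star]

lemma norm_star_alg {d : H →L[ℂ] H} (hd : d ∈ 𝔇.alg) : ‖star d 𝔇.Ω‖ = ‖d 𝔇.Ω‖ := by
  have h : ⟪star d 𝔇.Ω, star d 𝔇.Ω⟫_ℂ = ⟪d 𝔇.Ω, d 𝔇.Ω⟫_ℂ := by
    have hc : d (star d 𝔇.Ω) = star d (d 𝔇.Ω) :=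
      DFunLike.congr_fun (𝔇.comm _ hd _ (star_mem hd)) 𝔇.Ω
    rw [inner_star', hc, inner_star]
  rw [inner_self_eq_norm_sq_to_K, inner_self_eq_norm_sq_to_K] at h
  have h' : ‖star d 𝔇.Ω‖ ^ 2 = ‖d 𝔇.Ω‖ ^ 2 := by exact_mod_cast h
  exact (pow_left_inj₀ (norm_nonneg _) (norm_nonneg _) two_ne_zero).mp h'

lemma sub_sq {T d : H →L[ℂ] H} (hT : T ∈ 𝔇.com) (hd : d ∈ 𝔇.alg) :
    ‖star d 𝔇.Ω - 𝔇.e (star T 𝔇.Ω)‖ ^ 2 = ‖d 𝔇.Ω - 𝔇.e (T 𝔇.Ω)‖ ^ 2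
      + (‖𝔇.e (star T 𝔇.Ω)‖ ^ 2 - ‖𝔇.e (T 𝔇.Ω)‖ ^ 2) := by
  have h := key hT (star_mem hd) (one_mem _)
  rw [star_star] at h
  have h' : ⟪𝔇.e (T 𝔇.Ω), d 𝔇.Ω⟫_ℂ = ⟪star d 𝔇.Ω, 𝔇.e (star T 𝔇.Ω)⟫_ℂ := h
  have h2 : RCLike.re ⟪d 𝔇.Ω, 𝔇.e (T 𝔇.Ω)⟫_ℂ
      = RCLike.re ⟪star d 𝔇.Ω, 𝔇.e (star T 𝔇.Ω)⟫_ℂ := by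
    rw [← h', inner_re_symm]
  rw [norm_sub_sq (𝕜 := ℂ), norm_sub_sq (𝕜 := ℂ), norm_star_alg hd, h2]
  ring

lemma exists_near {z : H} (hz : z ∈ 𝔇.cyclicSubspace) {ε : ℝ} (hε : 0 < ε) :
    ∃ d ∈ 𝔇.alg, ‖d 𝔇.Ω - z‖ < ε := by
  obtain ⟨_, ⟨c, rfl⟩, h⟩ := Metric.mem_closure_iff.mp hz ε hε
  refine ⟨c, c.2, ?_⟩
  rwa [dist_comm, dist_eq_norm] at h

lemma norm_e_le {T : H →L[ℂ] H} (hT : T ∈ 𝔇.com) :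
    ‖𝔇.e (T 𝔇.Ω)‖ ^ 2 ≤ ‖𝔇.e (star T 𝔇.Ω)‖ ^ 2 := by
  refine le_of_forall_pos_le_add fun ε hε => ?_
  obtain ⟨d, hd, h⟩ := exists_near (e_mem_sub (𝔇 := 𝔇) (T 𝔇.Ω)) (Real.sqrt_pos.mpr hε)
  have h1 := sub_sq hT hd
  have h2 : ‖d 𝔇.Ω - 𝔇.e (T 𝔇.Ω)‖ ^ 2 ≤ ε := by
    calc _ ≤ (Real.sqrt ε) ^ 2 := by gcongr
      _ = ε := Real.sq_sqrt hε.le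
  nlinarith [sq_nonneg ‖star d 𝔇.Ω - 𝔇.e (star T 𝔇.Ω)‖]

lemma norm_sub_eq {T d : H →L[ℂ] H} (hT : T ∈ 𝔇.com) (hd : d ∈ 𝔇.alg) :
    ‖star d 𝔇.Ω - 𝔇.e (star T 𝔇.Ω)‖ = ‖d 𝔇.Ω - 𝔇.e (T 𝔇.Ω)‖ := by
  have h1 := norm_e_le hT
  have h2 := norm_e_le (star_mem hT)
  rw [star_star] at h2
  have h3 := sub_sq hT hd
  refine (pow_left_inj₀ (norm_nonneg _) (norm_nonneg _) two_ne_zero).mp ?_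
  linarith

lemma inner_swap {S T m : H →L[ℂ] H} (hS : S ∈ 𝔇.com) (hT : T ∈ 𝔇.com) (hm : m ∈ 𝔇.alg) :
    ⟪𝔇.e (T 𝔇.Ω), m (𝔇.e (star S 𝔇.Ω))⟫_ℂ = ⟪𝔇.e (S 𝔇.Ω), m (𝔇.e (star T 𝔇.Ω))⟫_ℂ := by
  choose d hd hd' using fun n : ℕ =>
    exists_near (e_mem_sub (𝔇 := 𝔇) (S 𝔇.Ω)) (Nat.one_div_pos_of_nat (α := ℝ) (n := n))
  have l1 : Filter.Tendsto (fun n => d n 𝔇.Ω) Filter.atTop (nhds (𝔇.e (S 𝔇.Ω))) := by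
    rw [tendsto_iff_norm_sub_tendsto_zero]
    exact squeeze_zero (fun _ => norm_nonneg _) (fun n => (hd' n).le)
      tendsto_one_div_add_atTop_nhds_zero_nat
  have l2 : Filter.Tendsto (fun n => star (d n) 𝔇.Ω) Filter.atTop
      (nhds (𝔇.e (star S 𝔇.Ω))) := by
    rw [tendsto_iff_norm_sub_tendsto_zero]
    refine squeeze_zero (fun _ => norm_nonneg _)
      (fun n => (norm_sub_eq hS (hd n)).le.trans (hd' n).le)
      tendsto_one_div_add_atTop_nhds_zero_nat
  have r1 : Filter.Tendsto (fun n => ⟪𝔇.e (T 𝔇.Ω), m (star (d n) 𝔇.Ω)⟫_ℂ) Filter.atTop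
      (nhds ⟪𝔇.e (T 𝔇.Ω), m (𝔇.e (star S 𝔇.Ω))⟫_ℂ) :=
    tendsto_const_nhds.inner ((m.continuous.tendsto _).comp l2)
  have r2 : Filter.Tendsto (fun n => ⟪d n 𝔇.Ω, m (𝔇.e (star T 𝔇.Ω))⟫_ℂ) Filter.atTop
      (nhds ⟪𝔇.e (S 𝔇.Ω), m (𝔇.e (star T 𝔇.Ω))⟫_ℂ) :=
    l1.inner tendsto_const_nhds
  refine tendsto_nhds_unique r1 (r2.congr fun n => (key hT (hd n) hm).symm)

/-- The compressions to `[C Ω]` of elements of `C'` commute. -/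
lemma compress_comm {S T : H →L[ℂ] H} (hS : S ∈ 𝔇.com) (hT : T ∈ 𝔇.com) :
    Commute (𝔇.e * S * 𝔇.e) (𝔇.e * T * 𝔇.e) := by
  have hin : ∀ {S T m : H →L[ℂ] H}, S ∈ 𝔇.com → T ∈ 𝔇.com → m ∈ 𝔇.alg →
      ⟪𝔇.e (S (𝔇.e (T 𝔇.Ω))), m 𝔇.Ω⟫_ℂ = ⟪𝔇.e (T 𝔇.Ω), m (𝔇.e (star S 𝔇.Ω))⟫_ℂ := by
    intro S T m hS hT hm
    rw [e_inner, e_of_mem (orbit_mem hm), ← inner_star' S, ← comm_of_mem (star_mem hS) hm,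
      e_comm hm, ← e_inner, e_e]
  have hΩ : 𝔇.e (S (𝔇.e (T 𝔇.Ω))) = 𝔇.e (T (𝔇.e (S 𝔇.Ω))) := by
    rw [← sub_eq_zero, ← inner_self_eq_zero (𝕜 := ℂ)]
    have hmem : 𝔇.e (S (𝔇.e (T 𝔇.Ω))) - 𝔇.e (T (𝔇.e (S 𝔇.Ω))) ∈ 𝔇.cyclicSubspace :=
      sub_mem (e_mem_sub _) (e_mem_sub _)
    refine cyclicSubspace_induction (𝔇 := 𝔇)
      (p := fun z => ⟪𝔇.e (S (𝔇.e (T 𝔇.Ω))) - 𝔇.e (T (𝔇.e (S 𝔇.Ω))), z⟫_ℂ = 0) ?_ ?_ hmem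
    · exact isClosed_eq (continuous_const.inner continuous_id) continuous_const
    · intro m hm
      rw [inner_sub_left, hin hS hT hm, hin hT hS hm, inner_swap hS hT hm, sub_self]
  ext z
  change 𝔇.e (S (𝔇.e (𝔇.e (T (𝔇.e z))))) = 𝔇.e (T (𝔇.e (𝔇.e (S (𝔇.e z)))))
  rw [e_e, e_e]
  refine cyclicSubspace_induction (𝔇 := 𝔇)
    (p := fun z => 𝔇.e (S (𝔇.e (T z))) = 𝔇.e (T (𝔇.e (S z)))) ?_ ?_ (e_mem_sub z)
  · exact isClosed_eq (𝔇.e * S * 𝔇.e * T).continuous (𝔇.e * T * 𝔇.e * S).continuous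
  · intro c hc
    rw [← comm_of_mem hT hc, ← comm_of_mem hS hc, ← e_comm hc, ← e_comm hc,
      ← comm_of_mem hT hc, ← comm_of_mem hS hc, ← e_comm hc, ← e_comm hc, hΩ]

lemma compress_mem {A : H →L[ℂ] H} (hA : A ∈ 𝔇.com) : 𝔇.e * A * 𝔇.e ∈ 𝔇.com :=
  mul_mem (mul_mem e_mem hA) e_mem

lemma compress_compress (A : H →L[ℂ] H) :
    𝔇.e * (𝔇.e * A * 𝔇.e) * 𝔇.e = 𝔇.e * A * 𝔇.e := by
  ext z
  change 𝔇.e (𝔇.e (A (𝔇.e (𝔇.e z)))) = 𝔇.e (A (𝔇.e z))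
  rw [e_e, e_e]

lemma compress_nonneg {A : H →L[ℂ] H} (hA : 0 ≤ A) : 0 ≤ 𝔇.e * A * 𝔇.e := by
  have := star_left_conjugate_nonneg hA 𝔇.e
  rwa [e_sa] at this

set_option linter.unusedSectionVars false in
lemma inner_nonneg_of_nonneg {A : H →L[ℂ] H} (hA : 0 ≤ A) (z : H) : 0 ≤ ⟪z, A z⟫_ℂ :=
  ((ContinuousLinearMap.nonneg_iff_isPositive A).mp hA).inner_nonneg_right z

lemma norm_bound {A B : H →L[ℂ] H} (hA : A ∈ 𝔇.com) (hB : B ∈ 𝔇.com) :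
    ‖B (𝔇.e (A 𝔇.Ω))‖ ≤ ‖A‖ * ‖B 𝔇.Ω‖ := by
  set T := 𝔇.e * A * 𝔇.e with hTdef
  have hT : T ∈ 𝔇.com := compress_mem hA
  have hTn : ‖T‖ ≤ ‖A‖ := by
    have he : ‖𝔇.e‖ ≤ 1 := Submodule.starProjection_norm_le _
    calc ‖T‖ ≤ ‖𝔇.e‖ * ‖A‖ * ‖𝔇.e‖ :=
          (norm_mul_le _ _).trans (mul_le_mul_of_nonneg_right (norm_mul_le _ _) (norm_nonneg _))
      _ ≤ 1 * ‖A‖ * 1 := by gcongr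
      _ = ‖A‖ := by ring
  set S := 𝔇.e * (star B * B) * 𝔇.e with hSdef
  have hS0 : 0 ≤ S := compress_nonneg (star_mul_self_nonneg B)
  have hST : Commute S T := compress_comm (mul_mem (star_mem hB) hB) hA
  have hST' : Commute S (star T) := by
    have : star T = 𝔇.e * star A * 𝔇.e := by simp [hTdef, e_sa, mul_assoc]
    rw [this]
    exact compress_comm (mul_mem (star_mem hB) hB) (star_mem hA)
  have hP : 0 ≤ (‖T‖ ^ 2 : ℝ) • (1 : H →L[ℂ] H) - star T * T := by
    rw [sub_nonneg]
    have := CStarAlgebra.star_mul_le_algebraMap_norm_sq (a := T)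
    rwa [Algebra.algebraMap_eq_smul_one] at this
  have hc : Commute S ((‖T‖ ^ 2 : ℝ) • (1 : H →L[ℂ] H) - star T * T) :=
    ((Commute.one_right S).smul_right _).sub_right (hST'.mul_right hST)
  have hpos := inner_nonneg_of_nonneg (hc.mul_nonneg hS0 hP) 𝔇.Ω
  have hTΩ : T 𝔇.Ω = 𝔇.e (A 𝔇.Ω) := by
    change 𝔇.e (A (𝔇.e 𝔇.Ω)) = _
    rw [e_Ω]
  have hS : ∀ z ∈ 𝔇.cyclicSubspace, ⟪z, S z⟫_ℂ = ((‖B z‖ ^ 2 : ℝ) : ℂ) := by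
    intro z hz
    change ⟪z, 𝔇.e (star B (B (𝔇.e z)))⟫_ℂ = _
    rw [← e_inner, e_of_mem hz, inner_star', inner_self_eq_norm_sq_to_K]
    norm_cast
  have h1 : ⟪𝔇.Ω, (S * ((‖T‖ ^ 2 : ℝ) • (1 : H →L[ℂ] H) - star T * T)) 𝔇.Ω⟫_ℂ
      = ((‖T‖ ^ 2 * ‖B 𝔇.Ω‖ ^ 2 - ‖B (𝔇.e (A 𝔇.Ω))‖ ^ 2 : ℝ) : ℂ) := by
    have : S * ((‖T‖ ^ 2 : ℝ) • (1 : H →L[ℂ] H) - star T * T)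
        = (‖T‖ ^ 2 : ℝ) • S - star T * (S * T) := by
      rw [mul_sub, mul_smul_comm, mul_one, ← mul_assoc, hST'.eq, mul_assoc]
    rw [this]
    change ⟪𝔇.Ω, (‖T‖ ^ 2 : ℝ) • S 𝔇.Ω - star T (S (T 𝔇.Ω))⟫_ℂ = _
    rw [inner_sub_right, inner_star', hS _ (by rw [hTΩ]; exact e_mem_sub _), hTΩ,
      RCLike.real_smul_eq_coe_smul (K := ℂ), inner_smul_right,
      hS _ (by rw [← e_Ω]; exact e_mem_sub _)]
    push_cast
    rfl
  rw [h1] at hpos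
  have hpos' : 0 ≤ ‖T‖ ^ 2 * ‖B 𝔇.Ω‖ ^ 2 - ‖B (𝔇.e (A 𝔇.Ω))‖ ^ 2 := by exact_mod_cast hpos
  have h2 : ‖B (𝔇.e (A 𝔇.Ω))‖ ≤ ‖T‖ * ‖B 𝔇.Ω‖ := by
    refine le_of_sq_le_sq ?_ (by positivity)
    rw [mul_pow]; linarith
  exact h2.trans (by gcongr)

lemma eq_of_e_mul {D D' : H →L[ℂ] H} (hD : D ∈ 𝔇.alg) (hD' : D' ∈ 𝔇.alg)
    (h : 𝔇.e * D = 𝔇.e * D') : D = D' := by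
  have hΩ : D 𝔇.Ω = D' 𝔇.Ω := by
    have := DFunLike.congr_fun h 𝔇.Ω
    change 𝔇.e (D 𝔇.Ω) = 𝔇.e (D' 𝔇.Ω) at this
    rwa [e_of_mem (orbit_mem hD), e_of_mem (orbit_mem hD')] at this
  ext z
  refine 𝔇.cyclic.induction_on (p := fun z => D z = D' z) z ?_ ?_
  · exact isClosed_eq D.continuous D'.continuous
  · intro B
    change D ((B : H →L[ℂ] H) 𝔇.Ω) = D' ((B : H →L[ℂ] H) 𝔇.Ω)
    rw [comm_of_mem B.2 hD, comm_of_mem B.2 hD', hΩ]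

/-- `e C' e ⊆ e C`: each compression is `e D` for a (unique) `D ∈ C`. -/
theorem exists_condExp {A : H →L[ℂ] H} (hA : A ∈ 𝔇.com) :
    ∃ D ∈ 𝔇.alg, 𝔇.e * D = 𝔇.e * A * 𝔇.e := by
  let f : 𝔇.com →ₗ[ℂ] H := orbitMap 𝔇.com (𝔇.e (A 𝔇.Ω))
  let D : H →L[ℂ] H := f.extendOfNorm (orbitMap 𝔇.com 𝔇.Ω)
  have hDB : ∀ B : 𝔇.com, D ((B : H →L[ℂ] H) 𝔇.Ω) = (B : H →L[ℂ] H) (𝔇.e (A 𝔇.Ω)) :=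
    fun B => LinearMap.extendOfNorm_eq (f := f) 𝔇.cyclic
      ⟨‖A‖, fun B => norm_bound hA B.2⟩ B
  have hD : D ∈ 𝔇.alg := by
    refine mem_alg fun B hB => ?_
    ext z
    refine 𝔇.cyclic.induction_on (p := fun z => (B * D) z = (D * B) z) z ?_ ?_
    · exact isClosed_eq (B * D).continuous (D * B).continuous
    · intro B'
      change B (D ((B' : H →L[ℂ] H) 𝔇.Ω)) = D (B ((B' : H →L[ℂ] H) 𝔇.Ω))
      rw [hDB]
      exact (hDB ⟨B * B', mul_mem hB B'.2⟩).symm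
  refine ⟨D, hD, ?_⟩
  have hDΩ : D 𝔇.Ω = 𝔇.e (A 𝔇.Ω) := hDB 1
  ext z
  change 𝔇.e (D z) = 𝔇.e (A (𝔇.e z))
  rw [← e_e (D z), ← e_comm hD]
  refine cyclicSubspace_induction (𝔇 := 𝔇)
    (p := fun z => 𝔇.e (D z) = 𝔇.e (A z)) ?_ ?_ (e_mem_sub z)
  · exact isClosed_eq (𝔇.e * D).continuous (𝔇.e * A).continuous
  · intro c hc
    have : D (c 𝔇.Ω) = c (D 𝔇.Ω) := DFunLike.congr_fun (𝔇.comm _ hD _ hc) _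
    rw [this, hDΩ, ← e_comm hc, e_e, ← comm_of_mem hA hc, ← e_comm hc]

variable (𝔇) in
/-- The map `Υ⁻¹ ∘ δ : C' → C`: it sends `A` to the unique `D ∈ C` with `e D = e A e`. -/
noncomputable def condExp : 𝔇.com →ₗ[ℂ] 𝔇.alg where
  toFun A := ⟨(exists_condExp A.2).choose, (exists_condExp A.2).choose_spec.1⟩
  map_add' A B := by
    refine Subtype.ext (eq_of_e_mul (𝔇 := 𝔇) (Subtype.prop _) (Subtype.prop _) ?_)
    rw [(exists_condExp (A + B).2).choose_spec.2]
    simp only [AddMemClass.coe_add]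
    rw [mul_add 𝔇.e (exists_condExp A.2).choose, (exists_condExp A.2).choose_spec.2,
      (exists_condExp B.2).choose_spec.2, mul_add, add_mul]
  map_smul' r A := by
    refine Subtype.ext (eq_of_e_mul (𝔇 := 𝔇) (Subtype.prop _) (Subtype.prop _) ?_)
    rw [(exists_condExp (r • A).2).choose_spec.2]
    simp only [SetLike.val_smul, RingHom.id_apply]
    rw [mul_smul_comm r 𝔇.e (exists_condExp A.2).choose, (exists_condExp A.2).choose_spec.2,
      mul_smul_comm, smul_mul_assoc]

lemma e_mul_condExp (A : 𝔇.com) :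
    𝔇.e * (𝔇.condExp A : H →L[ℂ] H) = 𝔇.e * (A : H →L[ℂ] H) * 𝔇.e :=
  (exists_condExp A.2).choose_spec.2

lemma condExp_Ω (A : 𝔇.com) :
    (𝔇.condExp A : H →L[ℂ] H) 𝔇.Ω = 𝔇.e ((A : H →L[ℂ] H) 𝔇.Ω) := by
  have := DFunLike.congr_fun (e_mul_condExp A) 𝔇.Ω
  change 𝔇.e ((𝔇.condExp A : H →L[ℂ] H) 𝔇.Ω) = 𝔇.e ((A : H →L[ℂ] H) (𝔇.e 𝔇.Ω)) at this
  rwa [e_of_mem (orbit_mem (𝔇.condExp A).2), e_Ω] at this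

lemma condExp_nonneg {A : 𝔇.com} (hA : 0 ≤ A) : 0 ≤ (𝔇.condExp A : H →L[ℂ] H) := by
  have hpos : ∀ z, 0 ≤ ⟪z, (𝔇.condExp A : H →L[ℂ] H) z⟫_ℂ := by
    intro z
    refine 𝔇.cyclic.induction_on (p := fun z => 0 ≤ ⟪z, (𝔇.condExp A : H →L[ℂ] H) z⟫_ℂ) z ?_ ?_
    · exact isClosed_Ici.preimage (f := fun z => ⟪z, (𝔇.condExp A : H →L[ℂ] H) z⟫_ℂ)
        (continuous_id.inner (ContinuousLinearMap.continuous _))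
    · intro B
      set b : H →L[ℂ] H := (B : H →L[ℂ] H)
      have hb : b ∈ 𝔇.com := B.2
      have hA0 : (0 : H →L[ℂ] H) ≤ (A : H →L[ℂ] H) := hA
      have h := inner_nonneg_of_nonneg ((compress_comm (mul_mem (star_mem hb) hb) A.2).mul_nonneg
        (compress_nonneg (star_mul_self_nonneg b)) (compress_nonneg hA0)) 𝔇.Ω
      have h2 : ⟪𝔇.Ω, (𝔇.e * (star b * b) * 𝔇.e * (𝔇.e * (A : H →L[ℂ] H) * 𝔇.e)) 𝔇.Ω⟫_ℂ
          = ⟪b 𝔇.Ω, (𝔇.condExp A : H →L[ℂ] H) (b 𝔇.Ω)⟫_ℂ := by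
        change ⟪𝔇.Ω, 𝔇.e (star b (b (𝔇.e (𝔇.e ((A : H →L[ℂ] H) (𝔇.e 𝔇.Ω))))))⟫_ℂ = _
        rw [← e_inner, e_Ω, e_e, inner_star', ← condExp_Ω, comm_of_mem hb (𝔇.condExp A).2]
      rw [h2] at h
      exact h
  rw [ContinuousLinearMap.nonneg_iff_isPositive, ContinuousLinearMap.isPositive_iff_complex]
  intro z
  have h := Complex.nonneg_iff.mp (hpos z)
  have h2 : ⟪(𝔇.condExp A : H →L[ℂ] H) z, z⟫_ℂ = ⟪z, (𝔇.condExp A : H →L[ℂ] H) z⟫_ℂ := by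
    rw [← inner_conj_symm]
    exact Complex.conj_eq_iff_im.mpr h.2.symm
  rw [h2]
  refine ⟨Complex.ext (by simp) (by simpa using h.2), h.1⟩

variable (𝔇) in
/-- The spectrum `X` of `C`. -/
abbrev X : Type u := WeakDual.characterSpace ℂ 𝔇.alg

variable (𝔇) in
/-- The state `ψ_x` of `C'`: `ψ_x(A) = Φ(Υ⁻¹(δ(A)))(x)`, where the Gelfand isomorphism `Φ` is
evaluation at characters, `Φ(D)(x) = x(D)`. -/
noncomputable def ψ (x : 𝔇.X) : 𝔇.com →ₚ[ℂ] ℂ :=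
  PositiveLinearMap.mk₀
    { toFun := fun A => x (𝔇.condExp A)
      map_add' := fun A B => by simp
      map_smul' := fun r A => by simp }
    (fun A hA => by
      have h : x (𝔇.condExp A) ∈ spectrum ℂ (𝔇.condExp A) := AlgHom.apply_mem_spectrum x _
      rw [StarSubalgebra.mem_spectrum_iff] at h
      exact spectrum_nonneg_of_nonneg (condExp_nonneg hA) h)

variable (𝔇) in
/-- The fibre `H_{ψ_x}` of the Hilbert bundle: the GNS space of `ψ_x`. -/
abbrev fib (x : 𝔇.X) : Type u := GNSSpace (𝔇.ψ x)

variable (𝔇) in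
/-- The GNS representation `π_{ψ_x}` of `C'` on `H_{ψ_x}`. -/
noncomputable def π (x : 𝔇.X) : 𝔇.com →⋆ₐ[ℂ] (𝔇.fib x →L[ℂ] 𝔇.fib x) :=
  gnsRep (𝔇.ψ x)

variable (𝔇) in
/-- The GNS vector `Ω_{ψ_x}`. -/
noncomputable def Ωf (x : 𝔇.X) : 𝔇.fib x := gnsVec (𝔇.ψ x)

variable (𝔇) in
/-- The C*-algebra `Γ₀(B(ψ))` of bounded sections of the bundle with fibres `B(H_{ψ_x})`. -/
abbrev Sections : Type u := BddSections 𝔇.fib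

lemma norm_π_le (A : 𝔇.com) (x : 𝔇.X) : ‖𝔇.π x A‖ ≤ ‖A‖ :=
  NonUnitalStarAlgHom.norm_apply_le (𝔇.π x) A

variable (𝔇) in
/-- The section `Π(A) : x ↦ π_{ψ_x}(A)`. -/
noncomputable def sec (A : 𝔇.com) : 𝔇.Sections :=
  BddSections.mk (fun x => 𝔇.π x A) ‖A‖ (norm_π_le A)

variable (𝔇) in
/-- The vector section `Π(A)Ω : x ↦ π_{ψ_x}(A)Ω_{ψ_x}`. -/
noncomputable def vec (A : 𝔇.com) (x : 𝔇.X) : 𝔇.fib x := 𝔇.π x A (𝔇.Ωf x)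

lemma condExp_one : 𝔇.condExp 1 = 1 := by
  refine Subtype.ext (eq_of_e_mul (𝔇 := 𝔇) (Subtype.prop _) (one_mem _) ?_)
  rw [e_mul_condExp]
  ext z
  exact e_e z

lemma norm_Ωf_le (x : 𝔇.X) : ‖𝔇.Ωf x‖ ≤ 1 := by
  have h2 : 𝔇.ψ x 1 = 1 := by
    change x (𝔇.condExp 1) = 1
    rw [condExp_one, map_one]
  refine (norm_gnsVec (𝔇.ψ x)).trans_le ?_
  rw [h2]
  simp

lemma norm_vec_le (A : 𝔇.com) (x : 𝔇.X) : ‖𝔇.vec A x‖ ≤ ‖A‖ := by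
  calc ‖𝔇.vec A x‖ ≤ ‖𝔇.π x A‖ * ‖𝔇.Ωf x‖ := ContinuousLinearMap.le_opNorm _ _
    _ ≤ ‖A‖ * 1 := mul_le_mul (norm_π_le A x) (norm_Ωf_le x) (norm_nonneg _) (norm_nonneg _)
    _ = ‖A‖ := mul_one _

lemma norm_rankOne_vec_le (A B : 𝔇.com) (x : 𝔇.X) :
    ‖InnerProductSpace.rankOne ℂ (𝔇.vec A x) (𝔇.vec B x)‖ ≤ ‖A‖ * ‖B‖ := by
  rw [InnerProductSpace.norm_rankOne]
  exact mul_le_mul (norm_vec_le A x) (norm_vec_le B x) (norm_nonneg _) (norm_nonneg _)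

variable (𝔇) in
/-- The section `x ↦ φ(x) (ζ(x), ·)` of rank-one operators, for `φ = Π(A)Ω` and `ζ = Π(B)Ω`. -/
noncomputable def rankOneSec (A B : 𝔇.com) : 𝔇.Sections :=
  BddSections.mk (fun x => InnerProductSpace.rankOne ℂ (𝔇.vec A x) (𝔇.vec B x))
    (‖A‖ * ‖B‖) (norm_rankOne_vec_le A B)

variable (𝔇) in
/-- The C*-algebra `L̃` generated by the rank-one sections. -/
noncomputable def Ltilde : NonUnitalStarSubalgebra ℂ 𝔇.Sections :=
  (NonUnitalStarAlgebra.adjoin ℂ {a | ∃ A B : 𝔇.com, a = 𝔇.rankOneSec A B}).topologicalClosure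

variable (𝔇) in
/-- The C*-algebra generated by `L̃` and `Π(C')` in the bounded sections. -/
noncomputable def extAlg : NonUnitalStarSubalgebra ℂ 𝔇.Sections :=
  (NonUnitalStarAlgebra.adjoin ℂ
    ((𝔇.Ltilde : Set 𝔇.Sections) ∪ Set.range 𝔇.sec)).topologicalClosure

lemma Ltilde_le_extAlg : 𝔇.Ltilde ≤ 𝔇.extAlg := fun _ ha =>
  NonUnitalStarSubalgebra.le_topologicalClosure _
    (NonUnitalStarAlgebra.subset_adjoin ℂ _ (Or.inl ha))

lemma sec_mem_extAlg (A : 𝔇.com) : 𝔇.sec A ∈ 𝔇.extAlg :=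
  NonUnitalStarSubalgebra.le_topologicalClosure _
    (NonUnitalStarAlgebra.subset_adjoin ℂ _ (Or.inr ⟨A, rfl⟩))

variable (𝔇) in
/-- The fibre algebra `L̃(x) = {a(x) | a ∈ L̃}`. -/
noncomputable def Lfib (x : 𝔇.X) : NonUnitalStarSubalgebra ℂ (𝔇.fib x →L[ℂ] 𝔇.fib x) :=
  𝔇.Ltilde.map (evalAt 𝔇.fib x)

/-- The value `a(x)` of `a ∈ L̃`, as an element of `L̃(x)`. -/
noncomputable def val (a : 𝔇.Ltilde) (x : 𝔇.X) : 𝔇.Lfib x :=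
  ⟨evalAt 𝔇.fib x (a : 𝔇.Sections), ⟨a, a.2, rfl⟩⟩

end AbelianData
end Operators

section State

variable {F : Type u} [NonUnitalCStarAlgebra F] [PartialOrder F] [StarOrderedRing F]

/-- The data `F, ω, C`: an abelian von Neumann algebra `C ⊆ π_ω(F)'` on the GNS space of `ω`. -/
noncomputable def stateData {ω : F →L[ℂ] ℂ} (hω : IsState ω)
    (C : VonNeumannAlgebra (GNSSpace hω.toPositive))
    (hC : ∀ c ∈ C, ∀ d ∈ C, c * d = d * c)
    (hCF : ∀ c ∈ C, ∀ f : F, c * gnsRep' hω.toPositive f = gnsRep' hω.toPositive f * c) :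
    AbelianData (GNSSpace hω.toPositive) where
  C := C
  Ω := hω.cyclicVector
  comm := hC
  cyclic := by
    refine (denseRange_gnsClass hω.toPositive).mono ?_
    rintro _ ⟨a, rfl⟩
    exact ⟨⟨gnsRep' hω.toPositive a,
      VonNeumannAlgebra.mem_commutant_iff.mpr fun c hc => hCF c hc a⟩, hω.rep_cyclicVector a⟩

end State

section Trace

variable (K : Type u) [NormedAddCommGroup K] [InnerProductSpace ℂ K] [CompleteSpace K]

/-- Index set of an orthonormal basis of `K`. -/
def onbIndex : Set K := (exists_hilbertBasis ℂ K).choose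

/-- An orthonormal basis of `K`. -/
noncomputable def onb : HilbertBasis (onbIndex K) ℂ K := (exists_hilbertBasis ℂ K).choose_spec.choose

variable {K}

/-- The trace `Tr(S) = ∑ᵢ (eᵢ, S eᵢ)` over an orthonormal basis. It is used for trace-class `S`
only, where the sum converges and does not depend on the basis. -/
noncomputable def trace (S : K →L[ℂ] K) : ℂ := ∑' i, ⟪onb K i, S (onb K i)⟫_ℂ

/-- A density operator: compact, positive, trace class (for a positive operator this says that
the diagonal is summable) and of trace one. -/
structure IsDensity (T : K →L[ℂ] K) : Prop where
  compact : IsCompactOperator T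
  positive : T.IsPositive
  traceClass : Summable fun i => ⟪onb K i, T (onb K i)⟫_ℂ
  trace_eq_one : trace T = 1

end Trace

namespace AbelianData

variable {H : Type u} [NormedAddCommGroup H] [InnerProductSpace ℂ H] [CompleteSpace H]
variable {𝔇 : AbelianData H} [MeasurableSpace 𝔇.X]

/-- `γ(a) = ∫ ρ_x(a(x)) dν(x)` on `L̃`, for a `ν`-almost everywhere defined family of states
`ρ_x` of the fibres `L̃(x)`. -/
structure IntegralOfStates (γ : 𝔇.Ltilde →L[ℂ] ℂ) (ν : Measure 𝔇.X)
    (ρ : ∀ x, 𝔇.Lfib x →L[ℂ] ℂ) : Prop where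
  isState : ∀ᵐ x ∂ν, IsState (ρ x)
  integrable : ∀ a : 𝔇.Ltilde, Integrable (fun x => ρ x (val a x)) ν
  eq : ∀ a : 𝔇.Ltilde, γ a = ∫ x, ρ x (val a x) ∂ν

/-- `γ(a) = ∫ Tr(a(x) T_x) dν(x)` on `L̃`, for a `ν`-almost everywhere defined family of density
operators `T_x` on the fibres `H_{ψ_x}`. -/
structure IntegralOfDensities (γ : 𝔇.Ltilde →L[ℂ] ℂ) (ν : Measure 𝔇.X)
    (T : ∀ x, 𝔇.fib x →L[ℂ] 𝔇.fib x) : Prop where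
  isDensity : ∀ᵐ x ∂ν, IsDensity (T x)
  integrable : ∀ a : 𝔇.Ltilde,
    Integrable (fun x => trace (evalAt 𝔇.fib x (a : 𝔇.Sections) * T x)) ν
  eq : ∀ a : 𝔇.Ltilde, γ a = ∫ x, trace (evalAt 𝔇.fib x (a : 𝔇.Sections) * T x) ∂ν

/-- A state `σ` of the C*-algebra generated by `L̃` and `Π(C')` that extends `γ`. -/
structure IsExtension (γ : 𝔇.Ltilde →L[ℂ] ℂ) (σ : 𝔇.extAlg →L[ℂ] ℂ) : Prop where
  isState : IsState (A := 𝔇.extAlg) σ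
  extends_eq : ∀ a : 𝔇.Ltilde, σ ⟨a, Ltilde_le_extAlg a.2⟩ = γ a

end AbelianData

end HostAlgebra

open HostAlgebra

/-! Write |A)(B| for the rank-one section of A, B ∈ C'. Its scalar products are functions x ↦
(π(B)Ω, π(A)Ω)(x) = x(E(B*A)), that is, Gelfand transforms of elements of C, and C acts on the fibre
over x by the scalars x(c) (`vec_incl_mul`). Hence a product of two rank-one sections is again a
rank-one section (`rankOneSec_mul`), and `L̃` is the closed linear span of these sections. Its fibre
at x is closed, being the image of a C*-algebra, and contains all rank-one operators, so it is the
algebra of compact operators (`coe_Lfib`).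

For a state γ take its GNS representation π on G with cyclic vector Ω. Fix B and ζ. The Gram matrix
of the vectors π(|A)(B|)ζ depends on A, A' only through E(A*A') and is given by a positive
functional on C. By Riesz it is ∫ (π(A)Ω, π(A')Ω)(x) dμ(x) (`exists_measure_rankOneVec`). So the
closure of these vectors is an L² space of sections on which π acts pointwise, and the vector state
of any ξ in it is an integral of vector states of a section w (`exists_isIntegralOfVectors`). No
separability is needed: Ω lies in the closed span of countably many such pieces, and its orthogonal
increments ξₙ along them each lie in a piece with a single B (`starProjection_sub_mem`). Thus γ is
the sum of the vector states of the ξₙ. The measures ‖wₙ‖² μₙ are added to one probability measure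
ν, and Radon–Nikodym densities distribute the mass over square summable sequences in the fibres
(`exists_measure_of_hasSum`). These sequences give both the states ρ_x and the density operators
T_x.

For the extension, `L̃` is an ideal of the larger algebra (`mul_mem_Ltilde`). If uₙ = aₙ*aₙ with
‖aₙ‖ ≤ 1 and γ(uₙ) → 1, every extension satisfies σ(b) = lim γ(b uₙ). When γ(uₙ) → 1 geometrically
fast, Tr(uₙ(x)T_x) → 1 for almost every x, so the same limit is ∫ Tr(b(x)T_x) dν for any
representing pair (ν, T). This yields existence, uniqueness and the formula for θ(γ)
(`IsExtension.apply_eq`). -/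

namespace HostAlgebra

open InnerProductSpace

/-! ### Algebra of the rank-one sections and the ideal `L̃`. -/

section BddSections

variable {X : Type u} {K : X → Type u} [∀ x, NormedAddCommGroup (K x)]
  [∀ x, InnerProductSpace ℂ (K x)] [∀ x, CompleteSpace (K x)]

lemma BddSections.ext {a b : BddSections K} (h : ∀ x, evalAt K x a = evalAt K x b) : a = b :=
  lp.ext (funext h)

lemma norm_evalAt_le (a : BddSections K) (x : X) : ‖evalAt K x a‖ ≤ ‖a‖ :=
  lp.norm_apply_le_norm ENNReal.top_ne_zero a x

lemma continuous_evalAt (x : X) : Continuous (evalAt K x) :=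
  AddMonoidHomClass.continuous_of_bound (evalAt K x) 1 fun a => by
    simpa using norm_evalAt_le a x

end BddSections

namespace AbelianData

variable {H : Type u} [NormedAddCommGroup H] [InnerProductSpace ℂ H] [CompleteSpace H]
variable {𝔇 : AbelianData H}

lemma alg_le_com : 𝔇.alg ≤ 𝔇.com := fun c hc =>
  VonNeumannAlgebra.mem_commutant_iff.mpr fun d hd => 𝔇.comm d hd c hc

variable (𝔇) in
/-- The inclusion of `C` in `C'`. -/
noncomputable def incl : 𝔇.alg →⋆ₐ[ℂ] 𝔇.com := StarSubalgebra.inclusion alg_le_com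

/-- The projection e commutes with C, so e c A e = c e E(A) = e c E(A), and an element D of C is
determined by e D. -/
lemma condExp_incl_mul (c : 𝔇.alg) (A : 𝔇.com) :
    𝔇.condExp (𝔇.incl c * A) = c * 𝔇.condExp A := by
  refine Subtype.ext (eq_of_e_mul (𝔇 := 𝔇) (Subtype.prop _) (Subtype.prop _) ?_)
  rw [e_mul_condExp]
  ext z
  have h := DFunLike.congr_fun (e_mul_condExp A) z
  change 𝔇.e ((𝔇.condExp A : H →L[ℂ] H) z) = 𝔇.e ((A : H →L[ℂ] H) (𝔇.e z)) at h
  change 𝔇.e ((c : H →L[ℂ] H) ((A : H →L[ℂ] H) (𝔇.e z)))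
    = 𝔇.e ((c : H →L[ℂ] H) ((𝔇.condExp A : H →L[ℂ] H) z))
  rw [← e_comm c.2, ← e_comm c.2, h]

lemma condExp_incl (c : 𝔇.alg) : 𝔇.condExp (𝔇.incl c) = c := by
  simpa [condExp_one] using condExp_incl_mul c (1 : 𝔇.com)

lemma vec_eq_gnsClass (A : 𝔇.com) (x : 𝔇.X) : 𝔇.vec A x = gnsClass (𝔇.ψ x) A := by
  have h := gnsRep'_class (𝔇.ψ x) A 1
  rwa [mul_one] at h

lemma denseRange_vec (x : 𝔇.X) : DenseRange fun A : 𝔇.com => 𝔇.vec A x := by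
  simpa only [vec_eq_gnsClass] using denseRange_gnsClass (𝔇.ψ x)

/-- The source of all continuity in x: scalar products of the sections are Gelfand transforms of
elements of C. -/
lemma inner_vec (A B : 𝔇.com) (x : 𝔇.X) :
    ⟪𝔇.vec A x, 𝔇.vec B x⟫_ℂ = x (𝔇.condExp (star A * B)) := by
  rw [vec_eq_gnsClass, vec_eq_gnsClass, inner_gnsClass]
  rfl

lemma vec_add (A B : 𝔇.com) (x : 𝔇.X) : 𝔇.vec (A + B) x = 𝔇.vec A x + 𝔇.vec B x := by
  simp [vec_eq_gnsClass]

lemma vec_smul (r : ℂ) (A : 𝔇.com) (x : 𝔇.X) : 𝔇.vec (r • A) x = r • 𝔇.vec A x := by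
  simp [vec_eq_gnsClass]

lemma vec_sub (A B : 𝔇.com) (x : 𝔇.X) : 𝔇.vec (A - B) x = 𝔇.vec A x - 𝔇.vec B x := by
  simp [vec_eq_gnsClass]

lemma vec_mul (A B : 𝔇.com) (x : 𝔇.X) : 𝔇.vec (A * B) x = 𝔇.π x A (𝔇.vec B x) := by
  simp [vec]

/-- Since B* commutes with c and E is C-linear, pairing with the class of B gives x(c E(B*A)) = x(c)
x(E(B*A)). Such classes are dense in the fibre. -/
lemma vec_incl_mul (c : 𝔇.alg) (A : 𝔇.com) (x : 𝔇.X) :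
    𝔇.vec (𝔇.incl c * A) x = x c • 𝔇.vec A x := by
  refine ext_inner_left ℂ fun z => ?_
  refine (denseRange_vec x).induction_on (p := fun z =>
    ⟪z, 𝔇.vec (𝔇.incl c * A) x⟫_ℂ = ⟪z, x c • 𝔇.vec A x⟫_ℂ) z ?_ fun B => ?_
  · exact isClosed_eq (continuous_id.inner continuous_const) (continuous_id.inner continuous_const)
  · have h : star B * (𝔇.incl c * A) = 𝔇.incl c * (star B * A) := by
      rw [← mul_assoc, ← mul_assoc]
      congr 1
      exact Subtype.ext (ContinuousLinearMap.ext fun z =>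
        (comm_of_mem (star_mem B.2) c.2 z).symm)
    rw [inner_vec, inner_smul_right, inner_vec, h, condExp_incl_mul, map_mul]

lemma continuous_inner_vec (A B : 𝔇.com) :
    Continuous fun x : 𝔇.X => ⟪𝔇.vec A x, 𝔇.vec B x⟫_ℂ := by
  simp only [inner_vec]
  exact (WeakDual.eval_continuous _).comp continuous_subtype_val

lemma evalAt_rankOneSec (A B : 𝔇.com) (x : 𝔇.X) :
    evalAt 𝔇.fib x (𝔇.rankOneSec A B) = rankOne ℂ (𝔇.vec A x) (𝔇.vec B x) := rfl

lemma evalAt_sec (A : 𝔇.com) (x : 𝔇.X) : evalAt 𝔇.fib x (𝔇.sec A) = 𝔇.π x A := rfl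

lemma star_rankOneSec (A B : 𝔇.com) : star (𝔇.rankOneSec A B) = 𝔇.rankOneSec B A := by
  refine BddSections.ext fun x => ?_
  rw [map_star, evalAt_rankOneSec, evalAt_rankOneSec, ContinuousLinearMap.star_eq_adjoint,
    adjoint_rankOne]

/-- The middle scalar product is the Gelfand transform of E(B*A') ∈ C. As C acts by scalars on the
fibres, this function can be absorbed into the left vector. -/
lemma rankOneSec_mul (A B A' B' : 𝔇.com) : 𝔇.rankOneSec A B * 𝔇.rankOneSec A' B'
    = 𝔇.rankOneSec (𝔇.incl (𝔇.condExp (star B * A')) * A) B' := by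
  refine BddSections.ext fun x => ?_
  simp only [map_mul, evalAt_rankOneSec, vec_incl_mul, ← inner_vec]
  rw [ContinuousLinearMap.mul_def, rankOne_comp_rankOne]
  simp

lemma sec_mul_rankOneSec (C A B : 𝔇.com) :
    𝔇.sec C * 𝔇.rankOneSec A B = 𝔇.rankOneSec (C * A) B := by
  refine BddSections.ext fun x => ?_
  rw [map_mul, evalAt_rankOneSec, evalAt_rankOneSec, evalAt_sec, vec_mul,
    ContinuousLinearMap.mul_def, comp_rankOne]

lemma star_sec (C : 𝔇.com) : star (𝔇.sec C) = 𝔇.sec (star C) := by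
  refine BddSections.ext fun x => ?_
  rw [map_star, evalAt_sec, evalAt_sec, map_star]

lemma rankOneSec_add_left (A A' B : 𝔇.com) :
    𝔇.rankOneSec (A + A') B = 𝔇.rankOneSec A B + 𝔇.rankOneSec A' B := by
  refine BddSections.ext fun x => ?_
  simp [evalAt_rankOneSec, vec_add]

lemma rankOneSec_smul_left (r : ℂ) (A B : 𝔇.com) :
    𝔇.rankOneSec (r • A) B = r • 𝔇.rankOneSec A B := by
  refine BddSections.ext fun x => ?_
  simp [evalAt_rankOneSec, vec_smul]

lemma rankOneSec_mem (A B : 𝔇.com) : 𝔇.rankOneSec A B ∈ 𝔇.Ltilde :=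
  NonUnitalStarSubalgebra.le_topologicalClosure _
    (NonUnitalStarAlgebra.subset_adjoin ℂ _ ⟨A, B, rfl⟩)

lemma isClosed_Ltilde : IsClosed (𝔇.Ltilde : Set 𝔇.Sections) :=
  NonUnitalStarSubalgebra.isClosed_topologicalClosure _

lemma isClosed_extAlg : IsClosed (𝔇.extAlg : Set 𝔇.Sections) :=
  NonUnitalStarSubalgebra.isClosed_topologicalClosure _

variable (𝔇) in
/-- The rank-one sections, as elements of `L̃`. -/
noncomputable def rankOneL (B : 𝔇.com) : 𝔇.com →ₗ[ℂ] 𝔇.Ltilde where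
  toFun A := ⟨𝔇.rankOneSec A B, rankOneSec_mem A B⟩
  map_add' A A' := Subtype.ext (rankOneSec_add_left A A' B)
  map_smul' r A := Subtype.ext (rankOneSec_smul_left r A B)

lemma star_rankOneL (A B : 𝔇.com) : star (𝔇.rankOneL B A) = 𝔇.rankOneL A B :=
  Subtype.ext (star_rankOneSec A B)

lemma rankOneL_mul (A B A' B' : 𝔇.com) : 𝔇.rankOneL B A * 𝔇.rankOneL B' A'
    = 𝔇.rankOneL B' (𝔇.incl (𝔇.condExp (star B * A')) * A) :=
  Subtype.ext (rankOneSec_mul A B A' B')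

variable (𝔇) in
/-- The linear span of the rank-one sections. -/
noncomputable def rankOneSpan : Submodule ℂ 𝔇.Sections :=
  Submodule.span ℂ {a | ∃ A B : 𝔇.com, a = 𝔇.rankOneSec A B}

/-- By `rankOneSec_mul` and `star_rankOneSec` the linear span is already a star-subalgebra. -/
lemma mem_rankOneSpan_of_mem_adjoin {a : 𝔇.Sections}
    (ha : a ∈ NonUnitalStarAlgebra.adjoin ℂ {a | ∃ A B : 𝔇.com, a = 𝔇.rankOneSec A B}) :
    a ∈ 𝔇.rankOneSpan := by
  have hmul : ∀ a ∈ 𝔇.rankOneSpan, ∀ b ∈ 𝔇.rankOneSpan, a * b ∈ 𝔇.rankOneSpan := by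
    intro a ha b hb
    refine Submodule.span_induction₂ (p := fun a b _ _ => a * b ∈ 𝔇.rankOneSpan)
      ?_ ?_ ?_ ?_ ?_ ?_ ?_ ha hb
    · rintro _ _ ⟨A, B, rfl⟩ ⟨A', B', rfl⟩
      exact Submodule.subset_span ⟨_, _, rankOneSec_mul A B A' B'⟩
    · intro b _
      simp
    · intro a _
      simp
    · intro a b c _ _ _ h1 h2
      rw [add_mul]
      exact add_mem h1 h2
    · intro a b c _ _ _ h1 h2
      rw [mul_add]
      exact add_mem h1 h2
    · intro r a b _ _ h
      rw [smul_mul_assoc]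
      exact Submodule.smul_mem _ r h
    · intro r a b _ _ h
      rw [mul_smul_comm]
      exact Submodule.smul_mem _ r h
  refine NonUnitalStarAlgebra.adjoin_induction ℂ (p := fun a _ => a ∈ 𝔇.rankOneSpan)
    (fun a ha => Submodule.subset_span ha) (fun a b _ _ h1 h2 => add_mem h1 h2) (zero_mem _)
    (fun a b _ _ h1 h2 => hmul a h1 b h2) (fun r a _ h => Submodule.smul_mem _ r h)
    (fun a _ h => ?_) ha
  refine Submodule.span_induction (p := fun a _ => star a ∈ 𝔇.rankOneSpan) ?_ (by simp) ?_ ?_ h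
  · rintro _ ⟨A, B, rfl⟩
    exact Submodule.subset_span ⟨_, _, star_rankOneSec A B⟩
  · intro a b _ _ h1 h2
    rw [star_add]
    exact add_mem h1 h2
  · intro r a _ h
    rw [star_smul]
    exact Submodule.smul_mem _ _ h

/-- A closed property that is linear and holds for the rank-one sections holds on `L̃`. -/
lemma Ltilde_induction {p : 𝔇.Ltilde → Prop} (hp : IsClosed {a | p a})
    (h1 : ∀ A B, p (𝔇.rankOneL B A)) (h2 : ∀ a b, p a → p b → p (a + b))
    (h3 : ∀ (r : ℂ) a, p a → p (r • a)) (a : 𝔇.Ltilde) : p a := by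
  have h0 : p 0 := by simpa using h3 0 _ (h1 0 0)
  have hspan : ∀ (b : 𝔇.Sections), b ∈ 𝔇.rankOneSpan → ∃ hb : b ∈ 𝔇.Ltilde, p ⟨b, hb⟩ := by
    intro b hb
    refine Submodule.span_induction (p := fun b _ => ∃ hb : b ∈ 𝔇.Ltilde, p ⟨b, hb⟩)
      ?_ ⟨zero_mem _, h0⟩ ?_ ?_ hb
    · rintro _ ⟨A, B, rfl⟩
      exact ⟨rankOneSec_mem A B, h1 A B⟩
    · rintro b c _ _ ⟨hb, hb'⟩ ⟨hc, hc'⟩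
      exact ⟨add_mem hb hc, h2 _ _ hb' hc'⟩
    · rintro r b _ ⟨hb, hb'⟩
      exact ⟨SMulMemClass.smul_mem r hb, h3 r _ hb'⟩
  refine closure_minimal (s := {a : 𝔇.Ltilde | (a : 𝔇.Sections) ∈ 𝔇.rankOneSpan})
    (t := {a | p a}) (fun a ha => (hspan a ha).2) hp ?_
  -- Density of the span inside the subtype `L̃` is read off from the closure in all bounded
  -- sections.
  rw [Topology.IsInducing.subtypeVal.closure_eq_preimage_closure_image]
  refine closure_mono (s := ((NonUnitalStarAlgebra.adjoin ℂ
    {a | ∃ A B : 𝔇.com, a = 𝔇.rankOneSec A B} : NonUnitalStarSubalgebra ℂ 𝔇.Sections) :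
      Set 𝔇.Sections)) (fun b hb => ?_) a.2
  have hb' := mem_rankOneSpan_of_mem_adjoin hb
  exact ⟨⟨b, (hspan b hb').1⟩, hb', rfl⟩

/-- `L̃` is an ideal because Π(C)|A)(B| = |CA)(B|. This is what lets a state of `L̃` be evaluated at
b uₙ with b outside `L̃`. -/
lemma mul_mem_Ltilde {b : 𝔇.Sections} (hb : b ∈ 𝔇.extAlg) (a : 𝔇.Ltilde) :
    b * (a : 𝔇.Sections) ∈ 𝔇.Ltilde := by
  -- Left and right multiplication are treated together, as the adjoint step of the induction
  -- exchanges them.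
  suffices h : ∀ b ∈ 𝔇.extAlg, ∀ a : 𝔇.Ltilde,
      b * (a : 𝔇.Sections) ∈ 𝔇.Ltilde ∧ (a : 𝔇.Sections) * b ∈ 𝔇.Ltilde from (h b hb a).1
  intro b hb
  refine closure_minimal (t := {b : 𝔇.Sections | ∀ a : 𝔇.Ltilde,
      b * (a : 𝔇.Sections) ∈ 𝔇.Ltilde ∧ (a : 𝔇.Sections) * b ∈ 𝔇.Ltilde}) (fun b hb => ?_) ?_ hb
  · have hsec : ∀ (C : 𝔇.com) (a : 𝔇.Ltilde), 𝔇.sec C * (a : 𝔇.Sections) ∈ 𝔇.Ltilde := by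
      intro C
      refine Ltilde_induction ?_ ?_ ?_ ?_
      · exact isClosed_Ltilde.preimage (continuous_const.mul continuous_subtype_val)
      · intro A B
        change 𝔇.sec C * 𝔇.rankOneSec A B ∈ 𝔇.Ltilde
        rw [sec_mul_rankOneSec]
        exact rankOneSec_mem _ _
      · intro a b ha hb
        change 𝔇.sec C * (a + b : 𝔇.Sections) ∈ 𝔇.Ltilde
        rw [mul_add]
        exact add_mem ha hb
      · intro r a ha
        change 𝔇.sec C * (r • (a : 𝔇.Sections)) ∈ 𝔇.Ltilde
        rw [mul_smul_comm]
        exact SMulMemClass.smul_mem r ha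
    refine NonUnitalStarAlgebra.adjoin_induction ℂ (p := fun b _ => ∀ a : 𝔇.Ltilde,
      b * (a : 𝔇.Sections) ∈ 𝔇.Ltilde ∧ (a : 𝔇.Sections) * b ∈ 𝔇.Ltilde)
      ?_ ?_ ?_ ?_ ?_ ?_ hb
    · rintro b (hb | ⟨C, rfl⟩) a
      · exact ⟨mul_mem hb a.2, mul_mem a.2 hb⟩
      · refine ⟨hsec C a, ?_⟩
        have h := star_mem (hsec (star C) (star a))
        change star (𝔇.sec (star C) * star (a : 𝔇.Sections)) ∈ 𝔇.Ltilde at h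
        rwa [star_mul, star_sec, star_star, star_star] at h
    · intro b c _ _ hb hc a
      rw [add_mul, mul_add]
      exact ⟨add_mem (hb a).1 (hc a).1, add_mem (hb a).2 (hc a).2⟩
    · intro a
      simp
    · intro b c _ _ hb hc a
      rw [mul_assoc, ← mul_assoc]
      exact ⟨(hb ⟨_, (hc a).1⟩).1, (hc ⟨_, (hb a).2⟩).2⟩
    · intro r b _ hb a
      rw [smul_mul_assoc, mul_smul_comm]
      exact ⟨SMulMemClass.smul_mem r (hb a).1, SMulMemClass.smul_mem r (hb a).2⟩
    · intro b _ hb a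
      have h := hb (star a)
      change b * star (a : 𝔇.Sections) ∈ 𝔇.Ltilde ∧ star (a : 𝔇.Sections) * b ∈ 𝔇.Ltilde at h
      have h1 := star_mem h.1
      have h2 := star_mem h.2
      rw [star_mul, star_star] at h1 h2
      exact ⟨h2, h1⟩
  · simp only [Set.ofPred_forall]
    refine isClosed_iInter fun a => ?_
    exact (isClosed_Ltilde.preimage (continuous_id.mul continuous_const)).inter
      (isClosed_Ltilde.preimage (continuous_const.mul continuous_id))

/-- For a rank-one section the matrix coefficient is a product of two Gelfand transforms; for
general a it is a uniform limit of sums of these. It is the only measurability input for the field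
of fibres. -/
lemma continuous_inner_Ltilde (a : 𝔇.Ltilde) (A B : 𝔇.com) :
    Continuous fun x : 𝔇.X => ⟪𝔇.vec A x, evalAt 𝔇.fib x a (𝔇.vec B x)⟫_ℂ := by
  refine Ltilde_induction (p := fun a : 𝔇.Ltilde => Continuous fun x : 𝔇.X =>
    ⟪𝔇.vec A x, evalAt 𝔇.fib x a (𝔇.vec B x)⟫_ℂ) ?_ ?_ ?_ ?_ a
  · refine isClosed_of_closure_subset fun a ha => ?_
    refine continuous_of_uniform_approx_of_continuous fun s hs => ?_
    obtain ⟨ε, hε, hs⟩ := Metric.mem_uniformity_dist.mp hs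
    -- The summand 1 keeps the denominator positive when A or B vanishes.
    obtain ⟨b, hb, hab⟩ := Metric.mem_closure_iff.mp ha (ε / (‖A‖ * ‖B‖ + 1)) (by positivity)
    refine ⟨_, hb, fun x => hs ?_⟩
    rw [dist_eq_norm, ← inner_sub_right, ← sub_apply, ← map_sub]
    have h1 : ‖evalAt 𝔇.fib x ((a : 𝔇.Sections) - b)‖ ≤ dist a b := by
      rw [dist_eq_norm]
      exact norm_evalAt_le _ _
    calc _ ≤ ‖𝔇.vec A x‖ * (‖evalAt 𝔇.fib x ((a : 𝔇.Sections) - b)‖ * ‖𝔇.vec B x‖) :=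
          (norm_inner_le_norm _ _).trans
            (mul_le_mul_of_nonneg_left (ContinuousLinearMap.le_opNorm _ _) (norm_nonneg _))
      _ ≤ ‖A‖ * (dist a b * ‖B‖) := by
          gcongr
          · exact norm_vec_le A x
          · exact norm_vec_le B x
      _ = dist a b * (‖A‖ * ‖B‖) := by ring
      _ ≤ dist a b * (‖A‖ * ‖B‖ + 1) := by gcongr; linarith
      _ < ε := by rwa [← lt_div_iff₀ (by positivity)]
  · intro C D
    change Continuous fun x : 𝔇.X =>
      ⟪𝔇.vec A x, rankOne ℂ (𝔇.vec C x) (𝔇.vec D x) (𝔇.vec B x)⟫_ℂ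
    simp only [rankOne_apply, inner_smul_right]
    exact (continuous_inner_vec _ _).mul (continuous_inner_vec _ _)
  · intro a b ha hb
    simp only [NonUnitalStarSubalgebra.coe_add, map_add, add_apply, inner_add_right]
    exact ha.add hb
  · intro r a ha
    simpa [inner_smul_right] using ha.const_mul r

end AbelianData

end HostAlgebra

/-! ### Closed ranges of star-homomorphisms, and the fibres of `L̃`. -/

namespace HostAlgebra

open InnerProductSpace

section Range

variable {B D : Type*} [NonUnitalCStarAlgebra B] [NonUnitalCStarAlgebra D]

/-- A self-adjoint element in the range of a star-homomorphism has a preimage of at most its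
norm. -/
lemma exists_lift_of_isSelfAdjoint (φ : B →⋆ₙₐ[ℂ] D) {b : B} (hb : IsSelfAdjoint b) :
    ∃ b', φ b' = φ b ∧ ‖b'‖ ≤ ‖φ b‖ := by
  set r := ‖φ b‖
  have hr : 0 ≤ r := norm_nonneg _
  -- Truncation to [-r, r]: f(b) has norm at most r, and f(φ b) = φ b because the spectrum of φ b
  -- already lies in [-r, r].
  let f : ℝ → ℝ := fun t => max (-r) (min r t)
  have hf : Continuous f := by fun_prop
  have hf0 : f 0 = 0 := by simp [f, hr]
  have hb' : IsSelfAdjoint (φ b) := hb.map φ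
  refine ⟨cfcₙ f b, ?_, norm_cfcₙ_le fun t _ => ?_⟩
  · have hφ : Continuous φ := AddMonoidHomClass.continuous_of_bound φ 1 fun a => by
      simpa using NonUnitalStarAlgHom.norm_apply_le φ a
    have h := NonUnitalStarAlgHomClass.map_cfcₙ (R := ℝ) (S := ℂ) φ f b hf.continuousOn hf0 hφ hb hb'
    rw [h]
    have h2 : ∀ t ∈ quasispectrum ℝ (φ b), |t| ≤ r := by
      have h3 := (norm_cfcₙ_le_iff (fun t : ℝ => t) (φ b) r).mp (by rw [cfcₙ_id' ℝ (φ b)])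
      simpa using h3
    calc cfcₙ f (φ b) = cfcₙ (fun t : ℝ => t) (φ b) := cfcₙ_congr fun t ht => by
          have := abs_le.mp (h2 t ht)
          simp [f, this.1, this.2]
      _ = φ b := cfcₙ_id' ℝ (φ b)
  · rw [Real.norm_eq_abs, abs_le]
    exact ⟨le_max_left _ _, max_le (by linarith) (min_le_left _ _)⟩

/-- Real and imaginary parts are lifted separately without increase of norm, whence the factor 2. -/
lemma exists_lift (φ : B →⋆ₙₐ[ℂ] D) (b : B) : ∃ b', φ b' = φ b ∧ ‖b'‖ ≤ 2 * ‖φ b‖ := by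
  have key : ∀ b : B, ∃ b', φ b' = (1 / 2 : ℂ) • (φ b + star (φ b)) ∧ ‖b'‖ ≤ ‖φ b‖ := by
    intro b
    have hsa : IsSelfAdjoint ((1 / 2 : ℂ) • (b + star b)) := by
      have : IsSelfAdjoint (1 / 2 : ℂ) := by simp [isSelfAdjoint_iff]
      exact this.smul (IsSelfAdjoint.add_star_self b)
    obtain ⟨b', h1, h2⟩ := exists_lift_of_isSelfAdjoint φ hsa
    have h3 : φ ((1 / 2 : ℂ) • (b + star b)) = (1 / 2 : ℂ) • (φ b + star (φ b)) := by
      rw [map_smul, map_add, map_star]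
    rw [h3] at h1 h2
    refine ⟨b', h1, h2.trans ?_⟩
    rw [norm_smul]
    have := norm_add_le (φ b) (star (φ b))
    rw [norm_star] at this
    norm_num
    linarith
  obtain ⟨b₁, h₁, n₁⟩ := key b
  -- The real part of -ib is the imaginary part of b.
  obtain ⟨b₂, h₂, n₂⟩ := key (-Complex.I • b)
  refine ⟨b₁ + Complex.I • b₂, ?_, ?_⟩
  · rw [map_add, map_smul, h₁, h₂, map_smul, star_smul, smul_comm Complex.I (1 / 2 : ℂ), ← smul_add,
      smul_add Complex.I, smul_smul, smul_smul]
    simp only [neg_smul, Complex.star_def, map_neg, Complex.conj_I, neg_neg, mul_neg,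
      Complex.I_mul_I, one_smul]
    rw [show φ b + star (φ b) + (φ b + -star (φ b)) = (2 : ℂ) • φ b by rw [two_smul]; abel,
      smul_smul]
    norm_num
  · rw [map_smul, norm_smul, norm_neg, Complex.norm_I, one_mul] at n₂
    refine (norm_add_le _ _).trans ?_
    rw [norm_smul, Complex.norm_I]
    linarith

/-- The range of a star-homomorphism of C*-algebras is closed. -/
theorem isClosed_range_starHom (φ : B →⋆ₙₐ[ℂ] D) : IsClosed (Set.range φ) := by
  let f : NormedAddGroupHom B D :=
    ⟨φ, map_add φ, ⟨1, fun a => by simpa using NonUnitalStarAlgHom.norm_apply_le φ a⟩⟩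
  have h : f.SurjectiveOnWith f.range 2 := by
    rintro _ ⟨b, rfl⟩
    exact exists_lift φ b
  -- Preimages of controlled norm let a limit of range elements be written as the image of a
  -- convergent series, by completeness of the domain.
  have h2 := controlled_closure_of_complete two_pos one_pos h
  refine isClosed_of_closure_subset fun y hy => ?_
  obtain ⟨b, hb, -⟩ := h2 y hy
  exact ⟨b, hb⟩

end Range

section Compact

variable {K : Type*} [NormedAddCommGroup K] [InnerProductSpace ℂ K]

lemma continuous_rankOne_right (v : K) : Continuous fun w : K => rankOne ℂ v w :=
  (rankOne ℂ v).continuous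

lemma isCompactOperator_rankOne (v w : K) : IsCompactOperator (rankOne ℂ v w) := by
  have h : IsCompactOperator (innerSL ℂ w) :=
    isCompactOperator_of_locallyCompactSpace_dom (innerSL ℂ w)
  exact h.clm_comp (ContinuousLinearMap.toSpanSingleton ℂ v)

variable [CompleteSpace K]

lemma continuous_rankOne_left (w : K) : Continuous fun v : K => rankOne ℂ v w := by
  simp only [← fun v => adjoint_rankOne (𝕜 := ℂ) w v]
  exact ContinuousLinearMap.adjoint.continuous.comp (continuous_rankOne_right w)

/-- A closed subspace of operators that contains the rank-one operators contains the compact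
operators. -/
theorem mem_of_isCompactOperator {S : Submodule ℂ (K →L[ℂ] K)}
    (hS : IsClosed (S : Set (K →L[ℂ] K))) (h : ∀ v w, rankOne ℂ v w ∈ S) {a : K →L[ℂ] K}
    (ha : IsCompactOperator a) : a ∈ S := by
  change a ∈ (S : Set (K →L[ℂ] K))
  rw [← hS.closure_eq, Metric.mem_closure_iff]
  intro ε hε
  have htb : TotallyBounded (a '' Metric.closedBall 0 1) :=
    (IsCompactOperator.isCompact_closure_image_closedBall (f := (a : K →ₗ[ℂ] K)) ha
      1).totallyBounded.subset subset_closure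
  obtain ⟨t, ht, hcov⟩ := Metric.totallyBounded_iff.mp htb (ε / 2) (half_pos hε)
  -- The image of the unit ball lies within ε/2 of the finite set t, hence of U; composing a with
  -- the projection onto U gives a finite-rank operator within ε/2 of a.
  let U : Submodule ℂ K := Submodule.span ℂ t
  have : FiniteDimensional ℂ U := FiniteDimensional.span_of_finite ℂ ht
  let b := stdOrthonormalBasis ℂ U
  refine ⟨U.starProjection * a, ?_, ?_⟩
  · rw [b.starProjection_eq_sum_rankOne, Finset.sum_mul]
    refine sum_mem fun i _ => ?_
    rw [ContinuousLinearMap.mul_def, rankOne_comp]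
    exact h _ _
  · rw [dist_eq_norm]
    refine lt_of_le_of_lt (ContinuousLinearMap.opNorm_le_of_unit_norm (C := ε / 2) (half_pos hε).le
      fun z hz => ?_) (half_lt_self hε)
    have hz' : a z ∈ a '' Metric.closedBall 0 1 := ⟨z, by simp [hz], rfl⟩
    obtain ⟨y, hy, hzy⟩ := Set.mem_iUnion₂.mp (hcov hz')
    change ‖a z - U.starProjection (a z)‖ ≤ _
    rw [Submodule.starProjection_minimal]
    refine (ciInf_le ⟨0, ?_⟩ (⟨y, Submodule.subset_span hy⟩ : U)).trans ?_
    · rintro _ ⟨u, rfl⟩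
      exact norm_nonneg _
    · rw [← dist_eq_norm]
      exact (Metric.mem_ball.mp hzy).le

end Compact

namespace AbelianData

variable {H : Type u} [NormedAddCommGroup H] [InnerProductSpace ℂ H] [CompleteSpace H]
variable {𝔇 : AbelianData H}

lemma isCompactOperator_evalAt (a : 𝔇.Ltilde) (x : 𝔇.X) :
    IsCompactOperator (evalAt 𝔇.fib x (a : 𝔇.Sections)) := by
  refine Ltilde_induction (p := fun a : 𝔇.Ltilde =>
    IsCompactOperator (evalAt 𝔇.fib x (a : 𝔇.Sections))) ?_ ?_ ?_ ?_ a
  · exact isClosed_setOfPred_isCompactOperator.preimage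
      ((continuous_evalAt x).comp continuous_subtype_val)
  · intro A B
    exact isCompactOperator_rankOne _ _
  · intro a b ha hb
    have h : evalAt 𝔇.fib x ((a + b : 𝔇.Ltilde) : 𝔇.Sections)
      = evalAt 𝔇.fib x (a : 𝔇.Sections) + evalAt 𝔇.fib x (b : 𝔇.Sections) := map_add _ _ _
    rw [h]
    exact ha.add hb
  · intro r a ha
    have h : evalAt 𝔇.fib x ((r • a : 𝔇.Ltilde) : 𝔇.Sections)
      = r • evalAt 𝔇.fib x (a : 𝔇.Sections) := map_smul _ _ _
    rw [h]
    exact ha.smul r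

/-- The image of a closed set under evaluation need not be closed; here it is the range of a
star-homomorphism defined on the C*-algebra `L̃`. -/
lemma isClosed_Lfib (x : 𝔇.X) : IsClosed (𝔇.Lfib x : Set (𝔇.fib x →L[ℂ] 𝔇.fib x)) := by
  have := isClosed_Ltilde (𝔇 := 𝔇)
  have h := isClosed_range_starHom
    ((evalAt 𝔇.fib x).comp (NonUnitalStarSubalgebraClass.subtype 𝔇.Ltilde))
  have h' : (𝔇.Lfib x : Set (𝔇.fib x →L[ℂ] 𝔇.fib x)) = Set.range
      ((evalAt 𝔇.fib x).comp (NonUnitalStarSubalgebraClass.subtype 𝔇.Ltilde)) := by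
    ext S
    constructor
    · rintro ⟨a, ha, rfl⟩
      exact ⟨⟨a, ha⟩, rfl⟩
    · rintro ⟨a, rfl⟩
      exact ⟨a, a.2, rfl⟩
  rw [h']
  exact h

lemma rankOne_mem_Lfib (x : 𝔇.X) (v w : 𝔇.fib x) : rankOne ℂ v w ∈ 𝔇.Lfib x := by
  refine (denseRange_vec x).induction_on (p := fun v => rankOne ℂ v w ∈ 𝔇.Lfib x) v
    ((isClosed_Lfib x).preimage (continuous_rankOne_left w)) fun A => ?_
  refine (denseRange_vec x).induction_on (p := fun w => rankOne ℂ (𝔇.vec A x) w ∈ 𝔇.Lfib x) w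
    ((isClosed_Lfib x).preimage (continuous_rankOne_right _)) fun B => ?_
  exact ⟨_, rankOneSec_mem A B, rfl⟩

/-- The fibre of `L̃` at `x` is the algebra of compact operators. -/
theorem coe_Lfib (x : 𝔇.X) : (𝔇.Lfib x : Set (𝔇.fib x →L[ℂ] 𝔇.fib x))
    = {S : 𝔇.fib x →L[ℂ] 𝔇.fib x | IsCompactOperator S} := by
  ext S
  constructor
  · rintro ⟨a, ha, rfl⟩
    exact isCompactOperator_evalAt ⟨a, ha⟩ x
  · intro hS
    exact mem_of_isCompactOperator (S := (𝔇.Lfib x).toSubmodule) (isClosed_Lfib x)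
      (rankOne_mem_Lfib x) hS

end AbelianData

end HostAlgebra

/-! ### Density operators as mixtures of vector states. -/

namespace HostAlgebra

open InnerProductSpace

section TraceClass

variable {K : Type u} [NormedAddCommGroup K] [InnerProductSpace ℂ K]

lemma inner_self_eq_ofReal (v : K) : ⟪v, v⟫_ℂ = ((‖v‖ ^ 2 : ℝ) : ℂ) := by
  rw [inner_self_eq_norm_sq_to_K]
  simp

lemma hasSum_norm_inner_sq {ι : Type*} (b : HilbertBasis ι ℂ K) (v : K) :
    HasSum (fun i => ‖⟪b i, v⟫_ℂ‖ ^ 2) (‖v‖ ^ 2) := by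
  have h := b.hasSum_inner_mul_inner v v
  rw [inner_self_eq_ofReal] at h
  have h2 : (fun i => ⟪v, b i⟫_ℂ * ⟪b i, v⟫_ℂ) = fun i => ((‖⟪b i, v⟫_ℂ‖ ^ 2 : ℝ) : ℂ) := by
    ext i
    rw [← inner_conj_symm v, RCLike.conj_mul]
    simp
  rw [h2] at h
  exact_mod_cast h

variable {ι κ : Type*} {w w' : κ → K}

lemma summable_norm_inner_sq_prod (b : HilbertBasis ι ℂ K) (hw : Summable fun j => ‖w j‖ ^ 2) :
    Summable fun p : κ × ι => ‖⟪b p.2, w p.1⟫_ℂ‖ ^ 2 := by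
  rw [summable_prod_of_nonneg fun p => sq_nonneg _]
  refine ⟨fun j => (hasSum_norm_inner_sq b (w j)).summable, ?_⟩
  simpa only [(hasSum_norm_inner_sq b _).tsum_eq] using hw

/-- Parseval for each j, then exchange of the sums over j and i, which is allowed by absolute
summability over pairs. It makes the trace of a mixture independent of the basis. -/
lemma hasSum_tsum_inner_mul_inner (b : HilbertBasis ι ℂ K) (hw : Summable fun j => ‖w j‖ ^ 2)
    (hw' : Summable fun j => ‖w' j‖ ^ 2) :
    HasSum (fun i => ∑' j, ⟪w j, b i⟫_ℂ * ⟪b i, w' j⟫_ℂ) (∑' j, ⟪w j, w' j⟫_ℂ) := by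
  have hs : Summable fun p : κ × ι => ⟪w p.1, b p.2⟫_ℂ * ⟪b p.2, w' p.1⟫_ℂ := by
    refine Summable.of_norm_bounded
      ((summable_norm_inner_sq_prod b hw).add (summable_norm_inner_sq_prod b hw')) fun p => ?_
    rw [norm_mul, norm_inner_symm]
    nlinarith [sq_nonneg (‖⟪b p.2, w p.1⟫_ℂ‖ - ‖⟪b p.2, w' p.1⟫_ℂ‖),
      norm_nonneg ⟪b p.2, w p.1⟫_ℂ, norm_nonneg ⟪b p.2, w' p.1⟫_ℂ]
  have h1 : ∑' j, ⟪w j, w' j⟫_ℂ = ∑' p : κ × ι, ⟪w p.1, b p.2⟫_ℂ * ⟪b p.2, w' p.1⟫_ℂ := by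
    rw [hs.tsum_prod]
    exact tsum_congr fun j => (b.tsum_inner_mul_inner _ _).symm
  have hs' := hs.prod_symm
  rw [h1, ← (Equiv.prodComm ι κ).tsum_eq]
  exact hs'.hasSum.prod_fiberwise fun i => (hs'.prod_factor i).hasSum

/-- Bessel's inequality. These finite-rank projections replace the identity in algebras that need
not contain it. -/
lemma norm_sum_rankOne_le {e : ι → K} (he : Orthonormal ℂ e) (s : Finset ι) :
    ‖∑ i ∈ s, rankOne ℂ (e i) (e i)‖ ≤ 1 := by
  refine ContinuousLinearMap.opNorm_le_bound _ zero_le_one fun z => ?_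
  have h1 : (∑ i ∈ s, rankOne ℂ (e i) (e i)) z = ∑ i ∈ s, ⟪e i, z⟫_ℂ • e i := by
    simp [sum_apply]
  have h2 : ‖∑ i ∈ s, ⟪e i, z⟫_ℂ • e i‖ ^ 2 = ∑ i ∈ s, ‖⟪e i, z⟫_ℂ‖ ^ 2 := by
    have h3 := he.inner_sum (fun i => ⟪e i, z⟫_ℂ) (fun i => ⟪e i, z⟫_ℂ) s
    simp only [RCLike.conj_mul] at h3
    rw [inner_self_eq_ofReal] at h3
    exact Complex.ofReal_injective (by simpa using h3)
  rw [h1, one_mul]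
  refine le_of_sq_le_sq ?_ (norm_nonneg z)
  rw [h2]
  exact he.sum_inner_products_le z

/-- `T = ∑ⱼ |wⱼ⟩⟨wⱼ|` with `∑ⱼ ‖wⱼ‖² = 1`. -/
structure IsMixture (T : K →L[ℂ] K) (w : κ → K) : Prop where
  hasSum_sq : HasSum (fun j => ‖w j‖ ^ 2) 1
  hasSum_apply : ∀ z, HasSum (fun j => ⟪w j, z⟫_ℂ • w j) (T z)

lemma summable_norm_sq_apply (hw : Summable fun j => ‖w j‖ ^ 2) (S : K →L[ℂ] K) :
    Summable fun j => ‖S (w j)‖ ^ 2 := by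
  refine Summable.of_nonneg_of_le (fun j => sq_nonneg _) (fun j => ?_) (hw.mul_left (‖S‖ ^ 2))
  rw [← mul_pow]
  gcongr
  exact S.le_opNorm _

lemma norm_inner_apply_le (S : K →L[ℂ] K) (v : K) : ‖⟪v, S v⟫_ℂ‖ ≤ ‖S‖ * ‖v‖ ^ 2 := by
  calc _ ≤ ‖v‖ * (‖S‖ * ‖v‖) :=
        (norm_inner_le_norm _ _).trans (mul_le_mul_of_nonneg_left (S.le_opNorm _) (norm_nonneg _))
    _ = _ := by ring

lemma summable_inner_apply (hw : Summable fun j => ‖w j‖ ^ 2) (S : K →L[ℂ] K) :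
    Summable fun j => ⟪w j, S (w j)⟫_ℂ :=
  Summable.of_norm_bounded (hw.mul_left ‖S‖) fun j => norm_inner_apply_le S (w j)

lemma hasSum_inner_self (hw : HasSum (fun j => ‖w j‖ ^ 2) 1) :
    HasSum (fun j => ⟪w j, w j⟫_ℂ) 1 := by
  simp only [inner_self_eq_ofReal]
  rw [← Complex.ofReal_one]
  exact Complex.hasSum_ofReal.mpr hw

variable [CompleteSpace K]

/-- The diagonal entry (eᵢ, S T eᵢ) is ∑ⱼ (wⱼ, eᵢ)(eᵢ, S wⱼ), to which the exchange of sums applies.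
-/
lemma IsMixture.hasSum_trace {T : K →L[ℂ] K} (h : IsMixture T w) (S : K →L[ℂ] K) :
    HasSum (fun i => ⟪onb K i, (S * T) (onb K i)⟫_ℂ) (∑' j, ⟪w j, S (w j)⟫_ℂ) := by
  have h1 := hasSum_tsum_inner_mul_inner (onb K) h.hasSum_sq.summable
    (summable_norm_sq_apply h.hasSum_sq.summable S)
  refine h1.congr_fun fun i => ?_
  have h2 := ((h.hasSum_apply (onb K i)).mapL S).mapL (innerSL ℂ (onb K i))
  simpa [inner_smul_right] using h2.tsum_eq.symm

lemma IsMixture.trace_mul {T : K →L[ℂ] K} (h : IsMixture T w) (S : K →L[ℂ] K) :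
    trace (S * T) = ∑' j, ⟪w j, S (w j)⟫_ℂ :=
  (h.hasSum_trace S).tsum_eq

/-- The operators |wⱼ)(wⱼ| have norms ‖wⱼ‖², so their sum converges in norm and is a compact
positive operator. -/
lemma exists_isMixture (hw : HasSum (fun j => ‖w j‖ ^ 2) 1) :
    ∃ T : K →L[ℂ] K, IsMixture T w ∧ IsDensity T := by
  have hs : Summable fun j => rankOne ℂ (w j) (w j) :=
    Summable.of_norm (by simpa [← sq] using hw.summable)
  have hT : IsMixture (∑' j, rankOne ℂ (w j) (w j)) w :=
    ⟨hw, fun z => by simpa using hs.hasSum.mapL (ContinuousLinearMap.apply ℂ K z)⟩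
  have h1 := hT.hasSum_trace 1
  rw [one_mul] at h1
  refine ⟨_, hT, ?_, ?_, h1.summable, ?_⟩
  · exact isCompactOperator_of_tendsto hs.hasSum (Filter.Eventually.of_forall fun s => by
      have : (∑ j ∈ s, rankOne ℂ (w j) (w j)) ∈ compactOperator (RingHom.id ℂ) K K :=
        sum_mem fun j _ => isCompactOperator_rankOne (w j) (w j)
      exact this)
  · rw [← ContinuousLinearMap.nonneg_iff_isPositive]
    exact tsum_nonneg fun j =>
      (ContinuousLinearMap.nonneg_iff_isPositive _).mpr (isPositive_rankOne_self (w j))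
  · rw [trace, h1.tsum_eq]
    exact (hasSum_inner_self hw).tsum_eq

/-- Take wⱼ = T^{1/2} eⱼ for the basis that defines the trace; no eigenvector expansion is needed.
-/
lemma IsDensity.exists_isMixture {T : K →L[ℂ] K} (hT : IsDensity T) :
    ∃ w : onbIndex K → K, IsMixture T w := by
  have hT0 : 0 ≤ T := (ContinuousLinearMap.nonneg_iff_isPositive T).mpr hT.positive
  set R := CFC.sqrt T
  have hR : R * R = T := CFC.sqrt_mul_sqrt_self T hT0
  have hsa : ∀ x y : K, ⟪R x, y⟫_ℂ = ⟪x, R y⟫_ℂ :=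
    ContinuousLinearMap.isSelfAdjoint_iff_isSymmetric.mp
      (IsSelfAdjoint.of_nonneg (CFC.sqrt_nonneg T))
  have hRR : ∀ x, R (R x) = T x := fun x => DFunLike.congr_fun hR x
  refine ⟨fun j => R (onb K j), ?_, fun z => ?_⟩
  · have h := hT.traceClass.hasSum
    rw [show (∑' i, ⟪onb K i, T (onb K i)⟫_ℂ) = 1 from hT.trace_eq_one] at h
    have h2 : ∀ i, ⟪onb K i, T (onb K i)⟫_ℂ = ((‖R (onb K i)‖ ^ 2 : ℝ) : ℂ) := fun i => by
      rw [← hRR, ← hsa, inner_self_eq_ofReal]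
    simp only [h2] at h
    rw [← Complex.ofReal_one] at h
    exact Complex.hasSum_ofReal.mp h
  · have h := ((onb K).hasSum_repr (R z)).mapL R
    simpa [HilbertBasis.repr_apply_apply, hsa, hRR] using h

end TraceClass

section VectorStates

variable {K : Type u} [NormedAddCommGroup K] [InnerProductSpace ℂ K] {κ : Type*} {w : κ → K}

/-- The state `S ↦ ∑ⱼ ⟨wⱼ, S wⱼ⟩` of `B(K)`. -/
noncomputable def mixtureState (w : κ → K) (hw : HasSum (fun j => ‖w j‖ ^ 2) 1) :
    (K →L[ℂ] K) →L[ℂ] ℂ :=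
  LinearMap.mkContinuous
    { toFun := fun S => ∑' j, ⟪w j, S (w j)⟫_ℂ
      map_add' := fun S S' => by
        simp only [add_apply, inner_add_right]
        exact (summable_inner_apply hw.summable S).tsum_add (summable_inner_apply hw.summable S')
      map_smul' := fun r S => by
        simp only [smul_apply, inner_smul_right, tsum_mul_left]
        rfl } 1 fun S => by
    rw [one_mul]
    refine tsum_of_norm_bounded (g := fun j => ‖S‖ * ‖w j‖ ^ 2) ?_
      fun j => norm_inner_apply_le S (w j)
    simpa using hw.mul_left ‖S‖

lemma norm_mixtureState_le (hw : HasSum (fun j => ‖w j‖ ^ 2) 1) : ‖mixtureState w hw‖ ≤ 1 :=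
  LinearMap.mkContinuous_norm_le _ zero_le_one _

lemma mixtureState_one (hw : HasSum (fun j => ‖w j‖ ^ 2) 1) : mixtureState w hw 1 = 1 := by
  exact (hasSum_inner_self hw).tsum_eq

variable [CompleteSpace K]

lemma mixtureState_nonneg (hw : HasSum (fun j => ‖w j‖ ^ 2) 1) (S : K →L[ℂ] K) :
    0 ≤ mixtureState w hw (star S * S) := by
  refine tsum_nonneg fun j => ?_
  change 0 ≤ ⟪w j, star S (S (w j))⟫_ℂ
  rw [AbelianData.inner_star', inner_self_eq_ofReal]
  exact_mod_cast sq_nonneg ‖S (w j)‖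

lemma isState_mixtureState (hw : HasSum (fun j => ‖w j‖ ^ 2) 1) : IsState (mixtureState w hw) where
  nonneg := mixtureState_nonneg hw
  norm_eq_one := by
    refine le_antisymm (norm_mixtureState_le hw) ?_
    have h := (mixtureState w hw).le_opNorm 1
    rw [mixtureState_one, norm_one] at h
    refine h.trans (mul_le_of_le_one_right (norm_nonneg _) ContinuousLinearMap.norm_id_le)

/-- A mixture of vector states stays a state on any algebra that contains the rank-one
operators. -/
lemma isState_mixtureState_comp_subtype (hw : HasSum (fun j => ‖w j‖ ^ 2) 1)
    (L : NonUnitalStarSubalgebra ℂ (K →L[ℂ] K)) (hL : ∀ v w, rankOne ℂ v w ∈ L) :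
    IsState (A := L) ((mixtureState w hw).comp (L.toSubmodule.subtypeL)) where
  nonneg a := mixtureState_nonneg hw (a : K →L[ℂ] K)
  norm_eq_one := by
    refine le_antisymm ?_ ?_
    · refine ContinuousLinearMap.opNorm_le_bound _ zero_le_one fun a => ?_
      exact ((mixtureState w hw).le_opNorm _).trans
        (mul_le_mul_of_nonneg_right (norm_mixtureState_le hw) (norm_nonneg _))
    -- L may lack the identity. The values at the projections onto finitely many basis vectors tend
    -- to ∑ⱼ ‖wⱼ‖² = 1, and these projections have norm at most 1.
    · have h1 := hasSum_tsum_inner_mul_inner (onb K) hw.summable hw.summable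
      rw [show ∑' j, ⟪w j, w j⟫_ℂ = 1 from mixtureState_one hw] at h1
      have h2 := (continuous_norm.tendsto _).comp h1
      rw [norm_one] at h2
      refine le_of_tendsto' h2 fun s => ?_
      set P : K →L[ℂ] K := ∑ i ∈ s, rankOne ℂ (onb K i) (onb K i)
      have hP : P ∈ L := sum_mem fun i _ => hL _ _
      have h3 : mixtureState w hw P = ∑ i ∈ s, ∑' j, ⟪w j, onb K i⟫_ℂ * ⟪onb K i, w j⟫_ℂ := by
        rw [map_sum]
        refine Finset.sum_congr rfl fun i _ => tsum_congr fun j => ?_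
        rw [rankOne_apply, inner_smul_right, mul_comm]
      have h4 := ((mixtureState w hw).comp (L.toSubmodule.subtypeL)).le_opNorm ⟨P, hP⟩
      refine (le_of_eq_of_le (congrArg norm h3.symm) h4).trans
        (mul_le_of_le_one_right (norm_nonneg _) ?_)
      exact norm_sum_rankOne_le (onb K).orthonormal s

end VectorStates

end HostAlgebra

/-! ### Approximating sequences for states, and extension from an ideal. -/

namespace HostAlgebra

open Filter Topology

section States

variable {A : Type u} [NonUnitalCStarAlgebra A] {φ : A →L[ℂ] ℂ}

section Order

variable [PartialOrder A] [StarOrderedRing A]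

lemma IsState.inner_rep (h : IsState φ) (a : A) :
    ⟪h.cyclicVector, gnsRep' h.toPositive a h.cyclicVector⟫_ℂ = φ a := by
  rw [h.rep_cyclicVector, h.inner_cyclicVector]

lemma norm_gnsRep'_le (f : A →ₚ[ℂ] ℂ) (a : A) : ‖gnsRep' f a‖ ≤ ‖a‖ :=
  NonUnitalStarAlgHom.norm_apply_le (gnsRep' f) a

/-- There may be no unit to evaluate at. The bound |φ(a)| ≤ ‖[a]‖ gives ‖Ω‖² ≤ ‖Ω‖, and φ(a) = (Ω,
π(a)Ω) gives 1 = ‖φ‖ ≤ ‖Ω‖². -/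
lemma IsState.norm_cyclicVector (h : IsState φ) : ‖h.cyclicVector‖ = 1 := by
  have h1 : ∀ z, ‖⟪h.cyclicVector, z⟫_ℂ‖ ≤ ‖z‖ := fun z =>
    (denseRange_gnsClass h.toPositive).induction_on
      (p := fun z => ‖⟪h.cyclicVector, z⟫_ℂ‖ ≤ ‖z‖) z
      (isClosed_le (continuous_const.inner continuous_id).norm continuous_norm) fun a => by
        rw [h.inner_cyclicVector]
        simpa using h.norm_le_class a
  have h2 := h1 h.cyclicVector
  rw [inner_self_eq_norm_sq_to_K] at h2
  have h2' : ‖h.cyclicVector‖ ^ 2 ≤ ‖h.cyclicVector‖ := by simpa using h2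
  have h3 : ‖φ‖ ≤ ‖h.cyclicVector‖ ^ 2 := by
    refine ContinuousLinearMap.opNorm_le_bound _ (sq_nonneg _) fun a => ?_
    rw [← h.inner_rep, mul_comm]
    refine (norm_inner_apply_le _ _).trans ?_
    gcongr
    exact norm_gnsRep'_le _ a
  rw [h.norm_eq_one] at h3
  nlinarith [norm_nonneg h.cyclicVector]

lemma IsState.norm_sq_class (h : IsState φ) (a : A) :
    ‖gnsClass h.toPositive a‖ ^ 2 = (φ (star a * a)).re := by
  have h1 := inner_gnsClass h.toPositive a a
  rw [inner_self_eq_ofReal] at h1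
  exact congrArg Complex.re h1

end Order

lemma IsState.norm_sq_le (h : IsState φ) (a : A) : ‖φ a‖ ^ 2 ≤ (φ (star a * a)).re := by
  let := CStarAlgebra.spectralOrder A
  have := CStarAlgebra.spectralOrderedRing A
  rw [← h.norm_sq_class]
  have := h.norm_le_class a
  rw [one_mul] at this
  gcongr

/-- Right multiplication by `star a * a` changes a state little if `φ (star a * a)` is close
to one. -/
lemma IsState.norm_sub_sq_le (h : IsState φ) {a : A} (ha : ‖a‖ ≤ 1) (b : A) :
    ‖φ b - φ (b * (star a * a))‖ ^ 2 ≤ ‖b‖ ^ 2 * (1 - (φ (star a * a)).re) := by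
  let := CStarAlgebra.spectralOrder A
  have := CStarAlgebra.spectralOrderedRing A
  set Ω := h.cyclicVector
  set π := gnsRep' h.toPositive
  have h0 : ‖Ω‖ = 1 := h.norm_cyclicVector
  have h1 : φ b - φ (b * (star a * a)) = ⟪Ω, π b (Ω - π (star a * a) Ω)⟫_ℂ := by
    rw [← h.inner_rep, ← h.inner_rep, map_sub, inner_sub_right, map_mul]
    rfl
  -- Put u = a*a. The square expands to 1 - 2φ(u) + ‖π(u)Ω‖², and ‖π(a*)π(a)Ω‖² ≤ ‖π(a)Ω‖² = φ(u).
  have h2 : ‖Ω - π (star a * a) Ω‖ ^ 2 ≤ 1 - (φ (star a * a)).re := by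
    have h3 : ‖π (star a * a) Ω‖ ^ 2 ≤ (φ (star a * a)).re := by
      rw [← h.norm_sq_class, ← h.rep_cyclicVector, map_mul]
      have h4 : ‖π (star a)‖ ≤ 1 := (norm_gnsRep'_le _ _).trans (by rwa [norm_star])
      have h5 := ((π (star a)).le_opNorm (π a Ω)).trans
        (mul_le_mul_of_nonneg_right h4 (norm_nonneg _))
      rw [one_mul] at h5
      gcongr
      exact h5
    rw [norm_sub_sq (𝕜 := ℂ), h0, h.inner_rep]
    simp only [one_pow, RCLike.re_eq_complex_re]
    linarith
  have h3 : ‖⟪Ω, π b (Ω - π (star a * a) Ω)⟫_ℂ‖ ≤ ‖b‖ * ‖Ω - π (star a * a) Ω‖ := by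
    refine (norm_inner_le_norm _ _).trans ?_
    rw [h0, one_mul]
    refine ((π b).le_opNorm _).trans ?_
    gcongr
    exact norm_gnsRep'_le _ b
  rw [h1]
  calc _ ≤ (‖b‖ * ‖Ω - π (star a * a) Ω‖) ^ 2 := by gcongr
    _ = ‖b‖ ^ 2 * ‖Ω - π (star a * a) Ω‖ ^ 2 := mul_pow _ _ _
    _ ≤ _ := by gcongr

lemma IsState.tendsto_mul (h : IsState φ) {a : ℕ → A} (ha : ∀ n, ‖a n‖ ≤ 1)
    (hl : Tendsto (fun n => 1 - (φ (star (a n) * a n)).re) atTop (𝓝 0)) (b : A) :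
    Tendsto (fun n => φ (b * (star (a n) * a n))) atTop (𝓝 (φ b)) := by
  rw [tendsto_iff_norm_sub_tendsto_zero]
  have h1 : Tendsto (fun n => ‖b‖ ^ 2 * (1 - (φ (star (a n) * a n)).re)) atTop (𝓝 0) := by
    simpa using hl.const_mul (‖b‖ ^ 2)
  have h2 : Tendsto (fun n => ‖φ (b * (star (a n) * a n)) - φ b‖ ^ 2) atTop (𝓝 0) :=
    squeeze_zero (fun n => sq_nonneg _) (fun n => by
      rw [norm_sub_rev]
      exact h.norm_sub_sq_le (ha n) b) h1
  have h3 := (Real.continuous_sqrt.tendsto _).comp h2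
  simpa [Function.comp_def, Real.sqrt_sq (norm_nonneg _)] using h3

/-- The geometric rate is wanted for integrals of states: summable errors force almost everywhere
convergence without passing to a subsequence. -/
lemma IsState.exists_approx (h : IsState φ) : ∃ a : ℕ → A, ∀ n, ‖a n‖ ≤ 1 ∧
    1 - (φ (star (a n) * a n)).re ≤ (1 / 2) ^ n := by
  have key : ∀ n : ℕ, ∃ a : A, ‖a‖ ≤ 1 ∧ 1 - (φ (star a * a)).re ≤ (1 / 2) ^ n := by
    intro n
    -- The exponent n + 1 pays for squaring: φ(a*a) ≥ |φ(a)|² ≥ (1 - δ)² ≥ 1 - 2δ with δ =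
    -- 2^{-(n+1)}.
    obtain ⟨a, h1, h2⟩ := φ.exists_lt_apply_of_lt_opNorm (r := 1 - (1 / 2) ^ (n + 1)) (by
      rw [h.norm_eq_one]
      have : (0 : ℝ) < (1 / 2) ^ (n + 1) := by positivity
      linarith)
    refine ⟨a, h1.le, ?_⟩
    have h3 := h.norm_sq_le a
    have h4 : ((1 / 2) ^ (n + 1) : ℝ) ≤ 1 := pow_le_one₀ (by norm_num) (by norm_num)
    have h5 : ((1 / 2) ^ n : ℝ) = 2 * (1 / 2) ^ (n + 1) := by rw [pow_succ]; ring
    rw [h5]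
    nlinarith [pow_le_pow_left₀ (by linarith) h2.le 2, sq_nonneg ((1 / 2 : ℝ) ^ (n + 1))]
  choose a ha using key
  exact ⟨a, ha⟩

lemma IsState.re_le_one (h : IsState φ) {a : A} (ha : ‖a‖ ≤ 1) : (φ (star a * a)).re ≤ 1 := by
  refine (Complex.re_le_norm _).trans ((φ.le_opNorm _).trans ?_)
  rw [h.norm_eq_one, one_mul, CStarRing.norm_star_mul_self]
  nlinarith [norm_nonneg a]

end States

section Subalgebra

variable {B : Type u} [NonUnitalCStarAlgebra B] {S : NonUnitalStarSubalgebra ℂ B}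
  {φ : S →L[ℂ] ℂ}

/-- A sequence of elements `uₙ = aₙ* aₙ`, `‖aₙ‖ ≤ 1`, along which `φ` tends to one fast. -/
structure IsApprox (φ : S →L[ℂ] ℂ) (a u : ℕ → S) : Prop where
  norm_le : ∀ n, ‖(a n : B)‖ ≤ 1
  coe_eq : ∀ n, (u n : B) = star (a n : B) * a n
  re_le_one : ∀ n, (φ (u n)).re ≤ 1
  le : ∀ n, 1 - (φ (u n)).re ≤ (1 / 2) ^ n

lemma IsState.exists_isApprox (h : IsState (A := S) φ) (hS : IsClosed (S : Set B)) :
    ∃ a u, IsApprox φ a u := by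
  have h : IsState (A := S) φ := h
  obtain ⟨a, ha⟩ := IsState.exists_approx h
  exact ⟨a, fun n => star (a n) * a n, fun n => (ha n).1, fun n => rfl,
    fun n => IsState.re_le_one h (ha n).1, fun n => (ha n).2⟩

/-- A state on an algebra that contains `S` as an ideal is determined by its restriction to `S`. -/
lemma IsState.tendsto_of_extends {S' : NonUnitalStarSubalgebra ℂ B}
    {σ : S' →L[ℂ] ℂ} (hσ : IsState (A := S') σ) (hS' : IsClosed (S' : Set B)) (hle : S ≤ S')
    (hext : ∀ a : S, σ ⟨a, hle a.2⟩ = φ a) {a u : ℕ → S} (h : IsApprox φ a u) (b : S')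
    {c : ℕ → S} (hc : ∀ n, (c n : B) = b * u n) :
    Tendsto (fun n => φ (c n)) atTop (𝓝 (σ b)) := by
  have hσ : IsState (A := S') σ := hσ
  let a' : ℕ → S' := fun n => ⟨a n, hle (a n).2⟩
  have hu : ∀ n, star (a' n) * a' n = ⟨u n, hle (u n).2⟩ := fun n => Subtype.ext (h.coe_eq n).symm
  have hcu : ∀ n, b * (star (a' n) * a' n) = ⟨c n, hle (c n).2⟩ := fun n => by
    rw [hu]
    exact Subtype.ext (hc n).symm
  -- σ is a state with σ(uₙ) = φ(uₙ) → 1, so the uₙ approximate for σ as well, and σ(b uₙ) = φ(cₙ).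
  have h1 := IsState.tendsto_mul hσ (a := a') h.norm_le ?_ b
  · simpa only [hcu, hext] using h1
  · simp only [hu, hext]
    exact squeeze_zero (fun n => by linarith [h.re_le_one n]) h.le
      (tendsto_pow_atTop_nhds_zero_of_lt_one (by norm_num) (by norm_num))

end Subalgebra

/-- The sum of the integrals is finite, so ∑ₙ gₙ(x) is finite for almost every x and its terms tend
to zero. -/
lemma ae_tendsto_zero_of_summable {α : Type*} [MeasurableSpace α] {μ : Measure α}
    {g : ℕ → α → ℝ} {c : ℕ → ℝ} (hc : Summable c) (hg : ∀ n, Integrable (g n) μ)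
    (h0 : ∀ᵐ x ∂μ, ∀ n, 0 ≤ g n x) (hgc : ∀ n, ∫ x, g n x ∂μ ≤ c n) :
    ∀ᵐ x ∂μ, Tendsto (fun n => g n x) atTop (𝓝 0) := by
  have h1 : ∫⁻ x, ∑' n, ENNReal.ofReal (g n x) ∂μ ≠ ∞ := by
    rw [lintegral_tsum fun n => (hg n).aemeasurable.ennreal_ofReal]
    have h2 : ∀ n, ∫⁻ x, ENNReal.ofReal (g n x) ∂μ ≤ ENNReal.ofReal (c n) := fun n => by
      rw [← ofReal_integral_eq_lintegral_ofReal (hg n) (h0.mono fun x hx => hx n)]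
      exact ENNReal.ofReal_le_ofReal (hgc n)
    exact ne_top_of_le_ne_top hc.tsum_ofReal_ne_top (ENNReal.tsum_le_tsum h2)
  filter_upwards [h0, ae_lt_top' (AEMeasurable.tsum fun n =>
    (hg n).aemeasurable.ennreal_ofReal) h1] with x hx0 hx
  have h2 := ENNReal.tendsto_atTop_zero_of_tsum_ne_top hx.ne
  have h3 := (ENNReal.tendsto_toReal ENNReal.zero_ne_top).comp h2
  simpa [Function.comp_def, ENNReal.toReal_ofReal (hx0 _)] using h3

namespace AbelianData

variable {H : Type u} [NormedAddCommGroup H] [InnerProductSpace ℂ H] [CompleteSpace H]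
variable {𝔇 : AbelianData H}

/-- `L̃` as an ideal of the C*-algebra generated by `L̃` and `Π(C')`. -/
noncomputable def idealMul (b : 𝔇.extAlg) (a : 𝔇.Ltilde) : 𝔇.Ltilde :=
  ⟨(b : 𝔇.Sections) * a, mul_mem_Ltilde b.2 a⟩

end AbelianData

end HostAlgebra

/-! ### The integral formula for the extended state. -/

namespace HostAlgebra

open Filter Topology

lemma integral_nonneg_complex {α : Type*} [MeasurableSpace α] {μ : Measure α} {f : α → ℂ}
    (h : ∀ᵐ x ∂μ, 0 ≤ f x) : 0 ≤ ∫ x, f x ∂μ := by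
  have h2 : ∫ x, f x ∂μ = ((∫ x, (f x).re ∂μ : ℝ) : ℂ) := by
    rw [← integral_complex_ofReal]
    exact integral_congr_ae (h.mono fun x hx => Complex.eq_re_of_ofReal_le hx)
  rw [h2]
  exact Complex.zero_le_real.mpr
    (integral_nonneg_of_ae (h.mono fun x hx => (Complex.nonneg_iff.mp hx).1))

lemma integral_one_sub_re {α : Type*} [MeasurableSpace α] {μ : Measure α}
    [IsProbabilityMeasure μ] {f : α → ℂ} (hf : Integrable f μ) :
    ∫ x, 1 - (f x).re ∂μ = 1 - (∫ x, f x ∂μ).re := by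
  have h : ∫ x, (f x).re ∂μ = (∫ x, f x ∂μ).re := integral_re hf
  have hre : Integrable (fun x => (f x).re) μ := hf.re
  rw [integral_sub (integrable_const 1) hre, h]
  simp

lemma norm_le_norm_of_extends {B : Type u} [NonUnitalCStarAlgebra B]
    {S S' : NonUnitalStarSubalgebra ℂ B} {φ : S →L[ℂ] ℂ} {σ : S' →L[ℂ] ℂ} (hle : S ≤ S')
    (hext : ∀ a : S, σ ⟨a, hle a.2⟩ = φ a) : ‖φ‖ ≤ ‖σ‖ := by
  refine ContinuousLinearMap.opNorm_le_bound _ σ.opNorm_nonneg fun a => ?_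
  rw [← hext]
  exact σ.le_opNorm _

section BddSections

variable {X : Type u} {K : X → Type u} [∀ x, NormedAddCommGroup (K x)]
  [∀ x, InnerProductSpace ℂ (K x)] [∀ x, CompleteSpace (K x)]

lemma evalAt_mul (a b : BddSections K) (x : X) :
    evalAt K x (a * b) = evalAt K x a * evalAt K x b := rfl

lemma evalAt_star_mul (a : BddSections K) (x : X) :
    evalAt K x (star a * a) = star (evalAt K x a) * evalAt K x a := rfl

lemma BddSections.norm_mul_star_mul_le (a b : BddSections K) (ha : ‖a‖ ≤ 1) :
    ‖b * (star a * a)‖ ≤ ‖b‖ := by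
  refine (norm_mul_le _ _).trans (mul_le_of_le_one_right (norm_nonneg _) ?_)
  rw [CStarRing.norm_star_mul_self]
  nlinarith [norm_nonneg a]

variable {L : NonUnitalStarSubalgebra ℂ (BddSections K)}

lemma evalAt_coe_add (a b : L) (x : X) : evalAt K x ((a + b : L) : BddSections K)
    = evalAt K x (a : BddSections K) + evalAt K x (b : BddSections K) := rfl

lemma evalAt_coe_smul (r : ℂ) (a : L) (x : X) : evalAt K x ((r • a : L) : BddSections K)
    = r • evalAt K x (a : BddSections K) := rfl

lemma evalAt_coe_star_mul (a : L) (x : X) : evalAt K x ((star a * a : L) : BddSections K)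
    = star (evalAt K x (a : BddSections K)) * evalAt K x (a : BddSections K) := rfl

end BddSections

namespace AbelianData

variable {H : Type u} [NormedAddCommGroup H] [InnerProductSpace ℂ H] [CompleteSpace H]
variable {𝔇 : AbelianData H}

variable [MeasurableSpace 𝔇.X] {γ : 𝔇.Ltilde →L[ℂ] ℂ} {ν : Measure 𝔇.X}
  {T : ∀ x, 𝔇.fib x →L[ℂ] 𝔇.fib x}

/-- In mixture form, S ↦ Tr(S T_x) is a bounded linear state on all of B(H_x). Additivity and the
estimates for states then apply in almost every fibre, where the bare sum defining `trace` gives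
neither. -/
lemma IntegralOfDensities.exists_state (h : 𝔇.IntegralOfDensities γ ν T) :
    ∀ᵐ x ∂ν, ∃ φ : (𝔇.fib x →L[ℂ] 𝔇.fib x) →L[ℂ] ℂ, IsState φ ∧ ∀ S, trace (S * T x) = φ S := by
  filter_upwards [h.isDensity] with x hx
  obtain ⟨w, hw⟩ := hx.exists_isMixture
  exact ⟨mixtureState w hw.hasSum_sq, isState_mixtureState _, hw.trace_mul⟩

set_option maxHeartbeats 1000000 in
-- Measurability of x ↦ Tr(b(x)T_x) is assumed only for b in `L̃`. For other b it holds because the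
-- function is the almost everywhere limit of Tr(b(x)uₙ(x)T_x), where b uₙ is in `L̃`; dominated
-- convergence then gives the integral.
lemma IntegralOfDensities.integrable_and_tendsto [IsProbabilityMeasure ν]
    (h : 𝔇.IntegralOfDensities γ ν T) {a u : ℕ → 𝔇.Ltilde} (hu : IsApprox γ a u)
    (b : 𝔇.Sections) {c : ℕ → 𝔇.Ltilde} (hc : ∀ n, (c n : 𝔇.Sections) = b * u n) :
    Integrable (fun x => trace (evalAt 𝔇.fib x b * T x)) ν ∧
    Tendsto (fun n => γ (c n)) atTop (𝓝 (∫ x, trace (evalAt 𝔇.fib x b * T x) ∂ν)) := by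
  set τ : 𝔇.Sections → 𝔇.X → ℂ := fun c x => trace (evalAt 𝔇.fib x c * T x)
  have hτ : ∀ c : 𝔇.Sections, ∀ᵐ x ∂ν, ‖τ c x‖ ≤ ‖c‖ := fun c => by
    filter_upwards [h.exists_state] with x ⟨φ, hφ, hφT⟩
    change ‖trace _‖ ≤ _
    rw [hφT]
    refine (φ.le_opNorm _).trans ?_
    rw [hφ.norm_eq_one, one_mul]
    exact norm_evalAt_le c x
  have hna : ∀ n x, ‖evalAt 𝔇.fib x (a n : 𝔇.Sections)‖ ≤ 1 := fun n x =>
    (norm_evalAt_le _ x).trans (hu.norm_le n)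
  have hux : ∀ n x, evalAt 𝔇.fib x (u n : 𝔇.Sections) = star (evalAt 𝔇.fib x (a n : 𝔇.Sections))
      * evalAt 𝔇.fib x (a n : 𝔇.Sections) := fun n x =>
    (congrArg (evalAt 𝔇.fib x) (hu.coe_eq n)).trans (evalAt_star_mul _ x)
  -- The integral of 1 - Tr(uₙ(x)T_x) is 1 - γ(uₙ), at most 2^{-n}, and the integrand is nonnegative
  -- almost everywhere.
  have hg : ∀ᵐ x ∂ν, Tendsto (fun n => 1 - (τ (u n) x).re) atTop (𝓝 0) := by
    refine ae_tendsto_zero_of_summable (c := fun n => (1 / 2) ^ n) summable_geometric_two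
      (fun n => (integrable_const 1).sub (h.integrable _).re) ?_ fun n => ?_
    · filter_upwards [h.exists_state] with x ⟨φ, hφ, hφT⟩ n
      change 0 ≤ 1 - (trace _).re
      rw [hφT, hux]
      linarith [hφ.re_le_one (hna n x)]
    · rw [integral_one_sub_re (h.integrable (u n)), ← h.eq]
      exact hu.le n
  have hlim : ∀ᵐ x ∂ν, Tendsto (fun n => τ (c n) x) atTop (𝓝 (τ b x)) := by
    filter_upwards [hg, h.exists_state] with x hx ⟨φ, hφ, hφT⟩
    simp only [τ, hφT, hux, hc, evalAt_mul] at hx ⊢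
    exact hφ.tendsto_mul (fun n => hna n x) hx _
  have hmeas : ∀ n, AEStronglyMeasurable (τ (c n)) ν := fun n =>
    (h.integrable (c n)).aestronglyMeasurable
  have hmeas' : AEStronglyMeasurable (τ b) ν := aestronglyMeasurable_of_tendsto_ae atTop hmeas hlim
  refine ⟨Integrable.of_bound hmeas' ‖b‖ (hτ b), ?_⟩
  have h2 := tendsto_integral_of_dominated_convergence (fun _ => ‖b‖) hmeas
    (integrable_const _) (fun n => ?_) hlim
  · exact h2.congr fun n => (h.eq _).symm
  · filter_upwards [hτ (c n)] with x hx
    refine hx.trans ?_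
    rw [hc, hu.coe_eq]
    exact BddSections.norm_mul_star_mul_le _ _ (hu.norm_le n)

set_option maxHeartbeats 1000000 in
/-- A state that is an integral of density operators has the extension
`b ↦ ∫ Tr(b(x) T_x) dν(x)`. -/
lemma IntegralOfDensities.exists_isExtension [IsProbabilityMeasure ν]
    (h : 𝔇.IntegralOfDensities γ ν T) (hγ : IsState (A := 𝔇.Ltilde) γ) : ∃ σ, 𝔇.IsExtension γ σ := by
  obtain ⟨a, u, hu⟩ := IsState.exists_isApprox hγ isClosed_Ltilde
  have hint : ∀ b : 𝔇.extAlg,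
      Integrable (fun x => trace (evalAt 𝔇.fib x (b : 𝔇.Sections) * T x)) ν := fun b =>
    (h.integrable_and_tendsto hu b (c := fun n => idealMul b (u n)) fun n => rfl).1
  have hbound : ∀ b : 𝔇.extAlg,
      ‖∫ x, trace (evalAt 𝔇.fib x (b : 𝔇.Sections) * T x) ∂ν‖ ≤ 1 * ‖b‖ := by
    intro b
    have h1 := norm_integral_le_of_norm_le_const (μ := ν) (C := ‖b‖)
      (f := fun x => trace (evalAt 𝔇.fib x (b : 𝔇.Sections) * T x)) ?_
    · simpa using h1
    filter_upwards [h.exists_state] with x ⟨φ, hφ, hφT⟩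
    rw [hφT]
    refine (φ.le_opNorm _).trans ?_
    rw [hφ.norm_eq_one, one_mul]
    exact norm_evalAt_le _ x
  let σ : 𝔇.extAlg →L[ℂ] ℂ := LinearMap.mkContinuous
    { toFun := fun b => ∫ x, trace (evalAt 𝔇.fib x (b : 𝔇.Sections) * T x) ∂ν
      map_add' := fun b c => by
        rw [← integral_add (hint b) (hint c)]
        refine integral_congr_ae ?_
        filter_upwards [h.exists_state] with x ⟨φ, hφ, hφT⟩
        rw [hφT, hφT, hφT, ← map_add, evalAt_coe_add]
      map_smul' := fun r b => by
        rw [RingHom.id_apply, ← integral_smul]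
        refine integral_congr_ae ?_
        filter_upwards [h.exists_state] with x ⟨φ, hφ, hφT⟩
        rw [hφT, hφT, ← map_smul, evalAt_coe_smul] } 1 hbound
  have hext : ∀ a : 𝔇.Ltilde, σ ⟨a, Ltilde_le_extAlg a.2⟩ = γ a := fun a => (h.eq a).symm
  refine ⟨σ, ⟨fun b => ?_, le_antisymm (LinearMap.mkContinuous_norm_le _ zero_le_one _) ?_⟩, hext⟩
  · change 0 ≤ ∫ x, trace (evalAt 𝔇.fib x ((star b * b : 𝔇.extAlg) : 𝔇.Sections) * T x) ∂ν
    have h1 : ∀ᵐ x ∂ν, 0 ≤ trace (evalAt 𝔇.fib x ((star b * b : 𝔇.extAlg) : 𝔇.Sections) * T x) := by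
      filter_upwards [h.exists_state] with x ⟨φ, hφ, hφT⟩
      rw [hφT, evalAt_coe_star_mul]
      exact hφ.nonneg _
    exact integral_nonneg_complex h1
  · rw [← hγ.norm_eq_one]
    exact norm_le_norm_of_extends Ltilde_le_extAlg hext

/-- Both sides are the limit of γ(b uₙ). As σ, ν and T are arbitrary, this contains the uniqueness
of the extension. -/
lemma IsExtension.apply_eq [IsProbabilityMeasure ν] {σ : 𝔇.extAlg →L[ℂ] ℂ}
    (hσ : 𝔇.IsExtension γ σ) (hγ : IsState (A := 𝔇.Ltilde) γ) (h : 𝔇.IntegralOfDensities γ ν T) (b : 𝔇.extAlg) :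
    Integrable (fun x => trace (evalAt 𝔇.fib x (b : 𝔇.Sections) * T x)) ν ∧
      σ b = ∫ x, trace (evalAt 𝔇.fib x (b : 𝔇.Sections) * T x) ∂ν := by
  obtain ⟨a, u, hu⟩ := IsState.exists_isApprox hγ isClosed_Ltilde
  have h1 := h.integrable_and_tendsto hu b (c := fun n => idealMul b (u n)) fun n => rfl
  have h2 := IsState.tendsto_of_extends hσ.isState isClosed_extAlg Ltilde_le_extAlg hσ.extends_eq hu b
    (c := fun n => idealMul b (u n)) fun n => rfl
  exact ⟨h1.1, tendsto_nhds_unique h2 h1.2⟩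

end AbelianData

end HostAlgebra

/-! ### Measures on the spectrum, and L² limits of sections. -/

namespace HostAlgebra

open Filter Topology CompactlySupported

/-- The Riesz representation of a positive functional on a commutative C*-algebra by a measure on
its spectrum. -/
theorem exists_measure_of_nonneg {A : Type u} [CommCStarAlgebra A]
    [MeasurableSpace (WeakDual.characterSpace ℂ A)] [BorelSpace (WeakDual.characterSpace ℂ A)]
    (Λ : A →ₗ[ℂ] ℂ) (hΛ : ∀ d, 0 ≤ Λ (star d * d)) :
    ∃ μ : Measure (WeakDual.characterSpace ℂ A), IsFiniteMeasure μ ∧ μ.Regular ∧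
      ∀ c, Λ c = ∫ x, x c ∂μ := by
  let Φ := gelfandStarTransform A
  let ofR : C_c(WeakDual.characterSpace ℂ A, ℝ) → C(WeakDual.characterSpace ℂ A, ℂ) :=
    fun f => ⟨fun x => (f x : ℂ), Complex.continuous_ofReal.comp f.continuous⟩
  have hsq : ∀ g : C(WeakDual.characterSpace ℂ A, ℂ), 0 ≤ Λ (Φ.symm (star g * g)) := fun g => by
    rw [map_mul, map_star]
    exact hΛ _
  have hpos : ∀ f : C_c(WeakDual.characterSpace ℂ A, ℝ), 0 ≤ f → 0 ≤ Λ (Φ.symm (ofR f)) := by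
    intro f hf
    convert hsq ⟨fun x => (√(f x) : ℂ), by
      exact Complex.continuous_ofReal.comp (Real.continuous_sqrt.comp f.continuous)⟩ using 3
    ext x
    have := Real.mul_self_sqrt (hf x)
    change ((f x : ℝ) : ℂ) = star ((√(f x) : ℝ) : ℂ) * ((√(f x) : ℝ) : ℂ)
    rw [Complex.star_def, Complex.conj_ofReal, ← Complex.ofReal_mul, this]
  let Λ' : C_c(WeakDual.characterSpace ℂ A, ℝ) →ₚ[ℝ] ℝ := PositiveLinearMap.mk₀
    { toFun := fun f => (Λ (Φ.symm (ofR f))).re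
      map_add' := fun f g => by
        have : ofR (f + g) = ofR f + ofR g := by ext x; simp [ofR]
        rw [this, map_add, map_add, Complex.add_re]
      map_smul' := fun r f => by
        have : ofR (r • f) = (r : ℂ) • ofR f := by ext x; simp [ofR]
        rw [this, map_smul, map_smul, smul_eq_mul, Complex.re_ofReal_mul]
        rfl } fun f hf => (Complex.nonneg_iff.mp (hpos f hf)).1
  have hreal : ∀ f : C(WeakDual.characterSpace ℂ A, ℝ),
      Λ (Φ.symm ⟨fun x => (f x : ℂ), Complex.continuous_ofReal.comp f.continuous⟩)
        = ((∫ x, f x ∂(RealRMK.rieszMeasure Λ') : ℝ) : ℂ) := by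
    intro f
    let f' : C_c(WeakDual.characterSpace ℂ A, ℝ) := ⟨f, HasCompactSupport.of_compactSpace _⟩
    have h1 : ∫ x, f x ∂(RealRMK.rieszMeasure Λ') = (Λ (Φ.symm (ofR f'))).re :=
      RealRMK.integral_rieszMeasure Λ' f'
    rw [h1]
    change Λ (Φ.symm (ofR f')) = _
    -- f = ((f+1)/2)² - ((f-1)/2)² is a difference of squares, so positivity on squares makes Λ real
    -- on real functions.
    let g : ℝ → C(WeakDual.characterSpace ℂ A, ℂ) := fun s =>
      ⟨fun x => ((f x + s) / 2 : ℂ),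
        ((Complex.continuous_ofReal.comp f.continuous).add continuous_const).div_const _⟩
    have h2 : ofR f' = star (g 1) * g 1 - star (g (-1)) * g (-1) := by
      ext x
      change ((f x : ℝ) : ℂ) = star ((f x + (1 : ℝ)) / 2 : ℂ) * ((f x + (1 : ℝ)) / 2 : ℂ)
        - star ((f x + (-1 : ℝ)) / 2 : ℂ) * ((f x + (-1 : ℝ)) / 2 : ℂ)
      simp only [Complex.star_def, map_div₀, map_add, Complex.conj_ofReal, map_ofNat]
      push_cast
      ring
    have h3 := (Complex.nonneg_iff.mp (hsq (g 1))).2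
    have h4 := (Complex.nonneg_iff.mp (hsq (g (-1)))).2
    have h5 : (Λ (Φ.symm (ofR f'))).im = 0 := by
      rw [h2, map_sub, map_sub, Complex.sub_im, ← h3, ← h4, sub_zero]
    exact Complex.ext rfl (by simpa using h5)
  refine ⟨RealRMK.rieszMeasure Λ', inferInstance, inferInstance, fun c => ?_⟩
  have hc : Continuous fun x : WeakDual.characterSpace ℂ A => x c :=
    (WeakDual.eval_continuous _).comp continuous_subtype_val
  have h1 : c = Φ.symm ⟨fun x => ((x c).re : ℂ),
      Complex.continuous_ofReal.comp (Complex.continuous_re.comp hc)⟩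
      + Complex.I • Φ.symm ⟨fun x => ((x c).im : ℂ),
      Complex.continuous_ofReal.comp (Complex.continuous_im.comp hc)⟩ := by
    rw [← map_smul, ← map_add, StarAlgEquiv.eq_symm_apply]
    ext x
    change x c = ((x c).re : ℂ) + Complex.I * ((x c).im : ℂ)
    rw [mul_comm, Complex.re_add_im]
  have hint : Integrable (fun x : WeakDual.characterSpace ℂ A => x c)
      (RealRMK.rieszMeasure Λ') :=
    hc.integrable_of_hasCompactSupport (HasCompactSupport.of_compactSpace _)
  have h2 := hreal ⟨fun x => (x c).re, Complex.continuous_re.comp hc⟩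
  have h3 := hreal ⟨fun x => (x c).im, Complex.continuous_im.comp hc⟩
  have h4 : ∫ x : WeakDual.characterSpace ℂ A, (x c).re ∂(RealRMK.rieszMeasure Λ')
      = (∫ x : WeakDual.characterSpace ℂ A, x c ∂(RealRMK.rieszMeasure Λ')).re := integral_re hint
  have h5 : ∫ x : WeakDual.characterSpace ℂ A, (x c).im ∂(RealRMK.rieszMeasure Λ')
      = (∫ x : WeakDual.characterSpace ℂ A, x c ∂(RealRMK.rieszMeasure Λ')).im := integral_im hint
  conv_lhs => rw [h1]
  rw [map_add, map_smul]
  refine (congrArg₂ (fun a b : ℂ => a + Complex.I • b) h2 h3).trans ?_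
  simp only [ContinuousMap.coe_mk, h4, h5, smul_eq_mul]
  rw [mul_comm, Complex.re_add_im]

/-- A sequence of sections of a field of Hilbert spaces that is summably Cauchy in `L²` converges
almost everywhere, and is dominated in `L²`. -/
theorem exists_ae_tendsto_of_integral_le {α : Type*} [MeasurableSpace α] {μ : Measure α}
    {K : α → Type*} [∀ x, NormedAddCommGroup (K x)] [∀ x, CompleteSpace (K x)]
    (v : ℕ → ∀ x, K x) (h0 : Integrable (fun x => ‖v 0 x‖ ^ 2) μ)
    (hd : ∀ n, Integrable (fun x => ‖v (n + 1) x - v n x‖ ^ 2) μ) {C : ℝ}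
    (hC : ∀ n, ∫ x, ‖v (n + 1) x - v n x‖ ^ 2 ∂μ ≤ C * (1 / 4) ^ n) :
    ∃ (w : ∀ x, K x) (g : α → ℝ), Integrable g μ ∧
      (∀ᵐ x ∂μ, Tendsto (fun n => v n x) atTop (𝓝 (w x))) ∧ ∀ᵐ x ∂μ, ∀ n, ‖v n x‖ ^ 2 ≤ g x := by
  classical
  -- The weight 2ⁿ leaves integrals of order 2^{-n}, still summable, and lets Cauchy–Schwarz against
  -- 2^{-n} control the sum of the increments.
  let F : ℕ → α → ℝ := fun n x => 2 ^ n * ‖v (n + 1) x - v n x‖ ^ 2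
  have hF0 : ∀ n x, 0 ≤ F n x := fun n x => by positivity
  have hFi : ∀ n, Integrable (F n) μ := fun n => (hd n).const_mul _
  have hlint : ∫⁻ x, ∑' n, ENNReal.ofReal (F n x) ∂μ ≠ ∞ := by
    rw [lintegral_tsum fun n => (hFi n).aemeasurable.ennreal_ofReal]
    have h2 : ∀ n, ∫⁻ x, ENNReal.ofReal (F n x) ∂μ ≤ ENNReal.ofReal (C * (1 / 2) ^ n) := fun n => by
      rw [← ofReal_integral_eq_lintegral_ofReal (hFi n) (Eventually.of_forall (hF0 n))]
      refine ENNReal.ofReal_le_ofReal ?_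
      rw [integral_const_mul]
      calc _ ≤ 2 ^ n * (C * (1 / 4) ^ n) := by gcongr; exact hC n
        _ = C * (1 / 2) ^ n := by
          rw [show (1 / 2 : ℝ) = 2 * (1 / 4) by norm_num, mul_pow]
          ring
    exact ne_top_of_le_ne_top (summable_geometric_two.mul_left C).tsum_ofReal_ne_top
      (ENNReal.tsum_le_tsum h2)
  have hmeas : AEMeasurable (fun x => ∑' n, ENNReal.ofReal (F n x)) μ :=
    AEMeasurable.tsum fun n => (hFi n).aemeasurable.ennreal_ofReal
  let s : α → ℝ := fun x => (∑' n, ENNReal.ofReal (F n x)).toReal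
  have hs : Integrable s μ := integrable_toReal_of_lintegral_ne_top hmeas hlint
  have hsum : ∀ᵐ x ∂μ, HasSum (fun n => F n x) (s x) := by
    filter_upwards [ae_lt_top' hmeas hlint] with x hx
    have h1 := ENNReal.hasSum_toReal hx.ne
    rw [← ENNReal.tsum_toReal_eq fun n => ENNReal.ofReal_ne_top] at h1
    simpa only [ENNReal.toReal_ofReal (hF0 _ x)] using h1
  have hlim : ∀ᵐ x ∂μ, ∃ w, Tendsto (fun n => v n x) atTop (𝓝 w) := by
    filter_upwards [hsum] with x hx
    refine cauchySeq_tendsto_of_complete (cauchySeq_of_summable_dist ?_)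
    refine Summable.of_nonneg_of_le (fun n => dist_nonneg) (fun n => ?_)
      (summable_geometric_two.add hx.summable)
    rw [dist_comm, dist_eq_norm]
    set t := ‖v (n + 1) x - v n x‖
    have ht : 0 ≤ t := norm_nonneg _
    have h1 : (2 : ℝ) ^ n * (1 / 2) ^ n = 1 := by rw [← mul_pow]; norm_num
    have h2 : (0 : ℝ) < (2 : ℝ) ^ n := by positivity
    have h3 : (0 : ℝ) < (1 / 2 : ℝ) ^ n := by positivity
    change t ≤ (1 / 2) ^ n + 2 ^ n * t ^ 2
    -- Completing the square gives 2t ≤ 2^{-n} + 2ⁿt², which bounds the increment by a summable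
    -- term.
    have h4 : (2 : ℝ) ^ n * (t - (1 / 2) ^ n) ^ 2 = 2 ^ n * t ^ 2 - 2 * t + (1 / 2) ^ n := by
      linear_combination ((1 / 2 : ℝ) ^ n - 2 * t) * h1
    nlinarith [mul_nonneg h2.le (sq_nonneg (t - (1 / 2) ^ n))]
  -- The limit is set to 0 on the null set without convergence. The bound comes from (p + q)² ≤ 2p²
  -- + 2q² with p = ‖v₀‖ and q² ≤ 2s.
  refine ⟨fun x => if h : ∃ w, Tendsto (fun n => v n x) atTop (𝓝 w) then h.choose else 0,
    fun x => 2 * ‖v 0 x‖ ^ 2 + 4 * s x, (h0.const_mul 2).add (hs.const_mul 4), ?_, ?_⟩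
  · filter_upwards [hlim] with x hx
    rw [dif_pos hx]
    exact hx.choose_spec
  · filter_upwards [hsum] with x hx n
    have h1 : ‖v n x‖ ≤ ‖v 0 x‖ + ∑ k ∈ Finset.range n, ‖v (k + 1) x - v k x‖ := by
      have h2 := Finset.sum_range_sub (fun k => v k x) n
      calc ‖v n x‖ = ‖v 0 x + ∑ k ∈ Finset.range n, (v (k + 1) x - v k x)‖ := by rw [h2]; simp
        _ ≤ _ := (norm_add_le _ _).trans (add_le_add le_rfl (norm_sum_le _ _))
    have h2 : (∑ k ∈ Finset.range n, ‖v (k + 1) x - v k x‖) ^ 2 ≤ 2 * s x := by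
      refine (Finset.sum_sq_le_sum_mul_sum_of_sq_le_mul (Finset.range n)
        (f := fun k => (1 / 2 : ℝ) ^ k) (g := fun k => F k x) (fun k _ => by positivity)
        (fun k _ => hF0 k x) fun k _ => ?_).trans ?_
      · change _ ≤ (1 / 2 : ℝ) ^ k * (2 ^ k * _)
        rw [← mul_assoc, ← mul_pow]
        norm_num
      · exact mul_le_mul (sum_geometric_two_le n)
          (sum_le_hasSum _ (fun k _ => hF0 k x) hx)
          (Finset.sum_nonneg fun k _ => hF0 k x) zero_le_two
    have h3 : 0 ≤ ∑ k ∈ Finset.range n, ‖v (k + 1) x - v k x‖ :=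
      Finset.sum_nonneg fun k _ => norm_nonneg _
    have h4 := pow_le_pow_left₀ (norm_nonneg _) h1 2
    nlinarith [sq_nonneg (‖v 0 x‖ - ∑ k ∈ Finset.range n, ‖v (k + 1) x - v k x‖)]

end HostAlgebra

/-! ### Pieces of a representation of `L̃` as L² spaces of sections. -/

namespace HostAlgebra

open Filter Topology

/-- A representation of an algebra of sections on a Hilbert space. -/
structure IsRep {B : Type*} [NonUnitalCStarAlgebra B] {S : NonUnitalStarSubalgebra ℂ B}
    {G : Type*} [NormedAddCommGroup G] [InnerProductSpace ℂ G] [CompleteSpace G]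
    (π : S → (G →L[ℂ] G)) : Prop where
  map_add : ∀ a b, π (a + b) = π a + π b
  map_smul : ∀ (r : ℂ) a, π (r • a) = r • π a
  map_mul : ∀ a b, π (a * b) = π a * π b
  map_star : ∀ a, π (star a) = star (π a)
  norm_le : ∀ a, ‖π a‖ ≤ ‖(a : B)‖

namespace AbelianData

variable {H : Type u} [NormedAddCommGroup H] [InnerProductSpace ℂ H] [CompleteSpace H]
variable {𝔇 : AbelianData H}
variable {G : Type u} [NormedAddCommGroup G] [InnerProductSpace ℂ G] [CompleteSpace G]

variable {π : 𝔇.Ltilde → (G →L[ℂ] G)}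

/-- `A ↦ π(|A)(B|) ζ`, for a representation `π` of `L̃`. -/
noncomputable def rankOneVec (hπ : IsRep π) (B : 𝔇.com) (ζ : G) : 𝔇.com →ₗ[ℂ] G where
  toFun A := π (𝔇.rankOneL B A) ζ
  map_add' A A' := congrArg (fun T : G →L[ℂ] G => T ζ)
    ((congrArg π (LinearMap.map_add _ A A')).trans (hπ.map_add _ _))
  map_smul' r A := congrArg (fun T : G →L[ℂ] G => T ζ)
    ((congrArg π (LinearMap.map_smul _ r A)).trans (hπ.map_smul _ _))

variable (hπ : IsRep π) (B : 𝔇.com) (ζ : G)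

lemma apply_rankOneVec (C D A : 𝔇.com) : π (𝔇.rankOneL D C) (rankOneVec hπ B ζ A)
    = rankOneVec hπ B ζ (𝔇.incl (𝔇.condExp (star D * A)) * C) :=
  congrArg (fun T : G →L[ℂ] G => T ζ)
    ((hπ.map_mul _ _).symm.trans (congrArg π (rankOneL_mul C D A B)))

/-- Moving one factor across gives |B)(A| |A')(B| = |E(A*A')B)(B|, so the Gram matrix sees A and A'
only through E(A*A') ∈ C. -/
lemma inner_rankOneVec (A A' : 𝔇.com) : ⟪rankOneVec hπ B ζ A, rankOneVec hπ B ζ A'⟫_ℂ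
    = ⟪ζ, rankOneVec hπ B ζ (𝔇.incl (𝔇.condExp (star A * A')) * B)⟫_ℂ := by
  have h1 : star (π (𝔇.rankOneL B A)) = π (𝔇.rankOneL A B) :=
    (hπ.map_star _).symm.trans (congrArg π (star_rankOneL A B))
  refine (inner_star' (π (𝔇.rankOneL B A)) ζ _).symm.trans ?_
  rw [h1, apply_rankOneVec]

/-- The functional c ↦ (ζ, π(|cB)(B|)ζ) on C is positive, since at d*d it equals ‖π(|d)(B|)ζ‖². Its
Riesz measure makes A ↦ π(|A)(B|)ζ isometric for the L² norm of the sections π(A)Ω. -/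
lemma exists_measure_rankOneVec [MeasurableSpace 𝔇.X] [BorelSpace 𝔇.X] :
    ∃ μ : Measure 𝔇.X, IsFiniteMeasure μ ∧ μ.Regular ∧
      ∀ A A', ⟪rankOneVec hπ B ζ A, rankOneVec hπ B ζ A'⟫_ℂ
        = ∫ x, ⟪𝔇.vec A x, 𝔇.vec A' x⟫_ℂ ∂μ := by
  let : CommCStarAlgebra 𝔇.alg :=
    { (inferInstance : CStarAlgebra 𝔇.alg) with
      mul_comm := fun c d => Subtype.ext (𝔇.comm c c.2 d d.2) }
  let Λ : 𝔇.alg →ₗ[ℂ] ℂ :=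
    { toFun := fun c => ⟪ζ, rankOneVec hπ B ζ (𝔇.incl c * B)⟫_ℂ
      map_add' := fun c d => by rw [map_add, add_mul, map_add, inner_add_right]
      map_smul' := fun r c => by
        rw [map_smul, smul_mul_assoc, map_smul, inner_smul_right, RingHom.id_apply, smul_eq_mul] }
  obtain ⟨μ, h1, h2, h3⟩ := exists_measure_of_nonneg Λ fun d => by
    -- Here A = A' = d lies in C, where E(d*d) = d*d.
    have h := inner_rankOneVec hπ B ζ (𝔇.incl d) (𝔇.incl d)
    rw [← map_star, ← map_mul, condExp_incl, inner_self_eq_ofReal] at h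
    exact (Complex.zero_le_real.mpr (sq_nonneg _)).trans_eq h
  refine ⟨μ, h1, h2, fun A A' => ?_⟩
  simp only [inner_rankOneVec, inner_vec]
  exact h3 _

variable {hπ B ζ}

set_option maxHeartbeats 1000000 in
-- The isometry turns π into the pointwise action. On rank-one sections this is the Gram formula;
-- both sides are linear and continuous in a.
lemma inner_apply_rankOneVec [MeasurableSpace 𝔇.X] [BorelSpace 𝔇.X] {μ : Measure 𝔇.X}
    [IsFiniteMeasure μ] (h : ∀ A A', ⟪rankOneVec hπ B ζ A, rankOneVec hπ B ζ A'⟫_ℂ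
        = ∫ x, ⟪𝔇.vec A x, 𝔇.vec A' x⟫_ℂ ∂μ) (a : 𝔇.Ltilde) (A A' : 𝔇.com) :
    ⟪rankOneVec hπ B ζ A, π a (rankOneVec hπ B ζ A')⟫_ℂ
      = ∫ x, ⟪𝔇.vec A x, evalAt 𝔇.fib x (a : 𝔇.Sections) (𝔇.vec A' x)⟫_ℂ ∂μ := by
  have hint : ∀ a : 𝔇.Ltilde, Integrable (fun x =>
      ⟪𝔇.vec A x, evalAt 𝔇.fib x (a : 𝔇.Sections) (𝔇.vec A' x)⟫_ℂ) μ := fun a =>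
    (continuous_inner_Ltilde a A A').integrable_of_hasCompactSupport
      (HasCompactSupport.of_compactSpace _)
  have hadd : ∀ (a b : 𝔇.Ltilde) (x : 𝔇.X),
      ⟪𝔇.vec A x, evalAt 𝔇.fib x ((a + b : 𝔇.Ltilde) : 𝔇.Sections) (𝔇.vec A' x)⟫_ℂ
        = ⟪𝔇.vec A x, evalAt 𝔇.fib x (a : 𝔇.Sections) (𝔇.vec A' x)⟫_ℂ
          + ⟪𝔇.vec A x, evalAt 𝔇.fib x (b : 𝔇.Sections) (𝔇.vec A' x)⟫_ℂ := fun a b x => by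
    rw [evalAt_coe_add, add_apply, inner_add_right]
  have hsmul : ∀ (r : ℂ) (a : 𝔇.Ltilde) (x : 𝔇.X),
      ⟪𝔇.vec A x, evalAt 𝔇.fib x ((r • a : 𝔇.Ltilde) : 𝔇.Sections) (𝔇.vec A' x)⟫_ℂ
        = r * ⟪𝔇.vec A x, evalAt 𝔇.fib x (a : 𝔇.Sections) (𝔇.vec A' x)⟫_ℂ := fun r a x => by
    rw [evalAt_coe_smul, smul_apply, inner_smul_right]
  let J : 𝔇.Ltilde →ₗ[ℂ] ℂ :=
    { toFun := fun a => ∫ x, ⟪𝔇.vec A x, evalAt 𝔇.fib x (a : 𝔇.Sections) (𝔇.vec A' x)⟫_ℂ ∂μ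
      map_add' := fun a b => by
        rw [← integral_add (hint a) (hint b)]
        exact integral_congr_ae (Eventually.of_forall fun x => hadd a b x)
      map_smul' := fun r a => by
        rw [RingHom.id_apply, smul_eq_mul, ← integral_const_mul]
        exact integral_congr_ae (Eventually.of_forall fun x => hsmul r a x) }
  let I : 𝔇.Ltilde →ₗ[ℂ] ℂ :=
    { toFun := fun a => ⟪rankOneVec hπ B ζ A, π a (rankOneVec hπ B ζ A')⟫_ℂ
      map_add' := fun a b => (congrArg (fun T : G →L[ℂ] G => ⟪rankOneVec hπ B ζ A,
        T (rankOneVec hπ B ζ A')⟫_ℂ) (hπ.map_add a b)).trans (inner_add_right _ _ _)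
      map_smul' := fun r a => (congrArg (fun T : G →L[ℂ] G => ⟪rankOneVec hπ B ζ A,
        T (rankOneVec hπ B ζ A')⟫_ℂ) (hπ.map_smul r a)).trans (inner_smul_right _ _ _) }
  have hJ : Continuous J := by
    refine AddMonoidHomClass.continuous_of_bound J (‖A‖ * ‖A'‖ * μ.real Set.univ) fun a => ?_
    refine (norm_integral_le_of_norm_le_const (C := ‖A‖ * (‖a‖ * ‖A'‖))
      (Eventually.of_forall fun x => ?_)).trans_eq (by ring)
    refine (norm_inner_le_norm _ _).trans ?_
    gcongr
    · exact norm_vec_le A x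
    · refine (ContinuousLinearMap.le_opNorm _ _).trans ?_
      gcongr
      · exact norm_evalAt_le _ _
      · exact norm_vec_le A' x
  have hI : Continuous I := by
    refine AddMonoidHomClass.continuous_of_bound I
      (‖rankOneVec hπ B ζ A‖ * ‖rankOneVec hπ B ζ A'‖) fun a => ?_
    refine (norm_inner_le_norm _ _).trans ?_
    rw [mul_assoc, mul_comm _ ‖a‖]
    gcongr
    refine (ContinuousLinearMap.le_opNorm _ _).trans ?_
    gcongr
    exact hπ.norm_le a
  change I a = J a
  refine Ltilde_induction (p := fun a => I a = J a) (isClosed_eq hI hJ) (fun C D => ?_)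
    (fun a b ha hb => ?_) (fun r a ha => ?_) a
  · change ⟪rankOneVec hπ B ζ A, π (𝔇.rankOneL D C) (rankOneVec hπ B ζ A')⟫_ℂ
      = ∫ x, ⟪𝔇.vec A x, InnerProductSpace.rankOne ℂ (𝔇.vec C x) (𝔇.vec D x) (𝔇.vec A' x)⟫_ℂ ∂μ
    rw [apply_rankOneVec, h]
    simp only [vec_incl_mul, InnerProductSpace.rankOne_apply, inner_vec]
  · exact (I.map_add a b).trans ((congrArg₂ (· + ·) ha hb).trans (J.map_add a b).symm)
  · exact (I.map_smul r a).trans ((congrArg (r • ·) ha).trans (J.map_smul r a).symm)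

end AbelianData

end HostAlgebra

namespace HostAlgebra

open Filter Topology

/-- Dominated convergence for the diagonal matrix elements of a bounded field of operators. -/
lemma integrable_inner_and_integral_eq {α : Type*} [MeasurableSpace α] {μ : Measure α}
    {K : α → Type*} [∀ x, NormedAddCommGroup (K x)] [∀ x, InnerProductSpace ℂ (K x)]
    {v : ℕ → ∀ x, K x} {w : ∀ x, K x} {g : α → ℝ} (hg : Integrable g μ)
    (hv : ∀ᵐ x ∂μ, Tendsto (fun n => v n x) atTop (𝓝 (w x)))
    (hvg : ∀ᵐ x ∂μ, ∀ n, ‖v n x‖ ^ 2 ≤ g x) (S : ∀ x, K x →L[ℂ] K x) {C : ℝ}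
    (hS : ∀ x, ‖S x‖ ≤ C)
    (hm : ∀ n, AEStronglyMeasurable (fun x => ⟪v n x, S x (v n x)⟫_ℂ) μ) {l : ℂ}
    (hl : Tendsto (fun n => ∫ x, ⟪v n x, S x (v n x)⟫_ℂ ∂μ) atTop (𝓝 l)) :
    Integrable (fun x => ⟪w x, S x (w x)⟫_ℂ) μ ∧ ∫ x, ⟪w x, S x (w x)⟫_ℂ ∂μ = l := by
  have hlim : ∀ᵐ x ∂μ, Tendsto (fun n => ⟪v n x, S x (v n x)⟫_ℂ) atTop
      (𝓝 ⟪w x, S x (w x)⟫_ℂ) :=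
    hv.mono fun x hx => hx.inner (((S x).continuous.tendsto _).comp hx)
  have hbd : ∀ᵐ x ∂μ, ∀ n, ‖⟪v n x, S x (v n x)⟫_ℂ‖ ≤ C * g x := hvg.mono fun x hx n =>
    (norm_inner_apply_le _ _).trans (mul_le_mul (hS x) (hx n) (sq_nonneg _)
      ((norm_nonneg _).trans (hS x)))
  refine ⟨(hg.const_mul C).mono' (aestronglyMeasurable_of_tendsto_ae atTop hm hlim) ?_, ?_⟩
  · filter_upwards [hlim, hbd] with x h1 h2
    exact le_of_tendsto h1.norm (Eventually.of_forall h2)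
  · exact tendsto_nhds_unique (tendsto_integral_of_dominated_convergence _ hm (hg.const_mul C)
      (fun n => hbd.mono fun x hx => hx n) hlim) hl

lemma integrable_ofReal_iff {α : Type*} [MeasurableSpace α] {μ : Measure α} {f : α → ℝ} :
    Integrable (fun x => (f x : ℂ)) μ ↔ Integrable f μ :=
  ⟨fun h => h.re, fun h => h.ofReal⟩

namespace AbelianData

variable {H : Type u} [NormedAddCommGroup H] [InnerProductSpace ℂ H] [CompleteSpace H]
variable {𝔇 : AbelianData H}
variable {G : Type u} [NormedAddCommGroup G] [InnerProductSpace ℂ G] [CompleteSpace G]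
variable {π : 𝔇.Ltilde → (G →L[ℂ] G)}

/-- The vector state of `ξ` on `L̃` is the integral of the vector states of a section `w`. -/
structure IsIntegralOfVectors [MeasurableSpace 𝔇.X] (π : 𝔇.Ltilde → (G →L[ℂ] G)) (ξ : G)
    (μ : Measure 𝔇.X) (w : ∀ x, 𝔇.fib x) : Prop where
  integrable : ∀ a : 𝔇.Ltilde,
    Integrable (fun x => ⟪w x, evalAt 𝔇.fib x (a : 𝔇.Sections) (w x)⟫_ℂ) μ
  eq : ∀ a : 𝔇.Ltilde,
    ⟪ξ, π a ξ⟫_ℂ = ∫ x, ⟪w x, evalAt 𝔇.fib x (a : 𝔇.Sections) (w x)⟫_ℂ ∂μ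

lemma integral_norm_vec_sq [MeasurableSpace 𝔇.X] [BorelSpace 𝔇.X] {μ : Measure 𝔇.X}
    [IsFiniteMeasure μ] {hπ : IsRep π} {B : 𝔇.com} {ζ : G}
    (h : ∀ A A', ⟪rankOneVec hπ B ζ A, rankOneVec hπ B ζ A'⟫_ℂ
        = ∫ x, ⟪𝔇.vec A x, 𝔇.vec A' x⟫_ℂ ∂μ) (A : 𝔇.com) :
    Integrable (fun x => ‖𝔇.vec A x‖ ^ 2) μ ∧
      ∫ x, ‖𝔇.vec A x‖ ^ 2 ∂μ = ‖rankOneVec hπ B ζ A‖ ^ 2 := by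
  have h1 := h A A
  have h2 : Integrable (fun x => ⟪𝔇.vec A x, 𝔇.vec A x⟫_ℂ) μ :=
    (continuous_inner_vec A A).integrable_of_hasCompactSupport
      (HasCompactSupport.of_compactSpace _)
  simp only [inner_self_eq_ofReal] at h1 h2
  refine ⟨integrable_ofReal_iff.mp h2, ?_⟩
  rw [integral_complex_ofReal] at h1
  exact_mod_cast h1.symm

/-- The vector ξ is a rapid limit of vectors π(|Aₙ)(B|)ζ. By the isometry the sections of the Aₙ are
rapidly Cauchy in L²(μ), so they converge almost everywhere to a section w, and dominated
convergence carries the matrix coefficients to the limit. -/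
theorem exists_isIntegralOfVectors [MeasurableSpace 𝔇.X] [BorelSpace 𝔇.X] (hπ : IsRep π)
    {B : 𝔇.com} {ζ ξ : G} (hξ : ξ ∈ closure (Set.range (rankOneVec hπ B ζ))) :
    ∃ (μ : Measure 𝔇.X) (w : ∀ x, 𝔇.fib x), IsFiniteMeasure μ ∧ μ.Regular ∧
      IsIntegralOfVectors π ξ μ w ∧ Integrable (fun x => ‖w x‖ ^ 2) μ ∧
      ∫ x, ‖w x‖ ^ 2 ∂μ = ‖ξ‖ ^ 2 := by
  obtain ⟨μ, hμ, hμ', h⟩ := exists_measure_rankOneVec hπ B ζ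
  have key : ∀ n : ℕ, ∃ A, ‖rankOneVec hπ B ζ A - ξ‖ < (1 / 2) ^ n := fun n => by
    obtain ⟨_, ⟨A, rfl⟩, hA⟩ := Metric.mem_closure_iff.mp hξ ((1 / 2) ^ n) (by positivity)
    exact ⟨A, by rwa [dist_comm, dist_eq_norm] at hA⟩
  choose A hA using key
  have hlim : Tendsto (fun n => rankOneVec hπ B ζ (A n)) atTop (𝓝 ξ) := by
    rw [tendsto_iff_norm_sub_tendsto_zero]
    exact squeeze_zero (fun _ => norm_nonneg _) (fun n => (hA n).le)
      (tendsto_pow_atTop_nhds_zero_of_lt_one (by norm_num) (by norm_num))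
  have hd := fun n => integral_norm_vec_sq h (A (n + 1) - A n)
  simp only [vec_sub] at hd
  -- Consecutive vectors differ by at most 2 · 2^{-n}; squaring gives 4 · 4^{-n}, hence C = 4.
  obtain ⟨w, g, hg, hw, hwg⟩ := exists_ae_tendsto_of_integral_le (μ := μ)
    (fun n x => 𝔇.vec (A n) x) (integral_norm_vec_sq h (A 0)).1 (fun n => (hd n).1) (C := 4)
    (fun n => by
      rw [(hd n).2, map_sub]
      have h1 : ‖rankOneVec hπ B ζ (A (n + 1)) - rankOneVec hπ B ζ (A n)‖ ≤ 2 * (1 / 2) ^ n := by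
        rw [← sub_sub_sub_cancel_right _ _ ξ]
        refine (norm_sub_le _ _).trans ?_
        have h2 := (hA (n + 1)).le
        have h3 := (hA n).le
        rw [pow_succ] at h2
        have h4 : (0 : ℝ) < (1 / 2) ^ n := by positivity
        linarith
      refine (pow_le_pow_left₀ (norm_nonneg _) h1 2).trans_eq ?_
      rw [mul_pow, ← pow_mul, mul_comm n, pow_mul]
      norm_num)
  -- The identity field gives the norm of w. It is treated apart because it need not belong to `L̃`.
  have hself := integrable_inner_and_integral_eq (μ := μ) hg hw hwg
    (fun x => ContinuousLinearMap.id ℂ (𝔇.fib x)) (C := 1)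
    (fun x => ContinuousLinearMap.norm_id_le)
    (fun n => (continuous_inner_vec (A n) (A n)).aestronglyMeasurable) (l := ⟪ξ, ξ⟫_ℂ) (by
      refine (hlim.inner hlim).congr fun n => ?_
      exact h _ _)
  simp only [ContinuousLinearMap.id_apply, inner_self_eq_ofReal, integral_complex_ofReal] at hself
  refine ⟨μ, w, hμ, hμ', ⟨fun a => ?_, fun a => ?_⟩, integrable_ofReal_iff.mp hself.1,
    by exact_mod_cast hself.2⟩
  all_goals
    have hl : Tendsto (fun n => ∫ x, ⟪𝔇.vec (A n) x,
        evalAt 𝔇.fib x (a : 𝔇.Sections) (𝔇.vec (A n) x)⟫_ℂ ∂μ) atTop (𝓝 ⟪ξ, π a ξ⟫_ℂ) :=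
      (hlim.inner (((π a).continuous.tendsto _).comp hlim)).congr fun n =>
        inner_apply_rankOneVec h a _ _
    have := integrable_inner_and_integral_eq (μ := μ) hg hw hwg
      (fun x => evalAt 𝔇.fib x (a : 𝔇.Sections)) (fun x => norm_evalAt_le _ x)
      (fun n => (continuous_inner_Ltilde a (A n) (A n)).aestronglyMeasurable) hl
  · exact this.1
  · exact this.2.symm

end AbelianData

end HostAlgebra

/-! ### Merging countably many integrals of vector states into one. -/

namespace HostAlgebra

open Filter Topology
open scoped NNReal

/-- A measure with integrable density with respect to an inner regular finite measure is inner
regular. -/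
lemma innerRegular_withDensity {α : Type*} [TopologicalSpace α] [T2Space α] [MeasurableSpace α]
    [BorelSpace α] {μ : Measure α} [IsFiniteMeasure μ] [μ.Regular] {f : α → ℝ≥0∞}
    (hf : ∫⁻ x, f x ∂μ ≠ ∞) : (μ.withDensity f).InnerRegular := by
  refine ⟨fun U hU r hr => ?_⟩
  rw [withDensity_apply _ hU] at hr
  -- By absolute continuity of the integral, a compact K in U with μ(U \ K) < δ loses less than the
  -- slack ∫_U f - r.
  obtain ⟨δ, hδ, h⟩ := exists_pos_setLIntegral_lt_of_measure_lt hf (tsub_pos_of_lt hr).ne'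
  obtain ⟨K, hKU, hK, hd⟩ := hU.exists_isCompact_sdiff_lt (measure_ne_top μ U) hδ.ne'
  refine ⟨K, hKU, hK, ?_⟩
  have hKm : MeasurableSet K := hK.isClosed.measurableSet
  rw [withDensity_apply _ hKm]
  have h1 := lintegral_inter_add_sdiff (μ := μ) f U hKm
  rw [Set.inter_eq_right.mpr hKU] at h1
  by_contra hlt
  have h2 := h _ hd
  have h3 : ∫⁻ x in U, f x ∂μ < r + (∫⁻ x in U, f x ∂μ - r) := by
    conv_lhs => rw [← h1]
    exact ENNReal.add_lt_add_of_le_of_lt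
      (ne_top_of_le_ne_top hr.ne_top (not_lt.mp hlt)) (not_lt.mp hlt) h2
  rw [add_tsub_cancel_of_le hr.le] at h3
  exact h3.false

section Field

variable {α : Type*} [MeasurableSpace α] {K : α → Type*} [∀ x, NormedAddCommGroup (K x)]

lemma inner_smul_apply_smul {E : Type*} [NormedAddCommGroup E] [InnerProductSpace ℂ E] (r : ℝ)
    (v : E) (S : E →L[ℂ] E) : ⟪(r : ℂ) • v, S ((r : ℂ) • v)⟫_ℂ = ((r ^ 2 : ℝ) : ℂ) * ⟪v, S v⟫_ℂ := by
  rw [map_smul, inner_smul_left, inner_smul_right, Complex.conj_ofReal]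
  push_cast
  ring

/-- The measure with density `‖w‖²`. -/
noncomputable def normSqMeasure (μ : Measure α) (w : ∀ x, K x) : Measure α :=
  μ.withDensity fun x => ((‖w x‖₊ ^ 2 : ℝ≥0) : ℝ≥0∞)

variable {μ : Measure α} {w : ∀ x, K x}

lemma aemeasurable_nnnorm_sq (hw : Integrable (fun x => ‖w x‖ ^ 2) μ) :
    AEMeasurable (fun x => ‖w x‖₊ ^ 2) μ := by
  have h := hw.aemeasurable.real_toNNReal
  refine h.congr (Eventually.of_forall fun x => ?_)
  exact Subtype.ext (Real.coe_toNNReal _ (sq_nonneg _))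

lemma lintegral_nnnorm_sq (hw : Integrable (fun x => ‖w x‖ ^ 2) μ) :
    ∫⁻ x, ((‖w x‖₊ ^ 2 : ℝ≥0) : ℝ≥0∞) ∂μ = ENNReal.ofReal (∫ x, ‖w x‖ ^ 2 ∂μ) := by
  rw [ofReal_integral_eq_lintegral_ofReal hw (Eventually.of_forall fun x => sq_nonneg _)]
  refine lintegral_congr fun x => ?_
  rw [ENNReal.ofReal_pow (norm_nonneg _), ofReal_norm, enorm_eq_nnnorm]
  push_cast
  rfl

lemma normSqMeasure_univ (hw : Integrable (fun x => ‖w x‖ ^ 2) μ) :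
    normSqMeasure μ w Set.univ = ENNReal.ofReal (∫ x, ‖w x‖ ^ 2 ∂μ) := by
  rw [normSqMeasure, withDensity_apply _ MeasurableSet.univ, setLIntegral_univ,
    lintegral_nnnorm_sq hw]

lemma ae_normSqMeasure_ne_zero (hw : Integrable (fun x => ‖w x‖ ^ 2) μ) :
    ∀ᵐ x ∂(normSqMeasure μ w), w x ≠ 0 := by
  rw [normSqMeasure, ae_withDensity_iff' (aemeasurable_nnnorm_sq hw).coe_nnreal_ennreal]
  refine Eventually.of_forall fun x h h0 => h ?_
  simp [h0]

variable [∀ x, InnerProductSpace ℂ (K x)]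

/-- Integrals of vector states, in terms of unit vectors. -/
lemma integral_normSqMeasure (hw : Integrable (fun x => ‖w x‖ ^ 2) μ) (S : ∀ x, K x →L[ℂ] K x)
    (hS : Integrable (fun x => ⟪w x, S x (w x)⟫_ℂ) μ) :
    Integrable (fun x => ((‖w x‖⁻¹ ^ 2 : ℝ) : ℂ) * ⟪w x, S x (w x)⟫_ℂ) (normSqMeasure μ w) ∧
      ∫ x, ((‖w x‖⁻¹ ^ 2 : ℝ) : ℂ) * ⟪w x, S x (w x)⟫_ℂ ∂(normSqMeasure μ w)
        = ∫ x, ⟪w x, S x (w x)⟫_ℂ ∂μ := by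
  have h : (fun x => ‖w x‖₊ ^ 2 • (((‖w x‖⁻¹ ^ 2 : ℝ) : ℂ) * ⟪w x, S x (w x)⟫_ℂ))
      = fun x => ⟪w x, S x (w x)⟫_ℂ := by
    ext x
    rw [NNReal.smul_def]
    by_cases h0 : w x = 0
    · simp [h0]
    · have : ‖w x‖ ≠ 0 := norm_ne_zero_iff.mpr h0
      rw [Complex.real_smul, ← mul_assoc, ← Complex.ofReal_mul]
      have h2 : ((‖w x‖₊ ^ 2 : ℝ≥0) : ℝ) * ‖w x‖⁻¹ ^ 2 = 1 := by
        push_cast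
        field_simp
      rw [h2, Complex.ofReal_one, one_mul]
  rw [normSqMeasure, integrable_withDensity_iff_integrable_smul₀ (aemeasurable_nnnorm_sq hw),
    integral_withDensity_eq_integral_smul₀ (aemeasurable_nnnorm_sq hw), h]
  exact ⟨hS, rfl⟩

end Field

/-- The sum of the densities and the constant 1 are both densities of the sum measure with respect
to itself. -/
lemma hasSum_rnDeriv_sum {α : Type*} [MeasurableSpace α] {μ : ℕ → Measure α}
    [IsFiniteMeasure (Measure.sum μ)] [∀ n, IsFiniteMeasure (μ n)] :
    ∀ᵐ x ∂(Measure.sum μ),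
      HasSum (fun n => ((μ n).rnDeriv (Measure.sum μ) x).toReal) 1 := by
  set ν := Measure.sum μ
  have hac : ∀ n, μ n ≪ ν := fun n => Measure.absolutelyContinuous_sum_right n .rfl
  have h1 : ν.withDensity (∑' n, (μ n).rnDeriv ν) = ν.withDensity 1 := by
    rw [withDensity_tsum fun n => Measure.measurable_rnDeriv _ _, withDensity_one]
    simp only [Measure.withDensity_rnDeriv_eq _ _ (hac _)]
    rfl
  have hm : Measurable (∑' n, (μ n).rnDeriv ν) := by
    have h : ∑' n, (μ n).rnDeriv ν = fun x => ∑' n, (μ n).rnDeriv ν x :=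
      funext fun x => tsum_apply (Pi.summable.mpr fun _ => ENNReal.summable)
    rw [h]
    exact Measurable.tsum fun n => Measure.measurable_rnDeriv _ _
  filter_upwards [(withDensity_eq_iff_of_sigmaFinite hm.aemeasurable aemeasurable_const).mp h1]
    with x hx
  rw [tsum_apply (Pi.summable.mpr fun _ => ENNReal.summable)] at hx
  have hx' : ∑' n, (μ n).rnDeriv ν x = 1 := hx
  have h2 := ENNReal.hasSum_toReal (f := fun n => (μ n).rnDeriv ν x) (by rw [hx']; simp)
  rw [← ENNReal.tsum_toReal_eq (f := fun n => (μ n).rnDeriv ν x)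
    fun n => ENNReal.ne_top_of_tsum_ne_top (by rw [hx']; simp) n, hx', ENNReal.toReal_one] at h2
  exact h2

/-- A countable sum of integrals of vector states is the integral of states given by square
summable sequences of vectors. -/
theorem exists_measure_of_hasSum {α : Type*} [TopologicalSpace α] [T2Space α] [MeasurableSpace α]
    [BorelSpace α] {K : α → Type*} [∀ x, NormedAddCommGroup (K x)]
    [∀ x, InnerProductSpace ℂ (K x)] {μ : ℕ → Measure α} [∀ n, IsFiniteMeasure (μ n)]
    [∀ n, (μ n).Regular] {w : ℕ → ∀ x, K x} (hw : ∀ n, Integrable (fun x => ‖w n x‖ ^ 2) (μ n))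
    (h1 : HasSum (fun n => ∫ x, ‖w n x‖ ^ 2 ∂(μ n)) 1) :
    ∃ (ν : Measure α) (v : ∀ x, ℕ → K x), IsProbabilityMeasure ν ∧ ν.Regular ∧
      (∀ᵐ x ∂ν, HasSum (fun n => ‖v x n‖ ^ 2) 1) ∧
      ∀ (S : ∀ x, K x →L[ℂ] K x) (C : ℝ), (∀ x, ‖S x‖ ≤ C) →
        (∀ n, Integrable (fun x => ⟪w n x, S x (w n x)⟫_ℂ) (μ n)) →
        Integrable (fun x => ∑' n, ⟪v x n, S x (v x n)⟫_ℂ) ν ∧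
        ∫ x, ∑' n, ⟪v x n, S x (v x n)⟫_ℂ ∂ν = ∑' n, ∫ x, ⟪w n x, S x (w n x)⟫_ℂ ∂(μ n) := by
  set μ' : ℕ → Measure α := fun n => normSqMeasure (μ n) (w n)
  set ν : Measure α := Measure.sum μ'
  -- Inner regularity passes to countable sums; with finite total mass it yields regularity of ν.
  have hreg : ∀ n, (μ' n).InnerRegular := fun n => innerRegular_withDensity (by
    rw [lintegral_nnnorm_sq (hw n)]
    exact ENNReal.ofReal_ne_top)
  have hfin : ∀ n, IsFiniteMeasure (μ' n) := fun n => ⟨by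
    rw [normSqMeasure_univ (hw n)]
    exact ENNReal.ofReal_lt_top⟩
  have hprob : IsProbabilityMeasure ν := ⟨by
    rw [Measure.sum_apply _ MeasurableSet.univ]
    simp only [μ', normSqMeasure_univ (hw _)]
    rw [← ENNReal.ofReal_tsum_of_nonneg (fun n => integral_nonneg fun x => sq_nonneg _)
      h1.summable, h1.tsum_eq, ENNReal.ofReal_one]⟩
  have hac : ∀ n, μ' n ≪ ν := fun n => Measure.absolutelyContinuous_sum_right n .rfl
  set q : ℕ → α → ℝ := fun n x => ((μ' n).rnDeriv ν x).toReal
  have hq0 : ∀ n x, 0 ≤ q n x := fun n x => ENNReal.toReal_nonneg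
  have hq : ∀ᵐ x ∂ν, HasSum (fun n => q n x) 1 := hasSum_rnDeriv_sum
  -- Where wₙ vanishes the factor on the left is 0, by 0⁻¹ = 0. The n-th measure does not charge
  -- that set, so qₙ is 0 almost everywhere on it.
  have hqw : ∀ᵐ x ∂ν, ∀ n, q n x * (‖w n x‖⁻¹ ^ 2 * ‖w n x‖ ^ 2) = q n x := by
    rw [ae_all_iff]
    intro n
    filter_upwards [Measure.ae_rnDeriv_ne_zero_imp_of_ae ν (ae_normSqMeasure_ne_zero (hw n))]
      with x hx
    by_cases h : (μ' n).rnDeriv ν x = 0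
    · simp [q, h]
    · have : ‖w n x‖ ≠ 0 := norm_ne_zero_iff.mpr (hx h)
      rw [← mul_pow, inv_mul_cancel₀ this, one_pow, mul_one]
  -- The unit vector of wₙ(x), scaled so that ‖vₙ(x)‖² = qₙ(x), the share of the n-th measure in ν
  -- at x.
  let v : ∀ x, ℕ → K x := fun x n => ((√(q n x) * ‖w n x‖⁻¹ : ℝ) : ℂ) • w n x
  have hv : ∀ᵐ x ∂ν, HasSum (fun n => ‖v x n‖ ^ 2) 1 := by
    filter_upwards [hq, hqw] with x hx hx'
    refine hx.congr_fun fun n => ?_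
    rw [norm_smul, mul_pow, Complex.norm_real, Real.norm_eq_abs, sq_abs, mul_pow,
      Real.sq_sqrt (hq0 n x), mul_assoc, hx']
  have hvS : ∀ (S : ∀ x, K x →L[ℂ] K x) (n : ℕ) (x : α), ⟪v x n, S x (v x n)⟫_ℂ
      = q n x • (((‖w n x‖⁻¹ ^ 2 : ℝ) : ℂ) * ⟪w n x, S x (w n x)⟫_ℂ) := fun S n x => by
    rw [inner_smul_apply_smul, mul_pow, Real.sq_sqrt (hq0 n x), Complex.real_smul]
    push_cast
    ring
  refine ⟨ν, v, hprob, inferInstance, hv, fun S C hS hSi => ?_⟩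
  have hi : ∀ n, Integrable (fun x => ⟪v x n, S x (v x n)⟫_ℂ) ν := fun n => by
    simp only [hvS]
    exact (integrable_rnDeriv_smul_iff (hac n)).mpr (integral_normSqMeasure (hw n) S (hSi n)).1
  have hie : ∀ n, ∫ x, ⟪v x n, S x (v x n)⟫_ℂ ∂ν = ∫ x, ⟪w n x, S x (w n x)⟫_ℂ ∂(μ n) := fun n => by
    simp only [hvS]
    exact (integral_rnDeriv_smul (hac n)).trans (integral_normSqMeasure (hw n) S (hSi n)).2
  have hqi : ∀ n, Integrable (q n) ν := fun n => Measure.integrable_toReal_rnDeriv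
  have hqe : ∀ n, ∫ x, q n x ∂ν = ∫ x, ‖w n x‖ ^ 2 ∂(μ n) := fun n => by
    rw [Measure.integral_toReal_rnDeriv (hac n), Measure.real, normSqMeasure_univ (hw n),
      ENNReal.toReal_ofReal (integral_nonneg fun x => sq_nonneg _)]
  have hbd : ∀ n, ∀ᵐ x ∂ν, ‖⟪v x n, S x (v x n)⟫_ℂ‖ ≤ C * q n x := fun n => by
    filter_upwards [hqw] with x hx
    refine (norm_inner_apply_le _ _).trans ?_
    rw [norm_smul, mul_pow, Complex.norm_real, Real.norm_eq_abs, sq_abs, mul_pow,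
      Real.sq_sqrt (hq0 n x), mul_assoc, hx]
    exact mul_le_mul_of_nonneg_right (hS x) (hq0 n x)
  -- The n-th integral is at most C ∫ ‖wₙ‖² dμₙ, which is summable; this permits exchanging sum and
  -- integral.
  have hsum : Summable fun n => ∫ x, ‖⟪v x n, S x (v x n)⟫_ℂ‖ ∂ν := by
    refine Summable.of_nonneg_of_le (fun n => integral_nonneg fun x => norm_nonneg _)
      (fun n => ?_) (h1.summable.mul_left C)
    rw [← hqe, ← integral_const_mul]
    exact integral_mono_ae (hi n).norm ((hqi n).const_mul C) (hbd n)
  refine ⟨Integrable.of_bound (C := C)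
    (AEMeasurable.tsum fun n => (hi n).aemeasurable).aestronglyMeasurable ?_, ?_⟩
  · filter_upwards [hv, hq] with x hx hx'
    have h3 := tsum_of_norm_bounded (hx.mul_left C) fun n =>
      (norm_inner_apply_le (S x) (v x n)).trans (mul_le_mul_of_nonneg_right (hS x) (sq_nonneg _))
    rwa [mul_one] at h3
  · rw [← (hasSum_integral_of_summable_integral_norm hi hsum).tsum_eq]
    simp only [hie]

end HostAlgebra

/-! ### GNS representations and increasing sequences of reducing subspaces. -/

namespace HostAlgebra

open Filter Topology

/-- The GNS representation of a state of a C*-subalgebra. -/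
lemma IsState.exists_isRep {B : Type u} [NonUnitalCStarAlgebra B]
    {S : NonUnitalStarSubalgebra ℂ B} {φ : S →L[ℂ] ℂ} (h : IsState (A := S) φ)
    (hS : IsClosed (S : Set B)) :
    ∃ (G : Type u) (_ : NormedAddCommGroup G) (_ : InnerProductSpace ℂ G) (_ : CompleteSpace G)
      (π : S → (G →L[ℂ] G)) (Ω : G), IsRep π ∧ ‖Ω‖ = 1 ∧ (∀ a, φ a = ⟪Ω, π a Ω⟫_ℂ) ∧
        Ω ∈ closure (Set.range fun a => π a Ω) := by
  have h : IsState (A := S) φ := h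
  let := CStarAlgebra.spectralOrder S
  have := CStarAlgebra.spectralOrderedRing S
  refine ⟨GNSSpace h.toPositive, inferInstance, inferInstance, inferInstance,
    gnsRep' h.toPositive, h.cyclicVector, ⟨map_add _, map_smul _, map_mul _, map_star _,
    norm_gnsRep'_le _⟩, h.norm_cyclicVector, fun a => (h.inner_rep a).symm, ?_⟩
  simp only [h.rep_cyclicVector]
  exact denseRange_gnsClass _ _

section Projections

variable {G : Type*} [NormedAddCommGroup G] [InnerProductSpace ℂ G]

/-- T commutes with the projections, so there are no cross terms between increments and the sum
telescopes. -/
lemma sum_range_inner_starProjection_sub {N : ℕ → Submodule ℂ G}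
    [∀ n, (N n).HasOrthogonalProjection] (hN : Monotone N) (h0 : N 0 = ⊥) (Ω : G) {T : G →L[ℂ] G}
    (hT : ∀ n z, T ((N n).starProjection z) = (N n).starProjection (T z)) (n : ℕ) :
    ∑ i ∈ Finset.range n, ⟪(N (i + 1)).starProjection Ω - (N i).starProjection Ω,
      T ((N (i + 1)).starProjection Ω - (N i).starProjection Ω)⟫_ℂ
      = ⟪(N n).starProjection Ω, T Ω⟫_ℂ := by
  have hPP : ∀ n m z, n ≤ m → (N n).starProjection ((N m).starProjection z)
      = (N n).starProjection z := fun n m z h => by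
    rw [← ContinuousLinearMap.comp_apply,
      Submodule.starProjection_comp_starProjection_of_le (hN h)]
  have hPP' : ∀ n m z, n ≤ m → (N m).starProjection ((N n).starProjection z)
      = (N n).starProjection z := fun n m z h =>
    Submodule.starProjection_eq_self_iff.mpr (hN h (Submodule.starProjection_apply_mem _ _))
  have hsym : ∀ n x y, ⟪(N n).starProjection x, y⟫_ℂ = ⟪x, (N n).starProjection y⟫_ℂ :=
    fun n x y => Submodule.starProjection_isSymmetric _ x y
  have h1 : ∀ n, ⟪(N (n + 1)).starProjection Ω - (N n).starProjection Ω,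
      T ((N (n + 1)).starProjection Ω - (N n).starProjection Ω)⟫_ℂ
      = ⟪(N (n + 1)).starProjection Ω, T Ω⟫_ℂ - ⟪(N n).starProjection Ω, T Ω⟫_ℂ := fun n => by
    rw [map_sub, hT, hT, inner_sub_left, inner_sub_right, inner_sub_right]
    simp only [hsym, hPP _ _ _ le_rfl, hPP _ _ _ n.le_succ, hPP' _ _ _ n.le_succ]
    ring
  simp only [h1]
  have h3 : (N 0).starProjection Ω = 0 :=
    (Submodule.mem_bot ℂ).mp (h0.le (Submodule.starProjection_apply_mem _ _))
  rw [Finset.sum_range_sub (fun i => ⟪(N i).starProjection Ω, T Ω⟫_ℂ), h3, inner_zero_left,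
    sub_zero]

lemma hasSum_norm_starProjection_sub_sq {N : ℕ → Submodule ℂ G}
    [∀ n, (N n).HasOrthogonalProjection] (hN : Monotone N) (h0 : N 0 = ⊥) {Ω : G}
    (hΩ : Tendsto (fun n => (N n).starProjection Ω) atTop (𝓝 Ω)) :
    HasSum (fun n => ‖(N (n + 1)).starProjection Ω - (N n).starProjection Ω‖ ^ 2) (‖Ω‖ ^ 2) := by
  rw [hasSum_iff_tendsto_nat_of_nonneg fun n => sq_nonneg _]
  have h := fun n => sum_range_inner_starProjection_sub hN h0 Ω
    (T := ContinuousLinearMap.id ℂ G) (fun n z => rfl) n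
  simp only [ContinuousLinearMap.id_apply, inner_self_eq_ofReal, ← Complex.ofReal_sum] at h
  have h2 := fun n => congrArg Complex.re (h n)
  simp only [Complex.ofReal_re] at h2
  simp only [h2]
  have h3 : ‖Ω‖ ^ 2 = (⟪Ω, Ω⟫_ℂ).re := by rw [inner_self_eq_ofReal, Complex.ofReal_re]
  rw [h3]
  exact (Complex.continuous_re.tendsto _).comp (hΩ.inner tendsto_const_nhds)

/-- A vector state is the sum of its components along an increasing sequence of reducing
subspaces. -/
lemma hasSum_inner_starProjection_sub {N : ℕ → Submodule ℂ G}
    [∀ n, (N n).HasOrthogonalProjection] (hN : Monotone N) (h0 : N 0 = ⊥) {Ω : G}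
    (hΩ : Tendsto (fun n => (N n).starProjection Ω) atTop (𝓝 Ω)) {T : G →L[ℂ] G}
    (hT : ∀ n z, T ((N n).starProjection z) = (N n).starProjection (T z)) :
    HasSum (fun n => ⟪(N (n + 1)).starProjection Ω - (N n).starProjection Ω,
      T ((N (n + 1)).starProjection Ω - (N n).starProjection Ω)⟫_ℂ) ⟪Ω, T Ω⟫_ℂ := by
  rw [(summable_inner_apply (hasSum_norm_starProjection_sub_sq hN h0 hΩ).summable
    T).hasSum_iff_tendsto_nat]
  simp only [sum_range_inner_starProjection_sub hN h0 Ω hT]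
  exact hΩ.inner tendsto_const_nhds

lemma apply_starProjection_eq [CompleteSpace G] {N : Submodule ℂ G} [N.HasOrthogonalProjection]
    {T : G →L[ℂ] G} (h1 : ∀ z ∈ N, T z ∈ N) (h2 : ∀ z ∈ N, star T z ∈ N) (z : G) :
    T (N.starProjection z) = N.starProjection (T z) := by
  refine (Submodule.eq_starProjection_of_mem_orthogonal
    (h1 _ (Submodule.starProjection_apply_mem _ _)) ?_).symm
  rw [← map_sub, Submodule.mem_orthogonal]
  intro y hy
  rw [← AbelianData.inner_star]
  exact Submodule.sub_starProjection_mem_orthogonal z _ (h2 y hy)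

end Projections

end HostAlgebra

/-! ### Decomposition of an arbitrary state of `L̃`. -/

namespace HostAlgebra

open Filter Topology

lemma IsRep.continuous_apply {B : Type*} [NonUnitalCStarAlgebra B]
    {S : NonUnitalStarSubalgebra ℂ B} {G : Type*} [NormedAddCommGroup G] [InnerProductSpace ℂ G]
    [CompleteSpace G] {π : S → (G →L[ℂ] G)} (hπ : IsRep π) (z : G) :
    Continuous fun a => π a z := by
  let I : S →ₗ[ℂ] G :=
    { toFun := fun a => π a z
      map_add' := fun a b => by rw [hπ.map_add, add_apply]
      map_smul' := fun r a => by rw [hπ.map_smul, smul_apply, RingHom.id_apply] }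
  refine AddMonoidHomClass.continuous_of_bound I ‖z‖ fun a => ?_
  rw [mul_comm]
  exact ((π a).le_opNorm z).trans (mul_le_mul_of_nonneg_right (hπ.norm_le a) (norm_nonneg _))

/-- The vector is the limit of a sequence whose terms each use finitely many indices. This replaces
any separability assumption. -/
lemma exists_seq_mem_closure_iSup {G : Type*} [NormedAddCommGroup G] [InnerProductSpace ℂ G]
    {ι : Type*} [Nonempty ι] {M : ι → Submodule ℂ G} {z : G}
    (hz : z ∈ (⨆ i, M i).topologicalClosure) :
    ∃ f : ℕ → ι, z ∈ (⨆ n, M (f n)).topologicalClosure := by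
  obtain ⟨y, hy, hyz⟩ := mem_closure_iff_seq_limit.mp hz
  choose F hF using fun n => Submodule.mem_iSup_iff_exists_finset.mp (hy n)
  obtain ⟨f, hf⟩ := Set.countable_iff_exists_subset_range.mp
    (Set.countable_iUnion fun n => (F n).countable_toSet)
  refine ⟨f, mem_closure_iff_seq_limit.mpr ⟨y, fun n => ?_, hyz⟩⟩
  refine (iSup₂_le fun i hi => ?_ : ⨆ i ∈ F n, M i ≤ ⨆ n, M (f n)) (hF n)
  obtain ⟨k, rfl⟩ := hf (Set.mem_iUnion_of_mem n hi)
  exact le_iSup (fun n => M (f n)) k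

lemma topologicalClosure_le_comap {G : Type*} [NormedAddCommGroup G] [InnerProductSpace ℂ G]
    {M N : Submodule ℂ G} (hN : IsClosed (N : Set G)) {T : G →L[ℂ] G}
    (h : ∀ z ∈ M, T z ∈ N) : ∀ z ∈ M.topologicalClosure, T z ∈ N := fun _ hz =>
  closure_minimal (t := T ⁻¹' N) h (hN.preimage T.continuous) hz

namespace AbelianData

variable {H : Type u} [NormedAddCommGroup H] [InnerProductSpace ℂ H] [CompleteSpace H]
variable {𝔇 : AbelianData H}
variable {G : Type u} [NormedAddCommGroup G] [InnerProductSpace ℂ G] [CompleteSpace G]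
variable {π : 𝔇.Ltilde → (G →L[ℂ] G)}

lemma apply_mem_of_rankOneL (hπ : IsRep π) {N : Submodule ℂ G} (hN : IsClosed (N : Set G)) {z : G}
    (h : ∀ A B, π (𝔇.rankOneL B A) z ∈ N) (a : 𝔇.Ltilde) : π a z ∈ N := by
  refine Ltilde_induction (p := fun a => π a z ∈ N) (hN.preimage (hπ.continuous_apply z)) h
    (fun a b ha hb => ?_) (fun r a ha => ?_) a
  · exact (congrArg (fun T : G →L[ℂ] G => T z ∈ N) (hπ.map_add a b)).mpr (add_mem ha hb)
  · exact (congrArg (fun T : G →L[ℂ] G => T z ∈ N) (hπ.map_smul r a)).mpr (N.smul_mem r ha)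

variable (hπ : IsRep π)

lemma mem_closure_iSup_rankOneVec {Ω : G} (hΩ : Ω ∈ closure (Set.range fun a => π a Ω)) :
    Ω ∈ (⨆ B, LinearMap.range (rankOneVec hπ B Ω)).topologicalClosure := by
  refine closure_minimal ?_ (Submodule.isClosed_topologicalClosure _) hΩ
  rintro _ ⟨a, rfl⟩
  refine apply_mem_of_rankOneL hπ (Submodule.isClosed_topologicalClosure _) (fun A B => ?_) a
  exact Submodule.le_topologicalClosure _ (Submodule.mem_iSup_of_mem B ⟨A, rfl⟩)

/-- An operator commuting with π only moves the base vector ζ; it is applied to the complement of a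
reducing projection. -/
lemma map_rankOneVec {T : G →L[ℂ] G} (hT : ∀ a z, π a (T z) = T (π a z)) (B A : 𝔇.com) (ζ : G) :
    T (rankOneVec hπ B ζ A) = rankOneVec hπ B (T ζ) A := (hT _ _).symm

/-- The reducing subspace generated by the first `n` subspaces `π(|·)(Bᵢ|) Ω`. -/
noncomputable def partialSpace (B : ℕ → 𝔇.com) (Ω : G) (n : ℕ) : Submodule ℂ G :=
  (⨆ i ∈ Finset.range n, LinearMap.range (rankOneVec hπ (B i) Ω)).topologicalClosure

instance (B : ℕ → 𝔇.com) (Ω : G) (n : ℕ) :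
    CompleteSpace (partialSpace hπ B Ω n) :=
  (Submodule.isClosed_topologicalClosure _).completeSpace_coe

variable (B : ℕ → 𝔇.com) (Ω : G)

lemma partialSpace_mono : Monotone (partialSpace hπ B Ω) := fun _ _ h =>
  Submodule.topologicalClosure_mono (biSup_mono fun _ hi =>
    Finset.mem_range.mpr ((Finset.mem_range.mp hi).trans_le h))

lemma partialSpace_zero : partialSpace hπ B Ω 0 = ⊥ := by
  rw [eq_bot_iff]
  exact Submodule.topologicalClosure_minimal _ (by simp) (by simp)

lemma rankOneVec_mem_partialSpace {i n : ℕ} (h : i < n) (A : 𝔇.com) :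
    rankOneVec hπ (B i) Ω A ∈ partialSpace hπ B Ω n :=
  Submodule.le_topologicalClosure _
    (Submodule.mem_iSup_of_mem i (Submodule.mem_iSup_of_mem (Finset.mem_range.mpr h) ⟨A, rfl⟩))

lemma map_mem_of_mem_partialSpace {N : Submodule ℂ G} (hN : IsClosed (N : Set G)) {T : G →L[ℂ] G}
    {n : ℕ} (h : ∀ i < n, ∀ A, T (rankOneVec hπ (B i) Ω A) ∈ N) {z : G}
    (hz : z ∈ partialSpace hπ B Ω n) : T z ∈ N := by
  refine topologicalClosure_le_comap hN (fun z hz => ?_) z hz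
  refine (iSup₂_le fun i hi => ?_ : ⨆ i ∈ Finset.range n, LinearMap.range (rankOneVec hπ (B i) Ω)
    ≤ N.comap (T : G →ₗ[ℂ] G)) hz
  rintro _ ⟨A, rfl⟩
  exact h i (Finset.mem_range.mp hi) A

/-- Multiplying |A)(Bᵢ| from the left by an element of `L̃` changes only A, so each generating
subspace is respected. -/
lemma apply_mem_partialSpace (a : 𝔇.Ltilde) {n : ℕ} {z : G} (hz : z ∈ partialSpace hπ B Ω n) :
    π a z ∈ partialSpace hπ B Ω n := by
  refine map_mem_of_mem_partialSpace hπ B Ω (Submodule.isClosed_topologicalClosure _)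
    (fun i hi A => ?_) hz
  refine apply_mem_of_rankOneL hπ (Submodule.isClosed_topologicalClosure _) (fun C D => ?_) a
  rw [apply_rankOneVec]
  exact rankOneVec_mem_partialSpace hπ B Ω hi _

lemma apply_starProjection_partialSpace (a : 𝔇.Ltilde) (n : ℕ) (z : G) :
    π a ((partialSpace hπ B Ω n).starProjection z)
      = (partialSpace hπ B Ω n).starProjection (π a z) :=
  apply_starProjection_eq (fun _ hz => apply_mem_partialSpace hπ B Ω a hz) (fun z hz => by
    rw [← hπ.map_star]
    exact apply_mem_partialSpace hπ B Ω _ hz) z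

variable {B Ω} in
lemma tendsto_starProjection_partialSpace
    (h : Ω ∈ (⨆ n, LinearMap.range (rankOneVec hπ (B n) Ω)).topologicalClosure) :
    Tendsto (fun n => (partialSpace hπ B Ω n).starProjection Ω) atTop (𝓝 Ω) := by
  have : CompleteSpace (⨆ n, partialSpace hπ B Ω n).topologicalClosure :=
    (Submodule.isClosed_topologicalClosure _).completeSpace_coe
  have h1 := Submodule.starProjection_tendsto_closure_iSup (partialSpace hπ B Ω)
    (partialSpace_mono hπ B Ω) Ω
  rwa [Submodule.starProjection_eq_self_iff.mpr] at h1
  refine Submodule.topologicalClosure_mono (iSup_le fun n => ?_) h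
  rintro _ ⟨A, rfl⟩
  exact Submodule.mem_iSup_of_mem (n + 1) (rankOneVec_mem_partialSpace hπ B Ω n.lt_succ_self A)

/-- The increments of `Ω` along the subspaces are generated by one `B` only. -/
lemma starProjection_sub_mem (n : ℕ) :
    (partialSpace hπ B Ω (n + 1)).starProjection Ω - (partialSpace hπ B Ω n).starProjection Ω
      ∈ closure (Set.range (rankOneVec hπ (B n) (Ω - (partialSpace hπ B Ω n).starProjection Ω))) := by
  set P := (partialSpace hπ B Ω n).starProjection
  set N := (LinearMap.range (rankOneVec hπ (B n) (Ω - P Ω))).topologicalClosure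
  change _ ∈ N
  -- The generating indices are 0, …, n. The operator 1 - P kills the pieces of index below n, and
  -- carries the piece of index n over Ω into the one over (1 - P)Ω.
  have h1 : ((ContinuousLinearMap.id ℂ G) - P) ((partialSpace hπ B Ω (n + 1)).starProjection Ω)
      ∈ N := by
    refine map_mem_of_mem_partialSpace hπ B Ω (Submodule.isClosed_topologicalClosure _)
      (fun i hi A => ?_) (Submodule.starProjection_apply_mem _ _)
    rcases Nat.lt_succ_iff_lt_or_eq.mp hi with hi | rfl
    · have h2 : P (rankOneVec hπ (B i) Ω A) = rankOneVec hπ (B i) Ω A :=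
        Submodule.starProjection_eq_self_iff.mpr (rankOneVec_mem_partialSpace hπ B Ω hi A)
      rw [sub_apply, h2]
      simp
    · rw [map_rankOneVec hπ (T := ContinuousLinearMap.id ℂ G - P) fun a z => by
        rw [sub_apply, map_sub, apply_starProjection_partialSpace]
        rfl]
      exact Submodule.le_topologicalClosure _ ⟨A, rfl⟩
  have h3 : P ((partialSpace hπ B Ω (n + 1)).starProjection Ω) = P Ω := by
    rw [← ContinuousLinearMap.comp_apply,
      Submodule.starProjection_comp_starProjection_of_le (partialSpace_mono hπ B Ω n.le_succ)]
  rwa [sub_apply, h3] at h1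

set_option maxHeartbeats 2000000 in
/-- Every state of `L̃` is an integral of states of the fibres, given by square summable sequences
of vectors. -/
theorem exists_integral_of_isState [MeasurableSpace 𝔇.X] [BorelSpace 𝔇.X]
    {γ : 𝔇.Ltilde →L[ℂ] ℂ} (hγ : IsState (A := 𝔇.Ltilde) γ) :
    ∃ (ν : Measure 𝔇.X) (v : ∀ x, ℕ → 𝔇.fib x), IsProbabilityMeasure ν ∧ ν.Regular ∧
      (∀ᵐ x ∂ν, HasSum (fun n => ‖v x n‖ ^ 2) 1) ∧ ∀ a : 𝔇.Ltilde,
        Integrable (fun x => ∑' n, ⟪v x n, evalAt 𝔇.fib x (a : 𝔇.Sections) (v x n)⟫_ℂ) ν ∧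
        γ a = ∫ x, ∑' n, ⟪v x n, evalAt 𝔇.fib x (a : 𝔇.Sections) (v x n)⟫_ℂ ∂ν := by
  obtain ⟨G, _, _, _, π, Ω, hπ, hΩ1, hγΩ, hΩ⟩ := IsState.exists_isRep (S := 𝔇.Ltilde) hγ isClosed_Ltilde
  obtain ⟨B, hB⟩ := exists_seq_mem_closure_iSup (mem_closure_iSup_rankOneVec hπ hΩ)
  have hlim := tendsto_starProjection_partialSpace hπ hB
  set ξ : ℕ → G := fun n =>
    (partialSpace hπ B Ω (n + 1)).starProjection Ω - (partialSpace hπ B Ω n).starProjection Ω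
  have hsq : HasSum (fun n => ‖ξ n‖ ^ 2) 1 := by
    simpa [hΩ1] using hasSum_norm_starProjection_sub_sq (partialSpace_mono hπ B Ω)
      (partialSpace_zero hπ B Ω) hlim
  have hin : ∀ a, HasSum (fun n => ⟪ξ n, π a (ξ n)⟫_ℂ) (γ a) := fun a => by
    rw [hγΩ]
    exact hasSum_inner_starProjection_sub (partialSpace_mono hπ B Ω)
      (partialSpace_zero hπ B Ω) hlim (apply_starProjection_partialSpace hπ B Ω a)
  -- Each increment ξₙ sits in a piece with the single element Bₙ, so it is an integral of vector
  -- states. The masses ‖ξₙ‖² add up to ‖Ω‖² = 1.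
  choose μ w hfin hreg hint hwi hwe using fun n =>
    exists_isIntegralOfVectors hπ (starProjection_sub_mem hπ B Ω n)
  obtain ⟨ν, v, hν, hνr, hv, h⟩ := exists_measure_of_hasSum hwi (by simpa only [hwe] using hsq)
  refine ⟨ν, v, hν, hνr, hv, fun a => ?_⟩
  have h1 := h (fun x => evalAt 𝔇.fib x (a : 𝔇.Sections)) ‖(a : 𝔇.Sections)‖
    (fun x => norm_evalAt_le _ x) fun n => (hint n).integrable a
  refine ⟨h1.1, ?_⟩
  rw [h1.2, ← (hin a).tsum_eq]
  exact tsum_congr fun n => (hint n).eq a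

end AbelianData

end HostAlgebra

/-! ### Fibre states, density operators and the conclusion. -/

namespace HostAlgebra

namespace AbelianData

variable {H : Type u} [NormedAddCommGroup H] [InnerProductSpace ℂ H] [CompleteSpace H]
variable {𝔇 : AbelianData H} [MeasurableSpace 𝔇.X] {γ : 𝔇.Ltilde →L[ℂ] ℂ} {ν : Measure 𝔇.X}
  {v : ∀ x, ℕ → 𝔇.fib x}

lemma exists_integralOfStates (hv : ∀ᵐ x ∂ν, HasSum (fun n => ‖v x n‖ ^ 2) 1)
    (h : ∀ a : 𝔇.Ltilde,
      Integrable (fun x => ∑' n, ⟪v x n, evalAt 𝔇.fib x (a : 𝔇.Sections) (v x n)⟫_ℂ) ν ∧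
      γ a = ∫ x, ∑' n, ⟪v x n, evalAt 𝔇.fib x (a : 𝔇.Sections) (v x n)⟫_ℂ ∂ν) :
    ∃ ρ : ∀ x, 𝔇.Lfib x →L[ℂ] ℂ, 𝔇.IntegralOfStates γ ν ρ := by
  classical
  -- The value 0 is used only on the null set where the vectors are not normalised.
  let ρ : ∀ x, 𝔇.Lfib x →L[ℂ] ℂ := fun x => if hx : HasSum (fun n => ‖v x n‖ ^ 2) 1 then
    (mixtureState (v x) hx).comp (𝔇.Lfib x).toSubmodule.subtypeL else 0
  have hρx : ∀ x (hx : HasSum (fun n => ‖v x n‖ ^ 2) 1),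
      ρ x = (mixtureState (v x) hx).comp (𝔇.Lfib x).toSubmodule.subtypeL := fun x hx => dif_pos hx
  have hρ : ∀ a : 𝔇.Ltilde, (fun x => ∑' n, ⟪v x n, evalAt 𝔇.fib x (a : 𝔇.Sections) (v x n)⟫_ℂ)
      =ᵐ[ν] fun x => ρ x (val a x) := fun a => by
    filter_upwards [hv] with x hx
    exact (congrArg (fun r : 𝔇.Lfib x →L[ℂ] ℂ => r (val a x)) (hρx x hx)).symm
  refine ⟨ρ, ?_, fun a => (h a).1.congr (hρ a), fun a => (h a).2.trans (integral_congr_ae (hρ a))⟩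
  filter_upwards [hv] with x hx
  rw [hρx x hx]
  exact isState_mixtureState_comp_subtype hx (𝔇.Lfib x) (rankOne_mem_Lfib x)

lemma exists_integralOfDensities (hv : ∀ᵐ x ∂ν, HasSum (fun n => ‖v x n‖ ^ 2) 1)
    (h : ∀ a : 𝔇.Ltilde,
      Integrable (fun x => ∑' n, ⟪v x n, evalAt 𝔇.fib x (a : 𝔇.Sections) (v x n)⟫_ℂ) ν ∧
      γ a = ∫ x, ∑' n, ⟪v x n, evalAt 𝔇.fib x (a : 𝔇.Sections) (v x n)⟫_ℂ ∂ν) :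
    ∃ T : ∀ x, 𝔇.fib x →L[ℂ] 𝔇.fib x, 𝔇.IntegralOfDensities γ ν T := by
  have key : ∀ x, ∃ T : 𝔇.fib x →L[ℂ] 𝔇.fib x,
      HasSum (fun n => ‖v x n‖ ^ 2) 1 → IsMixture T (v x) ∧ IsDensity T := fun x => by
    by_cases hx : HasSum (fun n => ‖v x n‖ ^ 2) 1
    · obtain ⟨T, hT⟩ := exists_isMixture hx
      exact ⟨T, fun _ => hT⟩
    · exact ⟨0, fun h => absurd h hx⟩
  choose T hT using key
  have hT' : ∀ a : 𝔇.Ltilde, (fun x => ∑' n, ⟪v x n, evalAt 𝔇.fib x (a : 𝔇.Sections) (v x n)⟫_ℂ)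
      =ᵐ[ν] fun x => trace (evalAt 𝔇.fib x (a : 𝔇.Sections) * T x) := fun a => by
    filter_upwards [hv] with x hx
    exact ((hT x hx).1.trace_mul _).symm
  exact ⟨T, hv.mono fun x hx => (hT x hx).2, fun a => (h a).1.congr (hT' a),
    fun a => (h a).2.trans (integral_congr_ae (hT' a))⟩

lemma IntegralOfDensities.existsUnique_isExtension [IsProbabilityMeasure ν]
    {T : ∀ x, 𝔇.fib x →L[ℂ] 𝔇.fib x} (h : 𝔇.IntegralOfDensities γ ν T) (hγ : IsState (A := 𝔇.Ltilde) γ) :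
    ∃! σ : 𝔇.extAlg →L[ℂ] ℂ, 𝔇.IsExtension γ σ := by
  obtain ⟨σ, hσ⟩ := h.exists_isExtension hγ
  exact ⟨σ, hσ, fun σ' hσ' => DFunLike.ext σ' σ fun b =>
    (hσ'.apply_eq hγ h b).2.trans (hσ.apply_eq hγ h b).2.symm⟩

lemma IsExtension.apply_sec [IsProbabilityMeasure ν] {σ : 𝔇.extAlg →L[ℂ] ℂ}
    {T : ∀ x, 𝔇.fib x →L[ℂ] 𝔇.fib x} (hσ : 𝔇.IsExtension γ σ) (hγ : IsState (A := 𝔇.Ltilde) γ)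
    (h : 𝔇.IntegralOfDensities γ ν T) (A : 𝔇.com) :
    Integrable (fun x => trace (𝔇.π x A * T x)) ν ∧
      σ ⟨𝔇.sec A, sec_mem_extAlg A⟩ = ∫ x, trace (𝔇.π x A * T x) ∂ν :=
  hσ.apply_eq hγ h ⟨𝔇.sec A, sec_mem_extAlg A⟩

end AbelianData

end HostAlgebra

namespace HostAlgebra

namespace AbelianData

set_option maxHeartbeats 2000000 in
/-- The fibres of `L̃` are the compact operators, and the states of `L̃` are integrals of states of
the fibres. -/
theorem Lfib_and_states {H : Type u} [NormedAddCommGroup H] [InnerProductSpace ℂ H]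
    [CompleteSpace H] (𝔇 : AbelianData H) [MeasurableSpace 𝔇.X] [BorelSpace 𝔇.X] :
    (∀ x : 𝔇.X, (𝔇.Lfib x : Set (𝔇.fib x →L[ℂ] 𝔇.fib x)) = {S : 𝔇.fib x →L[ℂ] 𝔇.fib x | IsCompactOperator S}) ∧
    ∀ γ : 𝔇.Ltilde →L[ℂ] ℂ, IsState (A := 𝔇.Ltilde) γ →
      (∃ ν : Measure 𝔇.X, IsProbabilityMeasure ν ∧ ν.Regular ∧
        ∃ ρ : ∀ x, 𝔇.Lfib x →L[ℂ] ℂ, 𝔇.IntegralOfStates γ ν ρ) ∧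
      (∃ ν : Measure 𝔇.X, IsProbabilityMeasure ν ∧ ν.Regular ∧
        ∃ T : ∀ x, 𝔇.fib x →L[ℂ] 𝔇.fib x, 𝔇.IntegralOfDensities γ ν T) ∧
      (∃! σ : 𝔇.extAlg →L[ℂ] ℂ, 𝔇.IsExtension γ σ) ∧
      ∀ σ : 𝔇.extAlg →L[ℂ] ℂ, 𝔇.IsExtension γ σ →
        ∀ (ν : Measure 𝔇.X) [IsProbabilityMeasure ν] (T : ∀ x, 𝔇.fib x →L[ℂ] 𝔇.fib x),
          𝔇.IntegralOfDensities γ ν T →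
          ∀ A : 𝔇.com, Integrable (fun x => trace (𝔇.π x A * T x)) ν ∧
            σ ⟨𝔇.sec A, sec_mem_extAlg A⟩ = ∫ x, trace (𝔇.π x A * T x) ∂ν := by
  refine ⟨coe_Lfib, fun γ hγ => ?_⟩
  obtain ⟨ν, v, hν, hνr, hv, h⟩ := exists_integral_of_isState hγ
  obtain ⟨ρ, hρ⟩ := exists_integralOfStates hv h
  obtain ⟨T, hT⟩ := exists_integralOfDensities hv h
  refine ⟨⟨ν, hν, hνr, ρ, hρ⟩, ⟨ν, hν, hνr, T, hT⟩, ?_, ?_⟩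
  · exact hT.existsUnique_isExtension hγ
  · intro σ hσ ν1 _ T1 hT1 A
    exact hσ.apply_sec hγ hT1 A

end AbelianData

end HostAlgebra

theorem theorem2p8 {F : Type u} [NonUnitalCStarAlgebra F] [PartialOrder F] [StarOrderedRing F]
    (ω : F →L[ℂ] ℂ) (hω : IsState ω)
    (C : VonNeumannAlgebra (GNSSpace hω.toPositive))
    (hC : ∀ c ∈ C, ∀ d ∈ C, c * d = d * c)
    (hCF : ∀ c ∈ C, ∀ f : F, c * gnsRep' hω.toPositive f = gnsRep' hω.toPositive f * c)
    (𝔇 : AbelianData (GNSSpace hω.toPositive)) (h𝔇 : 𝔇 = stateData hω C hC hCF)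
    [MeasurableSpace 𝔇.X] [BorelSpace 𝔇.X] :
    (∀ x : 𝔇.X, (𝔇.Lfib x : Set (𝔇.fib x →L[ℂ] 𝔇.fib x)) = {S : 𝔇.fib x →L[ℂ] 𝔇.fib x | IsCompactOperator S}) ∧
    ∀ γ : 𝔇.Ltilde →L[ℂ] ℂ, IsState γ →
      (∃ ν : Measure 𝔇.X, IsProbabilityMeasure ν ∧ ν.Regular ∧
        ∃ ρ : ∀ x, 𝔇.Lfib x →L[ℂ] ℂ, 𝔇.IntegralOfStates γ ν ρ) ∧
      (∃ ν : Measure 𝔇.X, IsProbabilityMeasure ν ∧ ν.Regular ∧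
        ∃ T : ∀ x, 𝔇.fib x →L[ℂ] 𝔇.fib x, 𝔇.IntegralOfDensities γ ν T) ∧
      (∃! σ : 𝔇.extAlg →L[ℂ] ℂ, 𝔇.IsExtension γ σ) ∧
      ∀ σ : 𝔇.extAlg →L[ℂ] ℂ, 𝔇.IsExtension γ σ →
        ∀ (ν : Measure 𝔇.X) [IsProbabilityMeasure ν] (T : ∀ x, 𝔇.fib x →L[ℂ] 𝔇.fib x),
          𝔇.IntegralOfDensities γ ν T →
          ∀ A : 𝔇.com, Integrable (fun x => trace (𝔇.π x A * T x)) ν ∧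
            σ ⟨𝔇.sec A, AbelianData.sec_mem_extAlg A⟩ = ∫ x, trace (𝔇.π x A * T x) ∂ν := by
  exact 𝔇.Lfib_and_states
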